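/- Star Partition is the following decision problem: given an undirected $n$-vertex graph $G=(V,E)$ and an integer $s\in\mathbb N$, can $V$ be partitioned into $k:=\lceil n/(s+1)\rceil$ disjoint subsets $V_1,\dots,V_k$ such that each induced subgraph $G[V_i]$ contains a star $K_{1,s}$ (not necessarily induced)? A bipartite permutation graph is a bipartite graph that is also a permutation graph, i.e. for some numbering of its vertices by $1,\dots,n$ and some permutation $\pi$, two vertices are adjacent if and only if $\pi$ inverts their numbers. (1) Star Partition is solvable in $O(n^2)$ time on bipartite permutation graphs. That is, there is a program for a word RAM with unit-cost operations and words of $O(\log(n+s))$ bits which, given $n$, $s$ and the adjacency matrix of a bipartite permutation graph $G$ on $n$ vertices, halts after $O(n^2)$ steps, with a constant depending on neither $G$ nor $s$ (for $n=0$ read: $O(1)$), and correctly answers whether $(G,s)$ is a yes-instance of Star Partition. (2) Let $G$ be a finite bipartite graph with bipartition $(U,W)$ and a strong ordering $\prec$: the union of total orders of $U$ and of $W$ such that for all edges $\{u,w\},\{u',w'\}$ with $u,u'\in U$, $w,w'\in W$, $u\prec u'$ and $w'\prec w$, also $\{u,w'\}$ and $\{u',w\}$ are edges. An $s$-star partition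 of $G$ is a set of pairwise disjoint stars in $G$, each consisting of a center and $s$ leaves adjacent to it, that together cover all vertices. The scope of a star is the set of vertices from its leftmost to its rightmost leaf with respect to $\prec$, and its width is the size of its scope. Two edges $\{u,w\},\{u',w'\}$ cross if $u\prec u'$ and $w'\prec w$, or $u'\prec u$ and $w\prec w'$; the edge-crossing number of two stars is the number of crossing pairs of an edge of one and an edge of the other. The score of an $s$-star partition is the pair consisting of the sum of the widths of its stars and the sum of the edge-crossing numbers over all pairs of distinct stars; scores are compared lexicographically. Two stars are non-crossing if their edge-crossing number is zero, and interleaving if the center of each lies in the scope of the other. Then every $s$-star partition $P$ of $G$ of minimum score is good, i.e. any two distinct stars of $P$ are non-crossing or interleaving, and every star of $P$ is interleaving with at most one other star of $P$. -/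

import Mathlib

namespace StarPart

open scoped Classical

/-! ## The decision problem -/

/-- The star `K_{1,s}`. -/
abbrev starGraph (s : ℕ) : SimpleGraph (Fin 1 ⊕ Fin s) :=
  completeBipartiteGraph (Fin 1) (Fin s)

/-- The yes-instances `(G, s)` of Star Partition: the vertex set can be partitioned into
`⌈n / (s + 1)⌉` disjoint sets, each of which induces a subgraph that contains a (not necessarily induced)
`K_{1,s}`. -/
def HasStarPartition {V : Type*} [Fintype V] (G : SimpleGraph V) (s : ℕ) : Prop :=
  ∃ X : Fin ⌈(Fintype.card V : ℚ) / ((s : ℚ) + 1)⌉₊ → Set V,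
    (∀ i j, i ≠ j → Disjoint (X i) (X j)) ∧ (⋃ i, X i) = Set.univ ∧
    ∀ i, (starGraph s).IsContained (G.induce (X i))

/-! ## Graph classes -/

/-- Permutation graphs: for a numbering `e` of the vertices and a permutation `π`, two vertices are
adjacent if and only if `π` inverts them. -/
def IsPermutationGraph {V : Type*} [Fintype V] (G : SimpleGraph V) : Prop :=
  ∃ (e : V ≃ Fin (Fintype.card V)) (π : Equiv.Perm (Fin (Fintype.card V))),
    ∀ u v, G.Adj u v ↔
      (e u < e v ∧ π (e v) < π (e u)) ∨ (e v < e u ∧ π (e u) < π (e v))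

/-- Bipartite permutation graphs: bipartite graphs that are permutation graphs. -/
def IsBipartitePermutationGraph {V : Type*} [Fintype V] (G : SimpleGraph V) : Prop :=
  G.IsBipartite ∧ IsPermutationGraph G

/-- A bipartition `(U, W)` of `G` with a strong ordering `lt`: the union of a (strict) total order
of `U` and a (strict) total order of `W` such that any two crossing edges `uw`, `u'w'` come with the
edges `uw'` and `u'w`. -/
structure StrongOrdering {V : Type*} (G : SimpleGraph V) where
  U : Set V
  W : Set V
  bipartite : G.IsBipartiteWith U W
  cover : U ∪ W = Set.univ
  lt : V → V → Prop
  lt_same_side : ∀ {x y}, lt x y → (x ∈ U ∧ y ∈ U) ∨ (x ∈ W ∧ y ∈ W)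
  lt_irrefl : ∀ x, ¬ lt x x
  lt_trans : ∀ {x y z}, lt x y → lt y z → lt x z
  total_U : ∀ {x y}, x ∈ U → y ∈ U → lt x y ∨ x = y ∨ lt y x
  total_W : ∀ {x y}, x ∈ W → y ∈ W → lt x y ∨ x = y ∨ lt y x
  strong : ∀ {u u' w w'}, u ∈ U → u' ∈ U → w ∈ W → w' ∈ W →
    G.Adj u w → G.Adj u' w' → lt u u' → lt w' w → G.Adj u w' ∧ G.Adj u' w

/-! ## Star partitions with their centers, and their score

A star is recorded as its center together with the set of its leaves. In a bipartite graph the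
center is determined by the vertex set as soon as there are at least two leaves. -/

/-- A center and a set of leaves. -/
@[ext]
structure CenteredStar (V : Type*) where
  center : V
  leaves : Finset V

namespace CenteredStar

variable {V : Type*}

/-- The vertex set of a star. -/
noncomputable def verts (X : CenteredStar V) : Finset V := insert X.center X.leaves

/-- The edges of a star. -/
noncomputable def edges (X : CenteredStar V) : Finset (Sym2 V) :=
  X.leaves.image fun v => s(X.center, v)

/-- `X` is an `s`-star that is a subgraph of `G`. -/
def IsStarOf (X : CenteredStar V) (G : SimpleGraph V) (s : ℕ) : Prop :=
  X.leaves.card = s ∧ ∀ v ∈ X.leaves, G.Adj X.center v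

end CenteredStar

/-- `P` is an `s`-star partition of `G`: pairwise disjoint `s`-stars of `G` that cover all
vertices. -/
def IsStarPartition {V : Type*} (G : SimpleGraph V) (s : ℕ) (P : Finset (CenteredStar V)) : Prop :=
  (∀ X ∈ P, X.IsStarOf G s) ∧
  (∀ X ∈ P, ∀ Y ∈ P, X ≠ Y → Disjoint X.verts Y.verts) ∧
  ∀ v, ∃ X ∈ P, v ∈ X.verts

namespace StrongOrdering

variable {V : Type*} {G : SimpleGraph V}

/-- The reflexive closure of the strong ordering. -/
def le (O : StrongOrdering G) (x y : V) : Prop := x = y ∨ O.lt x y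

variable [Fintype V]

/-- The scope of a star: the vertices from its leftmost to its rightmost leaf, that is, those that
lie between two leaves. -/
noncomputable def scope (O : StrongOrdering G) (X : CenteredStar V) : Finset V :=
  Finset.univ.filter fun v => (∃ a ∈ X.leaves, O.le a v) ∧ ∃ b ∈ X.leaves, O.le v b

/-- The width of a star. -/
noncomputable def width (O : StrongOrdering G) (X : CenteredStar V) : ℕ := (O.scope X).card

/-- Two edges `uw` and `u'w'` cross. -/
def Crosses (O : StrongOrdering G) (e e' : Sym2 V) : Prop :=
  ∃ u ∈ O.U, ∃ w ∈ O.W, ∃ u' ∈ O.U, ∃ w' ∈ O.W, e = s(u, w) ∧ e' = s(u', w') ∧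
    ((O.lt u u' ∧ O.lt w' w) ∨ (O.lt u' u ∧ O.lt w w'))

/-- The edge-crossing number of two stars. -/
noncomputable def crossingNumber (O : StrongOrdering G) (X Y : CenteredStar V) : ℕ :=
  ((X.edges ×ˢ Y.edges).filter fun p => O.Crosses p.1 p.2).card

/-- Two stars are non-crossing. -/
def NonCrossing (O : StrongOrdering G) (X Y : CenteredStar V) : Prop := O.crossingNumber X Y = 0

/-- Two stars are interleaving: each center lies in the scope of the other star. -/
def Interleaving (O : StrongOrdering G) (X Y : CenteredStar V) : Prop :=
  X.center ∈ O.scope Y ∧ Y.center ∈ O.scope X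

/-- The width of a star partition. -/
noncomputable def totalWidth (O : StrongOrdering G) (P : Finset (CenteredStar V)) : ℕ :=
  ∑ X ∈ P, O.width X

/-- The edge-crossing number of a star partition, summed over the ordered pairs of distinct stars
(so each unordered pair counts twice, which does not affect any comparison of scores). -/
noncomputable def totalCrossing (O : StrongOrdering G) (P : Finset (CenteredStar V)) : ℕ :=
  ∑ p ∈ P.offDiag, O.crossingNumber p.1 p.2

/-- The score of a star partition: the pair (width, edge-crossing number), in the lexicographical
order. -/
noncomputable def score (O : StrongOrdering G) (P : Finset (CenteredStar V)) : ℕ ×ₗ ℕ :=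
  toLex (O.totalWidth P, O.totalCrossing P)

/-- `P` is an `s`-star partition of minimum score. -/
def IsMinScore (O : StrongOrdering G) (s : ℕ) (P : Finset (CenteredStar V)) : Prop :=
  IsStarPartition G s P ∧ ∀ Q, IsStarPartition G s Q → O.score P ≤ O.score Q

/-- `P` is good: any two distinct stars are non-crossing or interleaving. -/
def IsGood (O : StrongOrdering G) (P : Finset (CenteredStar V)) : Prop :=
  ∀ X ∈ P, ∀ Y ∈ P, X ≠ Y → O.NonCrossing X Y ∨ O.Interleaving X Y

end StrongOrdering

/-! ## Random access machine

A word RAM with finitely many registers (those named in the program), a random access memory, and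
bounded words. Every arithmetic operation, constant, register access, memory access, assignment and
test costs one step. -/

/-- The contents of the registers and of the memory. -/
structure State where
  reg : ℕ → ℕ
  mem : ℕ → ℕ

/-- Arithmetic expressions; `load a` reads the memory cell with address `a`, and `sub` is truncated
subtraction. -/
inductive Expr where
  | const (k : ℕ)
  | reg (i : ℕ)
  | load (a : Expr)
  | add (a b : Expr)
  | sub (a b : Expr)
  | mul (a b : Expr)

namespace Expr

/-- The value of an expression. -/
def eval (σ : State) : Expr → ℕ
  | const k => k
  | reg i => σ.reg i
  | load a => σ.mem (a.eval σ)
  | add a b => a.eval σ + b.eval σ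
  | sub a b => a.eval σ - b.eval σ
  | mul a b => a.eval σ * b.eval σ

/-- The number of operations in an expression. -/
def cost : Expr → ℕ
  | const _ => 1
  | reg _ => 1
  | load a => a.cost + 1
  | add a b => a.cost + b.cost + 1
  | sub a b => a.cost + b.cost + 1
  | mul a b => a.cost + b.cost + 1

/-- All numbers that occur in the evaluation of an expression (addresses included) are less
than `B`. -/
def Fits (B : ℕ) (σ : State) : Expr → Prop
  | const k => k < B
  | reg i => σ.reg i < B
  | load a => a.Fits B σ ∧ σ.mem (a.eval σ) < B
  | add a b => a.Fits B σ ∧ b.Fits B σ ∧ a.eval σ + b.eval σ < B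
  | sub a b => a.Fits B σ ∧ b.Fits B σ
  | mul a b => a.Fits B σ ∧ b.Fits B σ ∧ a.eval σ * b.eval σ < B

end Expr

/-- Programs: assignment to a register, assignment to a memory cell, sequence, and branching and
looping on `e ≠ 0`. -/
inductive Program where
  | skip
  | set (i : ℕ) (e : Expr)
  | store (a e : Expr)
  | seq (p q : Program)
  | cond (e : Expr) (p q : Program)
  | loop (e : Expr) (p : Program)

/-- `Exec B p σ t τ`: started in state `σ`, the program `p` halts after exactly `t` steps in state
`τ`, and all numbers it computes are less than `B`. -/
inductive Exec (B : ℕ) : Program → State → ℕ → State → Prop where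
  | skip (σ : State) : Exec B .skip σ 1 σ
  | set (σ : State) (i : ℕ) (e : Expr) : e.Fits B σ →
      Exec B (.set i e) σ (e.cost + 1) ⟨Function.update σ.reg i (e.eval σ), σ.mem⟩
  | store (σ : State) (a e : Expr) : a.Fits B σ → e.Fits B σ →
      Exec B (.store a e) σ (a.cost + e.cost + 1)
        ⟨σ.reg, Function.update σ.mem (a.eval σ) (e.eval σ)⟩
  | seq {σ τ υ : State} {p q : Program} {t t' : ℕ} :
      Exec B p σ t τ → Exec B q τ t' υ → Exec B (.seq p q) σ (t + t') υ
  | cond_true {σ τ : State} {e : Expr} {p q : Program} {t : ℕ} :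
      e.Fits B σ → e.eval σ ≠ 0 → Exec B p σ t τ → Exec B (.cond e p q) σ (e.cost + 1 + t) τ
  | cond_false {σ τ : State} {e : Expr} {p q : Program} {t : ℕ} :
      e.Fits B σ → e.eval σ = 0 → Exec B q σ t τ → Exec B (.cond e p q) σ (e.cost + 1 + t) τ
  | loop_done {σ : State} {e : Expr} {p : Program} :
      e.Fits B σ → e.eval σ = 0 → Exec B (.loop e p) σ (e.cost + 1) σ
  | loop_step {σ τ υ : State} {e : Expr} {p : Program} {t t' : ℕ} :
      e.Fits B σ → e.eval σ ≠ 0 → Exec B p σ t τ → Exec B (.loop e p) τ t' υ →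
      Exec B (.loop e p) σ (e.cost + 1 + t + t') υ

/-- The instance `(G, s)` as input: `n` in register `0`, `s` in register `1`, the adjacency matrix of
`G` row by row in the memory cells `0, …, n² - 1`, and zeros everywhere else. -/
noncomputable def inputState {n : ℕ} (G : SimpleGraph (Fin n)) (s : ℕ) : State where
  reg i := if i = 0 then n else if i = 1 then s else 0
  mem a := if ∃ i j : Fin n, a = (i : ℕ) * n + (j : ℕ) ∧ G.Adj i j then 1 else 0

/-- Star Partition, restricted to the graphs in the class `K`, is solved by a word RAM with words of
`O(log (n + s))` bits in `O(T n)` steps (up to an additive constant), where `n` is the number of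
vertices. The answer is left in register `0`: one for yes, zero for no. -/
def SolvableInTime (K : ∀ n : ℕ, SimpleGraph (Fin n) → Prop) (T : ℕ → ℕ) : Prop :=
  ∃ (p : Program) (C D : ℕ), ∀ (n s : ℕ) (G : SimpleGraph (Fin n)), K n G →
    ∃ (t : ℕ) (τ : State), Exec ((n + s + 2) ^ D) p (inputState G s) t τ ∧
      t ≤ C * T n + C ∧
      ((HasStarPartition G s ∧ τ.reg 0 = 1) ∨ (¬ HasStarPartition G s ∧ τ.reg 0 = 0))

end StarPart

/-!
**Minimum score.** Let `P` be a star partition of minimum score. Redistributing the vertices of two of its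
stars among two new stars gives another star partition, so this cannot lower the score
(`IsMinScore.not_exchange`). If two stars with centers on the same side cross, then, because the ordering is
strong, the first center is adjacent to the `s` smallest of all their leaves and the second one to the
others; this exchange does not increase the widths or the crossings with third stars, and it removes the
crossings of the two stars. If two stars with centers on different sides cross and do not interleave, the
leaves of one of them, say `Y`, all lie beyond the center of the other one, `X`. The last leaf of `X` is
then adjacent to all leaves of `Y` and can become their center, while the center of `Y` becomes a leaf
of `X`; an induction on the gap between the center of `Y` and the leaves of `X` makes this an improvement.
That a star interleaves with at most one other star follows from the first case.

**A recursion.** Hence, if there is a star partition, there is one in which prefixes of the two sides grow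
in turn by one star with consecutive leaves, or by an interleaving pair of stars whose `s + 1` vertices on
either side are consecutive. The relation `Reach` describes this; `reach_iff_hasStarPartition` is the
correctness of the recursion. With tables of run lengths and of the last possible centers, each of its
`O(n²)` entries takes constant time (`reach_iff_tables`).

**Finding a strong ordering.** A numbering that makes `G` a permutation graph yields a strong
ordering, which the algorithm has to find. Breadth-first search from an arbitrary vertex of each component
ends in a layer that contains a twin of a first or last vertex of its side; among the vertices of the last
layer such a twin is found by minimizing the degree. A second search from these vertices gives layers in
which the neighborhoods in the next and in the previous layer are nested
(`Layering.nestedLayers`), so it suffices to sort by layer and by the difference of the two degrees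
(`layerOrdering`).

**Running time.** The algorithm is written in a language with two-dimensional arrays and bounded loops,
`Cmd`. Its programs are verified by weakest preconditions, with a frame rule; a command with loops of
nesting depth `d` takes `O((n + 1) ^ d)` steps, and its compilation to the word RAM is correct once and for
all (`Cmd.exec_comp`). The arrays are interleaved in the memory by an injective polynomial, so that all
addresses are polynomial in the stored values and fit into words of `O(log (n + s))` bits.
-/


namespace StarPart

open scoped Classical

/-! ### A structured language over two-dimensional arrays, compiled to the word RAM -/

/-- The state of the structured language: registers, and arrays `arr k` with two indices. -/
structure Store where
  reg : ℕ → ℕ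
  arr : ℕ → ℕ → ℕ → ℕ

namespace Store

/-- The store after an assignment to a register. -/
def setReg (h : Store) (i v : ℕ) : Store := ⟨fun j => if j = i then v else h.reg j, h.arr⟩

/-- The store after an assignment to an array entry. -/
def setArr (h : Store) (k i j v : ℕ) : Store :=
  ⟨h.reg, fun k' i' j' => if k' = k ∧ i' = i ∧ j' = j then v else h.arr k' i' j'⟩

@[simp] theorem setReg_reg (h : Store) (i v j : ℕ) :
    (h.setReg i v).reg j = if j = i then v else h.reg j := rfl
@[simp] theorem setReg_arr (h : Store) (i v : ℕ) : (h.setReg i v).arr = h.arr := rfl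
@[simp] theorem setArr_reg (h : Store) (k i j v : ℕ) : (h.setArr k i j v).reg = h.reg := rfl
@[simp] theorem setArr_arr (h : Store) (k i j v k' i' j' : ℕ) :
    (h.setArr k i j v).arr k' i' j' =
      if k' = k ∧ i' = i ∧ j' = j then v else h.arr k' i' j' := rfl

end Store

/-- Expressions of the structured language. -/
inductive Ex where
  | c (k : ℕ)
  | r (i : ℕ)
  | arr (k : ℕ) (i j : Ex)
  | add (a b : Ex)
  | sub (a b : Ex)
  | mul (a b : Ex)

/-- Commands of the structured language. `fetch k i j` copies the input bit at row `reg i` and column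
`reg j` to the array `k`; `loop i b p` runs `p` with register `i` set to `0, …, reg b - 1` in turn. -/
inductive Cmd where
  | skip
  | set (i : ℕ) (e : Ex)
  | put (k : ℕ) (i j e : Ex)
  | fetch (k i j : ℕ)
  | seq (p q : Cmd)
  | ite (e : Ex) (p q : Cmd)
  | loop (i b : ℕ) (p : Cmd)

namespace Ex

/-- The value of an expression. -/
def val (h : Store) : Ex → ℕ
  | c k => k
  | r i => h.reg i
  | arr k i j => h.arr k (i.val h) (j.val h)
  | add a b => a.val h + b.val h
  | sub a b => a.val h - b.val h
  | mul a b => a.val h * b.val h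

end Ex

/-- An injection of triples into the natural numbers that is computable without division. -/
def code (k i j : ℕ) : ℕ :=
  (((i + j) * (i + j) + i) + k) * (((i + j) * (i + j) + i) + k) + ((i + j) * (i + j) + i)

theorem sq_add_inj {a b c d : ℕ} (h : (a + b) * (a + b) + a = (c + d) * (c + d) + c) :
    a = c ∧ b = d := by
  have h1 : a + b = c + d := by
    rcases lt_trichotomy (a + b) (c + d) with h' | h' | h'
    · exfalso; nlinarith
    · exact h'
    · exfalso; nlinarith
  rw [h1] at h
  omega

theorem code_inj {k i j k' i' j' : ℕ} (h : code k i j = code k' i' j') :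
    k = k' ∧ i = i' ∧ j = j' := by
  obtain ⟨h1, h2⟩ := sq_add_inj h
  obtain ⟨h3, h4⟩ := sq_add_inj h1
  exact ⟨h2, h3, h4⟩

/-- The expression for `(i + j)² + i`. -/
def pairExpr (i j : Expr) : Expr := .add (.mul (.add i j) (.add i j)) i

/-- The expression for the address of an array entry: the arrays live behind the input, whose length
`n²` is kept in register `2`. -/
def addrExpr (k : ℕ) (i j : Expr) : Expr := .add (.reg 2) (pairExpr (pairExpr i j) (.const k))

/-- Compilation of expressions. -/
def Ex.comp : Ex → Expr
  | .c k => .const k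
  | .r i => .reg i
  | .arr k i j => .load (addrExpr k i.comp j.comp)
  | .add a b => .add a.comp b.comp
  | .sub a b => .sub a.comp b.comp
  | .mul a b => .mul a.comp b.comp

namespace Cmd

/-- Compilation of commands. -/
def comp : Cmd → Program
  | skip => .skip
  | set i e => .set i e.comp
  | put k i j e => .store (addrExpr k i.comp j.comp) e.comp
  | fetch k i j => .store (addrExpr k (.reg i) (.reg j))
      (.load (.add (.mul (.reg i) (.reg 0)) (.reg j)))
  | seq p q => .seq p.comp q.comp
  | ite e p q => .cond e.comp p.comp q.comp
  | loop i b p => .seq (.set i (.const 0))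
      (.loop (.sub (.reg b) (.reg i)) (.seq p.comp (.set i (.add (.reg i) (.const 1)))))

/-- Whether a command may write to register `i`. -/
def writesReg (i : ℕ) : Cmd → Bool
  | skip => false
  | set j _ => j == i
  | put _ _ _ _ => false
  | fetch _ _ _ => false
  | seq p q => p.writesReg i || q.writesReg i
  | ite _ p q => p.writesReg i || q.writesReg i
  | loop j _ p => j == i || p.writesReg i

/-- Whether a command may write to the array `k`. -/
def writesArr (k : ℕ) : Cmd → Bool
  | skip => false
  | set _ _ => false
  | put k' _ _ _ => k' == k
  | fetch k' _ _ => k' == k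
  | seq p q => p.writesArr k || q.writesArr k
  | ite _ p q => p.writesArr k || q.writesArr k
  | loop _ _ p => p.writesArr k

/-- Well-formed commands: the registers `0`, `2`, `3` (for `n`, `n²` and `n + 1`) are never written,
every loop runs up to the value of register `0` or `3`, and no loop counter is changed in its body. -/
def wf : Cmd → Bool
  | skip => true
  | set i _ => i != 0 && i != 2 && i != 3
  | put _ _ _ _ => true
  | fetch _ _ _ => true
  | seq p q => p.wf && q.wf
  | ite _ p q => p.wf && q.wf
  | loop i b p => i != 0 && i != 2 && i != 3 && (b == 0 || b == 3) && !p.writesReg i && p.wf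

/-- An upper bound for the running time when no loop has more than `N` rounds. -/
def time (N : ℕ) : Cmd → ℕ
  | skip => 1
  | set _ e => e.comp.cost + 1
  | put k i j e => (addrExpr k i.comp j.comp).cost + e.comp.cost + 1
  | fetch k i j => (addrExpr k (.reg i) (.reg j)).cost + 7
  | seq p q => p.time N + q.time N
  | ite e p q => e.comp.cost + 1 + (p.time N + q.time N)
  | loop _ _ p => 6 + N * (p.time N + 8)

/-- The nesting depth of the loops. -/
def depth : Cmd → ℕ
  | skip => 0
  | set _ _ => 0
  | put _ _ _ _ => 0
  | fetch _ _ _ => 0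
  | seq p q => max p.depth q.depth
  | ite _ p q => max p.depth q.depth
  | loop _ _ p => p.depth + 1

theorem exists_time_le (p : Cmd) : ∃ K, ∀ N, 1 ≤ N → p.time N ≤ K * N ^ p.depth := by
  have mono : ∀ {K N a b : ℕ}, 1 ≤ N → a ≤ b → K * N ^ a ≤ K * N ^ b := fun hN hab =>
    Nat.mul_le_mul_left _ (Nat.pow_le_pow_right hN hab)
  induction p with
  | skip => exact ⟨1, fun N _ => by simp [time, depth]⟩
  | set i e => exact ⟨_, fun N _ => by simp only [time, depth, pow_zero, mul_one]; exact le_rfl⟩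
  | put k i j e => exact ⟨_, fun N _ => by simp only [time, depth, pow_zero, mul_one]; exact le_rfl⟩
  | fetch k i j => exact ⟨_, fun N _ => by simp only [time, depth, pow_zero, mul_one]; exact le_rfl⟩
  | seq p q hp hq =>
    obtain ⟨K, hK⟩ := hp
    obtain ⟨L, hL⟩ := hq
    refine ⟨K + L, fun N hN => ?_⟩
    have h1 := (hK N hN).trans (mono hN (le_max_left p.depth q.depth))
    have h2 := (hL N hN).trans (mono hN (le_max_right p.depth q.depth))
    simp only [time, depth, add_mul]
    omega
  | ite e p q hp hq =>
    obtain ⟨K, hK⟩ := hp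
    obtain ⟨L, hL⟩ := hq
    refine ⟨e.comp.cost + 1 + (K + L), fun N hN => ?_⟩
    have h1 := (hK N hN).trans (mono hN (le_max_left p.depth q.depth))
    have h2 := (hL N hN).trans (mono hN (le_max_right p.depth q.depth))
    have h3 : (e.comp.cost + 1) * 1 ≤ (e.comp.cost + 1) * N ^ max p.depth q.depth :=
      Nat.mul_le_mul_left _ (Nat.one_le_pow _ _ hN)
    simp only [time, depth, add_mul _ (K + L), add_mul K L]
    omega
  | loop i b p hp =>
    obtain ⟨K, hK⟩ := hp
    refine ⟨6 + (K + 8), fun N hN => ?_⟩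
    have h1 := hK N hN
    have h2 : 1 ≤ N ^ p.depth := Nat.one_le_pow _ _ hN
    have h3 : 6 * 1 ≤ 6 * N ^ (p.depth + 1) := Nat.mul_le_mul_left _ (Nat.one_le_pow _ _ hN)
    have h4 : N * (p.time N + 8) ≤ N * ((K + 8) * N ^ p.depth) := by
      apply Nat.mul_le_mul_left; nlinarith
    simp only [time, depth]
    calc 6 + N * (p.time N + 8) ≤ 6 * N ^ (p.depth + 1) + N * ((K + 8) * N ^ p.depth) := by omega
      _ = _ := by ring

/-! ### Weakest preconditions -/

variable (M n : ℕ)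

/-- A precondition under which a command establishes the postcondition `Q` and stores only values up
to `M`. The input is addressed only inside the `n × n` matrix `inp`. -/
def wp (inp : ℕ → ℕ → ℕ) : Cmd → (Store → Prop) → Store → Prop
  | skip, Q, h => Q h
  | set i e, Q, h => e.val h ≤ M ∧ Q (h.setReg i (e.val h))
  | put k i j e, Q, h => e.val h ≤ M ∧ Q (h.setArr k (i.val h) (j.val h) (e.val h))
  | fetch k i j, Q, h => h.reg i < n ∧ h.reg j < n ∧
      Q (h.setArr k (h.reg i) (h.reg j) (inp (h.reg i) (h.reg j)))
  | seq p q, Q, h => wp inp p (wp inp q Q) h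
  | ite e p q, Q, h => (e.val h ≠ 0 → wp inp p Q h) ∧ (e.val h = 0 → wp inp q Q h)
  | loop i b p, Q, h => ∃ Inv : ℕ → Store → Prop, Inv 0 h ∧
      (∀ k, k < h.reg b → ∀ h', Inv k h' → wp inp p (Inv (k + 1)) (h'.setReg i k)) ∧
      ∀ h', Inv (h.reg b) h' → Q (h'.setReg i (h.reg b))

variable {M n} {inp : ℕ → ℕ → ℕ}

theorem wp_mono {p : Cmd} {Q R : Store → Prop} (hQR : ∀ h, Q h → R h) {h : Store}
    (hp : wp M n inp p Q h) : wp M n inp p R h := by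
  induction p generalizing Q R h with
  | skip => exact hQR _ hp
  | set i e => exact ⟨hp.1, hQR _ hp.2⟩
  | put k i j e => exact ⟨hp.1, hQR _ hp.2⟩
  | fetch k i j => exact ⟨hp.1, hp.2.1, hQR _ hp.2.2⟩
  | seq p q hp' hq' => exact hp' (fun _ h1 => hq' hQR h1) hp
  | ite e p q hp' hq' => exact ⟨fun h0 => hp' hQR (hp.1 h0), fun h0 => hq' hQR (hp.2 h0)⟩
  | loop i b p hp' =>
    obtain ⟨Inv, h1, h2, h3⟩ := hp
    exact ⟨Inv, h1, h2, fun h' hI => hQR _ (h3 h' hI)⟩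

/-- The frame of a command: what it cannot write keeps its value. -/
def Frame (p : Cmd) (h h' : Store) : Prop :=
  (∀ i, p.writesReg i = false → h'.reg i = h.reg i) ∧
  ∀ k, p.writesArr k = false → h'.arr k = h.arr k

theorem wp_frame_of_le {p c : Cmd} {Q : Store → Prop} {h₀ h : Store}
    (hr : ∀ i, c.writesReg i = false → p.writesReg i = false)
    (ha : ∀ k, c.writesArr k = false → p.writesArr k = false)
    (hf : Frame c h₀ h) (hp : wp M n inp p Q h) :
    wp M n inp p (fun h' => Q h' ∧ Frame c h₀ h') h := by
  induction p generalizing Q h with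
  | skip => exact ⟨hp, hf⟩
  | set i e =>
    refine ⟨hp.1, hp.2, fun j hj => ?_, fun k hk => hf.2 k hk⟩
    have := hr j hj
    simp only [writesReg, beq_eq_false_iff_ne, ne_eq] at this
    simp [Ne.symm this, hf.1 j hj]
  | put k i j e =>
    refine ⟨hp.1, hp.2, fun j hj => hf.1 j hj, fun k' hk => ?_⟩
    have := ha k' hk
    simp only [writesArr, beq_eq_false_iff_ne, ne_eq] at this
    funext a b
    simp [Ne.symm this, hf.2 k' hk]
  | fetch k i j =>
    refine ⟨hp.1, hp.2.1, hp.2.2, fun j hj => hf.1 j hj, fun k' hk => ?_⟩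
    have := ha k' hk
    simp only [writesArr, beq_eq_false_iff_ne, ne_eq] at this
    funext a b
    simp [Ne.symm this, hf.2 k' hk]
  | seq p q hp' hq' =>
    have hr' : ∀ i, c.writesReg i = false → p.writesReg i = false ∧ q.writesReg i = false :=
      fun i hi => by simpa [writesReg] using hr i hi
    have ha' : ∀ i, c.writesArr i = false → p.writesArr i = false ∧ q.writesArr i = false :=
      fun i hi => by simpa [writesArr] using ha i hi
    have := hp' (fun i hi => (hr' i hi).1) (fun i hi => (ha' i hi).1) hf hp
    exact wp_mono (fun h1 h2 => hq' (fun i hi => (hr' i hi).2) (fun i hi => (ha' i hi).2)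
      h2.2 h2.1) this
  | ite e p q hp' hq' =>
    have hr' : ∀ i, c.writesReg i = false → p.writesReg i = false ∧ q.writesReg i = false :=
      fun i hi => by simpa [writesReg] using hr i hi
    have ha' : ∀ i, c.writesArr i = false → p.writesArr i = false ∧ q.writesArr i = false :=
      fun i hi => by simpa [writesArr] using ha i hi
    exact ⟨fun h0 => hp' (fun i hi => (hr' i hi).1) (fun i hi => (ha' i hi).1) hf (hp.1 h0),
      fun h0 => hq' (fun i hi => (hr' i hi).2) (fun i hi => (ha' i hi).2) hf (hp.2 h0)⟩
  | loop i b p hp' =>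
    have hr' : ∀ j, c.writesReg j = false → i ≠ j ∧ p.writesReg j = false :=
      fun j hj => by simpa [writesReg] using hr j hj
    have setf : ∀ {h' : Store} (v : ℕ), Frame c h₀ h' → Frame c h₀ (h'.setReg i v) := by
      refine fun v h' => ⟨fun j hj => ?_, h'.2⟩
      simp [(hr' j hj).1.symm, h'.1 j hj]
    obtain ⟨Inv, h1, h2, h3⟩ := hp
    refine ⟨fun k h' => Inv k h' ∧ Frame c h₀ h', ⟨h1, hf⟩, fun k hk h' hI => ?_, fun h' hI => ?_⟩
    · exact hp' (fun j hj => (hr' j hj).2) ha (setf k hI.2) (h2 k hk h' hI.1)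
    · exact ⟨h3 h' hI.1, setf _ hI.2⟩

theorem wp_frame {p : Cmd} {Q : Store → Prop} {h : Store} (hp : wp M n inp p Q h) :
    wp M n inp p (fun h' => Q h' ∧ Frame p h h') h :=
  wp_frame_of_le (fun _ h => h) (fun _ h => h) ⟨fun _ _ => rfl, fun _ _ => rfl⟩ hp

/-- The sequencing rule, with the frame of the first command available for the second. -/
theorem wp_seq {p q : Cmd} {Q R : Store → Prop} {h : Store} (hp : wp M n inp p Q h)
    (hq : ∀ h', Q h' → Frame p h h' → wp M n inp q R h') : wp M n inp (.seq p q) R h :=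
  wp_mono (fun h' h1 => hq h' h1.1 h1.2) (wp_frame hp)

/-- The loop rule, with the frame of the body available in every round. -/
theorem wp_loop {i b : ℕ} {p : Cmd} {Q : Store → Prop} {h : Store} (Inv : ℕ → Store → Prop)
    (h0 : Inv 0 h)
    (hs : ∀ k, k < h.reg b → ∀ h', Inv k h' → Frame (.loop i b p) h h' →
      wp M n inp p (Inv (k + 1)) (h'.setReg i k))
    (hQ : ∀ h', Inv (h.reg b) h' → Frame (.loop i b p) h h' → Q (h'.setReg i (h.reg b))) :
    wp M n inp (.loop i b p) Q h := by
  have setf : ∀ {h' : Store} (v : ℕ), Frame (.loop i b p) h h' →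
      Frame (.loop i b p) h (h'.setReg i v) := by
    refine fun v h' => ⟨fun j hj => ?_, h'.2⟩
    have : i ≠ j ∧ p.writesReg j = false := by simpa [writesReg] using hj
    simp [this.1.symm, h'.1 j hj]
  refine ⟨fun k h' => Inv k h' ∧ Frame (.loop i b p) h h',
    ⟨h0, fun _ _ => rfl, fun _ _ => rfl⟩, fun k hk h' hI => ?_, fun h' hI => hQ h' hI.1 hI.2⟩
  refine wp_frame_of_le (fun j hj => ?_) (fun j hj => hj) (setf k hI.2) (hs k hk h' hI.1 hI.2)
  simp only [writesReg, Bool.or_eq_false_iff] at hj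
  exact hj.2

end Cmd

/-! ### Correctness of the compilation -/

/-- All registers and memory cells contain numbers up to `M`. -/
def Bdd (M : ℕ) (σ : State) : Prop := (∀ i, σ.reg i ≤ M) ∧ ∀ a, σ.mem a ≤ M

/-- An exponent `d` such that the values arising in the evaluation of an expression are less than
`X ^ d` when the state is bounded by `X ^ m`. -/
def Expr.deg (m : ℕ) : Expr → ℕ
  | .const k => k
  | .reg _ => m + 1
  | .load a => a.deg m + (m + 1)
  | .add a b => a.deg m + b.deg m + 1
  | .sub a b => a.deg m + b.deg m
  | .mul a b => a.deg m + b.deg m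

theorem Expr.fits_of_bdd {X m : ℕ} (hX : 2 ≤ X) {σ : State} (hσ : Bdd (X ^ m) σ) (e : Expr) :
    e.eval σ < X ^ e.deg m ∧ ∀ d, e.deg m ≤ d → e.Fits (X ^ d) σ := by
  have mono : ∀ {a b v : ℕ}, v < X ^ a → a ≤ b → v < X ^ b := fun h hab =>
    h.trans_le (Nat.pow_le_pow_right (by omega) hab)
  have succ_lt : ∀ {v}, v ≤ X ^ m → v < X ^ (m + 1) := fun h =>
    h.trans_lt (Nat.pow_lt_pow_right (by omega) (by omega))
  induction e with
  | const k =>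
    have h : k < X ^ k := (Nat.lt_two_pow_self).trans_le (Nat.pow_le_pow_left hX k)
    exact ⟨h, fun d hd => mono h hd⟩
  | reg i => exact ⟨succ_lt (hσ.1 i), fun d hd => mono (succ_lt (hσ.1 i)) hd⟩
  | load a ih =>
    have h := succ_lt (hσ.2 (a.eval σ))
    simp only [deg, eval, Fits]
    exact ⟨mono h (by omega), fun d hd => ⟨ih.2 d (by omega), mono h (by omega)⟩⟩
  | add a b iha ihb =>
    have h : a.eval σ + b.eval σ < X ^ (a.deg m + b.deg m + 1) := by
      have h1 := mono iha.1 (Nat.le_add_right (a.deg m) (b.deg m))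
      have h2 := mono ihb.1 (Nat.le_add_left (b.deg m) (a.deg m))
      rw [pow_succ]
      nlinarith
    simp only [deg, eval, Fits]
    exact ⟨h, fun d hd => ⟨iha.2 d (by omega), ihb.2 d (by omega), mono h hd⟩⟩
  | sub a b iha ihb =>
    simp only [deg, eval, Fits]
    exact ⟨(Nat.sub_le _ _).trans_lt (mono iha.1 (by omega)),
      fun d hd => ⟨iha.2 d (by omega), ihb.2 d (by omega)⟩⟩
  | mul a b iha ihb =>
    have h : a.eval σ * b.eval σ < X ^ (a.deg m + b.deg m) := by
      rw [pow_add]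
      exact Nat.mul_lt_mul'' iha.1 ihb.1
    simp only [deg, eval, Fits]
    exact ⟨h, fun d hd => ⟨iha.2 d (by omega), ihb.2 d (by omega), mono h hd⟩⟩

/-- An exponent that bounds the exponents of all expressions of a program. -/
def Program.deg (m : ℕ) : Program → ℕ
  | .skip => 0
  | .set _ e => e.deg m
  | .store a e => a.deg m + e.deg m
  | .seq p q => p.deg m + q.deg m
  | .cond e p q => e.deg m + p.deg m + q.deg m
  | .loop e p => e.deg m + p.deg m

/-- The RAM state `σ` represents the store `h`; the `n × n` matrix `inp` is the input. -/
structure Represents (n : ℕ) (inp : ℕ → ℕ → ℕ) (h : Store) (σ : State) : Prop where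
  reg : σ.reg = h.reg
  arr : ∀ k i j, σ.mem (n * n + code k i j) = h.arr k i j
  inp : ∀ i j, i < n → j < n → σ.mem (i * n + j) = inp i j
  reg_zero : h.reg 0 = n
  reg_two : h.reg 2 = n * n
  reg_three : h.reg 3 = n + 1

theorem Ex.comp_eval {n : ℕ} {inp : ℕ → ℕ → ℕ} {h : Store} {σ : State}
    (hr : Represents n inp h σ) (e : Ex) : e.comp.eval σ = e.val h := by
  induction e with
  | c k => rfl
  | r i => exact congrFun hr.reg i
  | arr k i j hi hj =>
    rw [val, ← hr.arr, ← hi, ← hj, ← hr.reg_two, ← hr.reg]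
    rfl
  | add a b ha hb => rw [val, ← ha, ← hb]; rfl
  | sub a b ha hb => rw [val, ← ha, ← hb]; rfl
  | mul a b ha hb => rw [val, ← ha, ← hb]; rfl

theorem addrExpr_eval {n : ℕ} {inp : ℕ → ℕ → ℕ} {h : Store} {σ : State}
    (hr : Represents n inp h σ) (k : ℕ) (i j : Expr) :
    (addrExpr k i j).eval σ = n * n + code k (i.eval σ) (j.eval σ) := by
  rw [← hr.reg_two, ← hr.reg]; rfl

theorem Represents.setReg {n : ℕ} {inp : ℕ → ℕ → ℕ} {h : Store} {σ : State}
    (hr : Represents n inp h σ) {i v : ℕ} (h0 : i ≠ 0) (h2 : i ≠ 2) (h3 : i ≠ 3) :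
    Represents n inp (h.setReg i v) ⟨Function.update σ.reg i v, σ.mem⟩ where
  reg := by
    funext j
    by_cases hj : j = i <;> simp [hj, hr.reg]
  arr := hr.arr
  inp := hr.inp
  reg_zero := by simp [h0.symm, hr.reg_zero]
  reg_two := by simp [h2.symm, hr.reg_two]
  reg_three := by simp [h3.symm, hr.reg_three]

theorem Represents.setArr {n : ℕ} {inp : ℕ → ℕ → ℕ} {h : Store} {σ : State}
    (hr : Represents n inp h σ) (k i j v : ℕ) :
    Represents n inp (h.setArr k i j v)
      ⟨σ.reg, Function.update σ.mem (n * n + code k i j) v⟩ where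
  reg := hr.reg
  arr k' i' j' := by
    simp only [Function.update_apply, Store.setArr_arr]
    by_cases hc : k' = k ∧ i' = i ∧ j' = j
    · simp [hc]
    · rw [if_neg hc, if_neg, hr.arr]
      intro heq
      exact hc (code_inj (by omega))
  inp i' j' hi hj := by
    have hlt : i' * n + j' < n * n := by nlinarith
    simp only [Function.update_apply]
    rw [if_neg (by omega), hr.inp i' j' hi hj]
  reg_zero := hr.reg_zero
  reg_two := hr.reg_two
  reg_three := hr.reg_three

theorem Bdd.setReg {M : ℕ} {σ : State} (hσ : Bdd M σ) {i v : ℕ} (hv : v ≤ M) :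
    Bdd M ⟨Function.update σ.reg i v, σ.mem⟩ :=
  ⟨fun j => by
    by_cases hj : j = i
    · simpa [Function.update_apply, hj] using hv
    · simpa [Function.update_apply, hj] using hσ.1 j, hσ.2⟩

theorem Bdd.setMem {M : ℕ} {σ : State} (hσ : Bdd M σ) {a v : ℕ} (hv : v ≤ M) :
    Bdd M ⟨σ.reg, Function.update σ.mem a v⟩ :=
  ⟨hσ.1, fun j => by
    by_cases hj : j = a
    · simpa [Function.update_apply, hj] using hv
    · simpa [Function.update_apply, hj] using hσ.2 j⟩

/-- The compiled command simulates the structured one: it halts within the time bound, uses only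
small numbers, and ends in a state that represents a store with the postcondition. -/
theorem Cmd.exec_comp {X m n D : ℕ} {inp : ℕ → ℕ → ℕ} (hX : 2 ≤ X) (hn : n + 1 ≤ X ^ m)
    (c : Cmd) {Q : Store → Prop} {h : Store} {σ : State}
    (hwp : c.wp (X ^ m) n inp Q h) (hwf : c.wf = true) (hr : Represents n inp h σ)
    (hb : Bdd (X ^ m) σ) (hD : c.comp.deg m ≤ D) :
    ∃ t τ h', Exec (X ^ D) c.comp σ t τ ∧ t ≤ c.time (n + 1) ∧ Represents n inp h' τ ∧
      Bdd (X ^ m) τ ∧ Q h' := by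
  induction c generalizing Q h σ with
  | skip => exact ⟨1, σ, h, .skip σ, le_rfl, hr, hb, hwp⟩
  | set i e =>
    simp only [wf, Bool.and_eq_true, bne_iff_ne, ne_eq] at hwf
    refine ⟨_, _, _, .set σ i e.comp ((e.comp.fits_of_bdd hX hb).2 D hD), le_rfl, ?_,
      hb.setReg ?_, hwp.2⟩
    · rw [e.comp_eval hr]
      exact hr.setReg hwf.1.1 hwf.1.2 hwf.2
    · rw [e.comp_eval hr]; exact hwp.1
  | put k i j e =>
    simp only [comp, Program.deg] at hD
    refine ⟨_, _, _, .store σ _ e.comp ((Expr.fits_of_bdd hX hb _).2 D (by omega))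
      ((Expr.fits_of_bdd hX hb _).2 D (by omega)), le_rfl, ?_, hb.setMem ?_, hwp.2⟩
    · rw [e.comp_eval hr, addrExpr_eval hr, i.comp_eval hr, j.comp_eval hr]
      exact hr.setArr _ _ _ _
    · rw [e.comp_eval hr]; exact hwp.1
  | fetch k i j =>
    simp only [comp, Program.deg] at hD
    have hv : (Expr.load (.add (.mul (.reg i) (.reg 0)) (.reg j))).eval σ
        = inp (h.reg i) (h.reg j) := by
      simp only [Expr.eval, hr.reg, hr.reg_zero]
      exact hr.inp _ _ hwp.1 hwp.2.1
    refine ⟨_, _, _, .store σ _ _ ((Expr.fits_of_bdd hX hb _).2 D (by omega))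
      ((Expr.fits_of_bdd hX hb _).2 D (by omega)), le_rfl, ?_, hb.setMem (hb.2 _), hwp.2.2⟩
    · have hi : (Expr.reg i).eval σ = h.reg i := congrFun hr.reg i
      have hj : (Expr.reg j).eval σ = h.reg j := congrFun hr.reg j
      rw [hv, addrExpr_eval hr, hi, hj]
      exact hr.setArr _ _ _ _
  | seq p q hp hq =>
    simp only [wf, Bool.and_eq_true] at hwf
    simp only [comp, Program.deg] at hD
    obtain ⟨t, τ, h', h1, h2, h3, h4, h5⟩ := hp hwp hwf.1 hr hb (by omega)
    obtain ⟨t', τ', h'', h6, h7, h8, h9, h10⟩ := hq h5 hwf.2 h3 h4 (by omega)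
    exact ⟨_, _, _, .seq h1 h6, by simp only [time]; omega, h8, h9, h10⟩
  | ite e p q hp hq =>
    simp only [wf, Bool.and_eq_true] at hwf
    simp only [comp, Program.deg] at hD
    have hfit := (e.comp.fits_of_bdd hX hb).2 D (by omega)
    by_cases h0 : e.val h = 0
    · obtain ⟨t, τ, h', h1, h2, h3⟩ := hq (hwp.2 h0) hwf.2 hr hb (by omega)
      exact ⟨_, τ, h', .cond_false hfit (by rw [e.comp_eval hr, h0]) h1,
        by simp only [time]; omega, h3⟩
    · obtain ⟨t, τ, h', h1, h2, h3⟩ := hp (hwp.1 h0) hwf.1 hr hb (by omega)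
      exact ⟨_, τ, h', .cond_true hfit (by rw [e.comp_eval hr]; exact h0) h1,
        by simp only [time]; omega, h3⟩
  | loop i b p hp =>
    simp only [wf, Bool.and_eq_true, bne_iff_ne, ne_eq, Bool.or_eq_true, beq_iff_eq,
      Bool.not_eq_true'] at hwf
    obtain ⟨⟨⟨⟨⟨hi0, hi2⟩, hi3⟩, hb03⟩, hnw⟩, hwfp⟩ := hwf
    simp only [comp, Program.deg] at hD
    obtain ⟨Inv, hI0, hIs, hIQ⟩ := hwp
    have hbi : b ≠ i := by rintro rfl; rcases hb03 with h | h <;> omega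
    set N := h.reg b with hN
    have hNle : N ≤ n + 1 := by
      rcases hb03 with rfl | rfl
      · rw [hN, hr.reg_zero]; omega
      · rw [hN, hr.reg_three]
    have hregb : ∀ {h' : Store} {σ' : State}, Represents n inp h' σ' → σ'.reg b = N := by
      intro h' σ' hr'
      rw [hr'.reg]
      rcases hb03 with rfl | rfl
      · rw [hr'.reg_zero, hN, hr.reg_zero]
      · rw [hr'.reg_three, hN, hr.reg_three]
    have hfit : ∀ {σ'}, Bdd (X ^ m) σ' → (Expr.sub (.reg b) (.reg i)).Fits (X ^ D) σ' :=
      fun hb' => (Expr.fits_of_bdd hX hb' _).2 D (by omega)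
    -- Induction on the number of remaining rounds.
    have key : ∀ r, r ≤ N → ∀ h' σ', Inv (N - r) h' →
        Represents n inp (h'.setReg i (N - r)) σ' → Bdd (X ^ m) σ' →
        ∃ t τ h'', Exec (X ^ D) (.loop (.sub (.reg b) (.reg i))
            (.seq p.comp (.set i (.add (.reg i) (.const 1))))) σ' t τ ∧
          t ≤ 4 + r * (p.time (n + 1) + 8) ∧ Represents n inp (h''.setReg i N) τ ∧
          Bdd (X ^ m) τ ∧ Inv N h'' := by
      intro r
      induction r with
      | zero =>
        intro _ h' σ' hI hr' hb'
        refine ⟨_, σ', h', .loop_done (hfit hb') ?_, by simp [Expr.cost], hr', hb', hI⟩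
        simp [Expr.eval, hregb hr', hr'.reg]
      | succ r ih =>
        intro hrN h' σ' hI hr' hb'
        have hlt : N - (r + 1) < N := by omega
        have hw := Cmd.wp_frame (hIs _ hlt h' hI)
        obtain ⟨t, τ, h1, e1, e2, e3, e4, e5, e6⟩ := hp hw hwfp hr' hb' (by omega)
        have hi1 : h1.reg i = N - (r + 1) := by
          rw [e6.1 i hnw]; simp
        have hs1 : N - (r + 1) + 1 = N - r := by omega
        have e7 : (Expr.add (.reg i) (.const 1)).eval τ = N - r := by
          simp only [Expr.eval, e3.reg, hi1]; omega
        have e8 : Exec (X ^ D) (.set i (.add (.reg i) (.const 1))) τ _ _ :=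
          .set τ i (.add (.reg i) (.const 1)) ((Expr.fits_of_bdd hX e4 _).2 D (by omega))
        rw [e7] at e8
        rw [hs1] at e5
        obtain ⟨t', τ', h'', f1, f2, f3⟩ := ih (by omega) h1 _ e5
          (e3.setReg (v := N - r) hi0 hi2 hi3) (e4.setReg (by omega))
        refine ⟨_, τ', h'', .loop_step (hfit hb') ?_ (.seq e1 e8) f1, ?_, f3⟩
        · simp only [Expr.eval, hregb hr', hr'.reg]
          simp
          omega
        · simp only [Expr.cost]
          rw [add_mul]
          omega
    have e0 : Exec (X ^ D) (.set i (.const 0)) σ 2 ⟨Function.update σ.reg i 0, σ.mem⟩ :=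
      .set σ i (.const 0) ((Expr.fits_of_bdd hX hb _).2 D (by omega))
    obtain ⟨t, τ, h', e1, e2, e3, e4, e5⟩ := key N le_rfl h _ (by simpa using hI0)
      (by simpa using hr.setReg (v := 0) hi0 hi2 hi3) (hb.setReg (by omega))
    refine ⟨_, τ, _, .seq e0 e1, ?_, e3, e4, hIQ h' e5⟩
    have : N * (p.time (n + 1) + 8) ≤ (n + 1) * (p.time (n + 1) + 8) :=
      Nat.mul_le_mul_right _ hNle
    simp only [time]
    omega

/-! ### Strong orderings: symmetries and positions -/

namespace StrongOrdering

variable {V : Type*} {G : SimpleGraph V}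

/-- The strong ordering with `≺` reversed. -/
def dual (O : StrongOrdering G) : StrongOrdering G where
  U := O.U
  W := O.W
  bipartite := O.bipartite
  cover := O.cover
  lt x y := O.lt y x
  lt_same_side h := (O.lt_same_side h).imp And.symm And.symm
  lt_irrefl := O.lt_irrefl
  lt_trans h h' := O.lt_trans h' h
  total_U hx hy := by rcases O.total_U hx hy with h | h | h <;> tauto
  total_W hx hy := by rcases O.total_W hx hy with h | h | h <;> tauto
  strong hu hu' hw hw' h h' hlt hlt' := (O.strong hu' hu hw' hw h' h hlt hlt').symm

/-- The strong ordering with the two sides exchanged. -/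
def flip (O : StrongOrdering G) : StrongOrdering G where
  U := O.W
  W := O.U
  bipartite := O.bipartite.symm
  cover := by rw [Set.union_comm, O.cover]
  lt := O.lt
  lt_same_side h := (O.lt_same_side h).symm
  lt_irrefl := O.lt_irrefl
  lt_trans := O.lt_trans
  total_U := O.total_W
  total_W := O.total_U
  strong hu hu' hw hw' h h' hlt hlt' :=
    (O.strong hw' hw hu' hu h'.symm h.symm hlt' hlt).imp SimpleGraph.Adj.symm SimpleGraph.Adj.symm

variable (O : StrongOrdering G)

@[simp] theorem dual_lt (x y : V) : O.dual.lt x y ↔ O.lt y x := Iff.rfl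
@[simp] theorem flip_lt (x y : V) : O.flip.lt x y ↔ O.lt x y := Iff.rfl
@[simp] theorem dual_U : O.dual.U = O.U := rfl
@[simp] theorem dual_W : O.dual.W = O.W := rfl
@[simp] theorem flip_U : O.flip.U = O.W := rfl
@[simp] theorem flip_W : O.flip.W = O.U := rfl

theorem lt_asymm {x y : V} (h : O.lt x y) (h' : O.lt y x) : False := O.lt_irrefl x (O.lt_trans h h')

theorem ne_of_lt {x y : V} (h : O.lt x y) : x ≠ y := fun e => O.lt_irrefl x (by rwa [← e] at h)

theorem mem_W_iff (x : V) : x ∈ O.W ↔ x ∉ O.U := by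
  have hd := Set.disjoint_left.mp O.bipartite.disjoint
  have hc : x ∈ O.U ∪ O.W := by rw [O.cover]; trivial
  exact ⟨fun h h' => hd h' h, fun h => hc.resolve_left h⟩

theorem mem_U_iff (x : V) : x ∈ O.U ↔ x ∉ O.W := by rw [O.mem_W_iff]; tauto

theorem adj_side {x y : V} (h : G.Adj x y) : x ∈ O.U ↔ y ∉ O.U := by
  rw [← O.mem_W_iff]
  rcases O.bipartite.mem_of_adj h with ⟨hx, hy⟩ | ⟨hx, hy⟩
  · tauto
  · have h1 := (O.mem_W_iff x).mp hx
    have h2 := (O.mem_U_iff y).mp hy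
    tauto

theorem lt_side {x y : V} (h : O.lt x y) : x ∈ O.U ↔ y ∈ O.U := by
  rcases O.lt_same_side h with h | h
  · tauto
  · have := O.mem_W_iff x; have := O.mem_W_iff y; tauto

theorem total {x y : V} (h : x ∈ O.U ↔ y ∈ O.U) : O.lt x y ∨ x = y ∨ O.lt y x := by
  by_cases hx : x ∈ O.U
  · exact O.total_U hx (h.mp hx)
  · exact O.total_W ((O.mem_W_iff x).mpr hx) ((O.mem_W_iff y).mpr (by tauto))

/-- The defining property of a strong ordering, regardless of the sides of the end vertices. -/
theorem cross_adj {x x' y y' : V} (h : G.Adj x y) (h' : G.Adj x' y') (hx : O.lt x x')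
    (hy : O.lt y' y) : G.Adj x y' ∧ G.Adj x' y := by
  have h1 := O.adj_side h
  have h2 := O.adj_side h'
  have h3 := O.lt_side hx
  by_cases hxU : x ∈ O.U
  · exact O.strong hxU (h3.mp hxU) ((O.mem_W_iff y).mpr (h1.mp hxU))
      ((O.mem_W_iff y').mpr (h2.mp (h3.mp hxU))) h h' hx hy
  · have hx'U : x' ∉ O.U := by tauto
    have := O.strong (u := y') (u' := y) (w := x') (w' := x) (by tauto) (by tauto)
      ((O.mem_W_iff _).mpr hx'U) ((O.mem_W_iff _).mpr hxU) h'.symm h.symm hy hx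
    exact ⟨this.1.symm, this.2.symm⟩

variable [Fintype V]

/-- The number of predecessors of a vertex; on either side, this is its position in the order. -/
noncomputable def pos (v : V) : ℕ := (Finset.univ.filter fun x => O.lt x v).card

@[simp] theorem pos_flip (v : V) : O.flip.pos v = O.pos v := rfl

theorem pos_lt_pos {x y : V} (h : O.lt x y) : O.pos x < O.pos y := by
  apply Finset.card_lt_card
  rw [Finset.ssubset_iff_of_subset]
  · exact ⟨x, by simpa using h, by simpa using O.lt_irrefl x⟩
  · intro z hz
    simp only [Finset.mem_filter, Finset.mem_univ, true_and] at hz ⊢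
    exact O.lt_trans hz h

theorem lt_iff_pos {x y : V} (h : x ∈ O.U ↔ y ∈ O.U) : O.lt x y ↔ O.pos x < O.pos y := by
  refine ⟨O.pos_lt_pos, fun hp => ?_⟩
  rcases O.total h with h' | h' | h'
  · exact h'
  · subst h'; omega
  · have := O.pos_lt_pos h'; omega

theorem pos_inj {x y : V} (h : x ∈ O.U ↔ y ∈ O.U) (hp : O.pos x = O.pos y) : x = y := by
  rcases O.total h with h' | h' | h'
  · have := O.pos_lt_pos h'; omega
  · exact h'
  · have := O.pos_lt_pos h'; omega

theorem pos_lt_card_U {x : V} (h : x ∈ O.U) :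
    O.pos x < (Finset.univ.filter fun v => v ∈ O.U).card := by
  apply Finset.card_lt_card
  rw [Finset.ssubset_iff_of_subset]
  · exact ⟨x, by simpa using h, by simpa using O.lt_irrefl x⟩
  · intro z hz
    simp only [Finset.mem_filter, Finset.mem_univ, true_and] at hz ⊢
    exact (O.lt_side hz).mpr h

theorem exists_pos_eq_U {k : ℕ} (hk : k < (Finset.univ.filter fun v => v ∈ O.U).card) :
    ∃ x ∈ O.U, O.pos x = k := by
  have := Finset.surj_on_of_inj_on_of_card_le (s := Finset.univ.filter fun v => v ∈ O.U)
    (t := Finset.range (Finset.univ.filter fun v => v ∈ O.U).card) (fun x _ => O.pos x)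
    (fun x hx => by simpa using O.pos_lt_card_U (by simpa using hx))
    (fun x y hx hy hxy => O.pos_inj (by simp at hx hy; tauto) hxy) (by simp) k (by simpa using hk)
  obtain ⟨x, hx, hx'⟩ := this
  exact ⟨x, by simpa using hx, hx'.symm⟩

/-- The vertex immediately after a vertex that is not the last one on its side. -/
theorem exists_succ {x y : V} (hlt : O.lt x y) :
    ∃ z, (z ∈ O.U ↔ x ∈ O.U) ∧ O.pos z = O.pos x + 1 := by
  have hp := O.pos_lt_pos hlt
  by_cases hx : x ∈ O.U
  · have := O.pos_lt_card_U ((O.lt_side hlt).mp hx)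
    obtain ⟨z, hz, hz'⟩ := O.exists_pos_eq_U (k := O.pos x + 1) (by omega)
    exact ⟨z, by tauto, hz'⟩
  · have hy : y ∈ O.flip.U := (O.mem_W_iff y).mpr (fun h => hx ((O.lt_side hlt).mpr h))
    have := O.flip.pos_lt_card_U hy
    obtain ⟨z, hz, hz'⟩ := O.flip.exists_pos_eq_U (k := O.pos x + 1) (by
      rw [O.pos_flip] at this; omega)
    have := (O.mem_W_iff z).mp hz
    exact ⟨z, by tauto, hz'⟩

theorem mem_scope {X : CenteredStar V} {v : V} :
    v ∈ O.scope X ↔ (∃ a ∈ X.leaves, O.le a v) ∧ ∃ b ∈ X.leaves, O.le v b := by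
  simp [scope]

theorem leaf_mem_scope {X : CenteredStar V} {v : V} (h : v ∈ X.leaves) : v ∈ O.scope X :=
  O.mem_scope.mpr ⟨⟨v, h, Or.inl rfl⟩, v, h, Or.inl rfl⟩

theorem scope_dual (X : CenteredStar V) : O.dual.scope X = O.scope X := by
  ext v
  simp only [mem_scope, le, dual_lt]
  constructor <;> rintro ⟨⟨a, ha, ha'⟩, b, hb, hb'⟩ <;>
    exact ⟨⟨b, hb, hb'.imp_left Eq.symm⟩, a, ha, ha'.imp_left Eq.symm⟩

theorem scope_flip (X : CenteredStar V) : O.flip.scope X = O.scope X := rfl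

theorem interleaving_dual (X Y : CenteredStar V) :
    O.dual.Interleaving X Y ↔ O.Interleaving X Y := by
  simp only [Interleaving, scope_dual]

omit [Fintype V] in
theorem crosses_dual (e e' : Sym2 V) : O.dual.Crosses e e' ↔ O.Crosses e e' := by
  simp only [Crosses, dual_U, dual_W, dual_lt]
  constructor <;> rintro ⟨u, hu, w, hw, u', hu', w', hw', h1, h2, h3⟩ <;>
    exact ⟨u, hu, w, hw, u', hu', w', hw', h1, h2, by tauto⟩

omit [Fintype V] in
theorem crosses_flip (e e' : Sym2 V) : O.flip.Crosses e e' ↔ O.Crosses e e' := by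
  simp only [Crosses, flip_U, flip_W, flip_lt]
  constructor <;> rintro ⟨u, hu, w, hw, u', hu', w', hw', h1, h2, h3⟩ <;>
    exact ⟨w, hw, u, hu, w', hw', u', hu', by rw [h1, Sym2.eq_swap], by rw [h2, Sym2.eq_swap],
      by tauto⟩

omit [Fintype V] in
theorem crosses_comm (e e' : Sym2 V) : O.Crosses e e' ↔ O.Crosses e' e := by
  constructor <;> rintro ⟨u, hu, w, hw, u', hu', w', hw', h1, h2, h3⟩ <;>
    exact ⟨u', hu', w', hw', u, hu, w, hw, h2, h1, by tauto⟩

omit [Fintype V] in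
/-- Two edges, given by their end vertices on the same side, cross if the two pairs of end vertices
have opposite orders. -/
theorem crosses_iff {x y x' y' : V} (h : G.Adj x y) (h' : G.Adj x' y')
    (hs : x ∈ O.U ↔ x' ∈ O.U) :
    O.Crosses s(x, y) s(x', y') ↔ (O.lt x x' ∧ O.lt y' y) ∨ (O.lt x' x ∧ O.lt y y') := by
  have h1 := O.adj_side h
  have h2 := O.adj_side h'
  have hW := O.mem_W_iff
  constructor
  · rintro ⟨u, hu, w, hw, u', hu', w', hw', e1, e2, h3⟩
    rw [hW] at hw hw'
    rw [Sym2.eq_iff] at e1 e2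
    rcases e1 with ⟨rfl, rfl⟩ | ⟨rfl, rfl⟩ <;> rcases e2 with ⟨rfl, rfl⟩ | ⟨rfl, rfl⟩ <;> tauto
  · intro h3
    by_cases hx : x ∈ O.U
    · exact ⟨x, hx, y, by rw [hW]; tauto, x', by tauto, y', by rw [hW]; tauto, rfl, rfl, h3⟩
    · exact ⟨y, by tauto, x, by rw [hW]; tauto, y', by tauto, x', by rw [hW]; tauto,
        Sym2.eq_swap, Sym2.eq_swap, by tauto⟩

/-- The number of edges of a star that cross a given edge. -/
noncomputable def crossWith (X : CenteredStar V) (e : Sym2 V) : ℕ :=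
  (X.leaves.filter fun x => O.Crosses s(X.center, x) e).card

omit [Fintype V] in
theorem crossingNumber_eq_sum (X Y : CenteredStar V) :
    O.crossingNumber X Y = ∑ y ∈ Y.leaves, O.crossWith X s(Y.center, y) := by
  have inj : ∀ c : V, Function.Injective fun v => s(c, v) := fun c a b h =>
    Sym2.congr_right.mp h
  have h1 : O.crossingNumber X Y =
      ((X.leaves ×ˢ Y.leaves).filter fun p =>
        O.Crosses s(X.center, p.1) s(Y.center, p.2)).card := by
    refine (Finset.card_bij (fun p _ => (s(X.center, p.1), s(Y.center, p.2))) ?_ ?_ ?_).symm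
    · rintro ⟨a, b⟩ hp
      simp only [Finset.mem_filter, Finset.mem_product, CenteredStar.edges,
        Finset.mem_image] at hp ⊢
      exact ⟨⟨⟨a, hp.1.1, rfl⟩, b, hp.1.2, rfl⟩, hp.2⟩
    · rintro ⟨a, b⟩ _ ⟨a', b'⟩ _ he
      simp only [Prod.mk.injEq] at he
      rw [inj _ he.1, inj _ he.2]
    · rintro ⟨e, e'⟩ hp
      simp only [Finset.mem_filter, Finset.mem_product, CenteredStar.edges,
        Finset.mem_image] at hp
      obtain ⟨⟨⟨a, ha, rfl⟩, b, hb, rfl⟩, hc⟩ := hp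
      exact ⟨(a, b), by simp [ha, hb, hc], rfl⟩
  rw [h1, Finset.card_filter, Finset.sum_product_right]
  simp only [crossWith, Finset.card_filter]

omit [Fintype V] in
theorem crossingNumber_comm (X Y : CenteredStar V) :
    O.crossingNumber X Y = O.crossingNumber Y X := by
  refine Finset.card_bij (fun p _ => p.swap) ?_ ?_ ?_
  · rintro ⟨a, b⟩ hp
    simp only [Finset.mem_filter, Finset.mem_product, Prod.swap] at hp ⊢
    exact ⟨hp.1.symm, (O.crosses_comm _ _).mp hp.2⟩
  · intro p _ q _ h
    exact Prod.swap_injective h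
  · rintro ⟨a, b⟩ hp
    simp only [Finset.mem_filter, Finset.mem_product] at hp
    exact ⟨(b, a), by simpa using ⟨hp.1.symm, (O.crosses_comm _ _).mp hp.2⟩, rfl⟩

omit [Fintype V] in
theorem nonCrossing_comm {X Y : CenteredStar V} : O.NonCrossing X Y ↔ O.NonCrossing Y X := by
  rw [NonCrossing, NonCrossing, crossingNumber_comm]

omit [Fintype V] in
theorem nonCrossing_iff {X Y : CenteredStar V} :
    O.NonCrossing X Y ↔
      ∀ x ∈ X.leaves, ∀ y ∈ Y.leaves, ¬ O.Crosses s(X.center, x) s(Y.center, y) := by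
  simp only [NonCrossing, crossingNumber_eq_sum, Finset.sum_eq_zero_iff, crossWith,
    Finset.card_eq_zero, Finset.filter_eq_empty_iff]
  tauto

omit [Fintype V] in
theorem crossingNumber_dual (X Y : CenteredStar V) :
    O.dual.crossingNumber X Y = O.crossingNumber X Y := by
  simp only [crossingNumber_eq_sum, crossWith, crosses_dual]

omit [Fintype V] in
theorem crossingNumber_flip (X Y : CenteredStar V) :
    O.flip.crossingNumber X Y = O.crossingNumber X Y := by
  simp only [crossingNumber_eq_sum, crossWith, crosses_flip]

variable {O} {s : ℕ} {P : Finset (CenteredStar V)}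

theorem IsMinScore.dual (h : O.IsMinScore s P) : O.dual.IsMinScore s P := by
  simpa only [IsMinScore, score, totalWidth, width, totalCrossing, scope_dual,
    crossingNumber_dual] using h

theorem IsMinScore.flip (h : O.IsMinScore s P) : O.flip.IsMinScore s P := by
  simpa only [IsMinScore, score, totalWidth, width, totalCrossing, scope_flip,
    crossingNumber_flip] using h

/-! ### Exchanging two stars of a partition of minimum score -/

omit [Fintype V] in
/-- The edge-crossing number of a partition, split into the contributions of two stars and of the
rest. -/
theorem totalCrossing_insert_insert {R : Finset (CenteredStar V)} {X Y : CenteredStar V}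
    (hX : X ∉ R) (hY : Y ∉ R) (hXY : X ≠ Y) :
    O.totalCrossing (insert X (insert Y R)) = O.totalCrossing R + 2 * O.crossingNumber X Y +
      2 * ∑ Z ∈ R, (O.crossingNumber X Z + O.crossingNumber Y Z) := by
  have step : ∀ {S : Finset (CenteredStar V)} {Z : CenteredStar V}, Z ∉ S →
      O.totalCrossing (insert Z S) = O.totalCrossing S + 2 * ∑ T ∈ S, O.crossingNumber Z T := by
    intro S Z hZ
    have e1 : (insert Z S).offDiag = S.offDiag ∪ (S.image (fun T => (Z, T)) ∪
        S.image (fun T => (T, Z))) := by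
      ext ⟨a, b⟩
      simp only [Finset.mem_offDiag, Finset.mem_insert, Finset.mem_union, Finset.mem_image,
        Prod.mk.injEq]
      constructor
      · rintro ⟨rfl | ha, rfl | hb, hab⟩
        · exact absurd rfl hab
        · exact Or.inr (Or.inl ⟨b, hb, rfl, rfl⟩)
        · exact Or.inr (Or.inr ⟨a, ha, rfl, rfl⟩)
        · exact Or.inl ⟨ha, hb, hab⟩
      · rintro (⟨ha, hb, hab⟩ | ⟨c, hc, rfl, rfl⟩ | ⟨c, hc, rfl, rfl⟩)
        · exact ⟨Or.inr ha, Or.inr hb, hab⟩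
        · exact ⟨Or.inl rfl, Or.inr hc, fun h => hZ (h ▸ hc)⟩
        · exact ⟨Or.inr hc, Or.inl rfl, fun h => hZ (h ▸ hc)⟩
    have d1 : Disjoint (S.image (fun T => (Z, T))) (S.image (fun T => (T, Z))) := by
      rw [Finset.disjoint_left]
      simp only [Finset.mem_image, not_exists, not_and]
      rintro _ ⟨c, hc, rfl⟩ d hd he
      simp only [Prod.mk.injEq] at he
      exact hZ (he.1 ▸ hd)
    have d2 : Disjoint S.offDiag (S.image (fun T => (Z, T)) ∪ S.image (fun T => (T, Z))) := by
      rw [Finset.disjoint_left]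
      rintro ⟨a, b⟩ hab
      simp only [Finset.mem_offDiag] at hab
      simp only [Finset.mem_union, Finset.mem_image, Prod.mk.injEq]
      rintro (⟨c, hc, rfl, rfl⟩ | ⟨c, hc, rfl, rfl⟩)
      · exact hZ hab.1
      · exact hZ hab.2.1
    rw [totalCrossing, e1, Finset.sum_union d2, Finset.sum_union d1,
      Finset.sum_image (fun a _ b _ h => (Prod.mk.inj h).2),
      Finset.sum_image (fun a _ b _ h => (Prod.mk.inj h).1), totalCrossing]
    simp only [O.crossingNumber_comm _ Z]
    ring
  rw [step (by simp [hX, hXY]), step hY, Finset.sum_insert hY, Finset.sum_add_distrib]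
  ring

/-- Two stars of a partition of minimum score cannot be replaced by two stars on the same vertices
with a smaller width, or with the same width and fewer crossings. -/
theorem IsMinScore.not_exchange (h : O.IsMinScore s P) {X Y X' Y' : CenteredStar V} (hX : X ∈ P)
    (hY : Y ∈ P) (hXY : X ≠ Y) (hX' : X'.IsStarOf G s) (hY' : Y'.IsStarOf G s)
    (hd : Disjoint X'.verts Y'.verts) (hv : X'.verts ∪ Y'.verts = X.verts ∪ Y.verts)
    (hw : O.width X' + O.width Y' ≤ O.width X + O.width Y) :
    O.width X' + O.width Y' = O.width X + O.width Y ∧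
    ((∀ Z ∈ P, Z ≠ X → Z ≠ Y → ∀ z ∈ Z.leaves,
      O.crossWith X' s(Z.center, z) + O.crossWith Y' s(Z.center, z) ≤
      O.crossWith X s(Z.center, z) + O.crossWith Y s(Z.center, z)) →
    O.crossingNumber X Y ≤ O.crossingNumber X' Y') := by
  obtain ⟨⟨hstar, hdis, hcov⟩, hmin⟩ := h
  set R := (P.erase X).erase Y with hR
  have hYR : Y ∉ R := by simp [hR]
  have hXR : X ∉ R := by simp [hR]
  have hP : P = insert X (insert Y R) := by
    rw [hR, Finset.insert_erase (by simp [hY, hXY.symm]), Finset.insert_erase hX]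
  have hRmem : ∀ {Z}, Z ∈ R ↔ Z ∈ P ∧ Z ≠ X ∧ Z ≠ Y := by
    intro Z; simp only [hR, Finset.mem_erase]; tauto
  have cm : ∀ Z : CenteredStar V, Z.center ∈ Z.verts := fun Z => by simp [CenteredStar.verts]
  have hnew : ∀ Z ∈ R, Disjoint Z.verts (X'.verts ∪ Y'.verts) := by
    intro Z hZ
    obtain ⟨h1, h2, h3⟩ := hRmem.mp hZ
    rw [hv, Finset.disjoint_union_right]
    exact ⟨hdis Z h1 X hX h2, hdis Z h1 Y hY h3⟩
  have hnX : ∀ Z ∈ R, Disjoint Z.verts X'.verts := fun Z hZ =>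
    (Finset.disjoint_union_right.mp (hnew Z hZ)).1
  have hnY : ∀ Z ∈ R, Disjoint Z.verts Y'.verts := fun Z hZ =>
    (Finset.disjoint_union_right.mp (hnew Z hZ)).2
  have hX'R : X' ∉ R := fun hh => Finset.disjoint_left.mp (hnX X' hh) (cm X') (cm X')
  have hY'R : Y' ∉ R := fun hh => Finset.disjoint_left.mp (hnY Y' hh) (cm Y') (cm Y')
  have hX'Y' : X' ≠ Y' := fun hh => Finset.disjoint_left.mp hd (cm X') (hh ▸ cm X')
  have hQ : IsStarPartition G s (insert X' (insert Y' R)) := by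
    refine ⟨?_, ?_, ?_⟩
    · intro Z hZ
      simp only [Finset.mem_insert] at hZ
      rcases hZ with rfl | rfl | hZ
      · exact hX'
      · exact hY'
      · exact hstar Z (hRmem.mp hZ).1
    · intro Z hZ T hT hne
      simp only [Finset.mem_insert] at hZ hT
      rcases hZ with rfl | rfl | hZ <;> rcases hT with rfl | rfl | hT
      · exact absurd rfl hne
      · exact hd
      · exact (hnX T hT).symm
      · exact hd.symm
      · exact absurd rfl hne
      · exact (hnY T hT).symm
      · exact hnX Z hZ
      · exact hnY Z hZ
      · exact hdis Z (hRmem.mp hZ).1 T (hRmem.mp hT).1 hne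
    · intro v
      obtain ⟨Z, hZ, hvZ⟩ := hcov v
      by_cases hZR : Z ∈ R
      · exact ⟨Z, by simp [hZR], hvZ⟩
      · have hvv : v ∈ X'.verts ∪ Y'.verts := by
          rw [hv, Finset.mem_union]
          by_cases e1 : Z = X
          · exact Or.inl (e1 ▸ hvZ)
          · by_cases e2 : Z = Y
            · exact Or.inr (e2 ▸ hvZ)
            · exact absurd (hRmem.mpr ⟨hZ, e1, e2⟩) hZR
        rcases Finset.mem_union.mp hvv with hh | hh
        · exact ⟨X', by simp, hh⟩
        · exact ⟨Y', by simp, hh⟩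
  have hle := hmin _ hQ
  have w1 : O.totalWidth P = O.width X + (O.width Y + O.totalWidth R) := by
    conv_lhs => rw [hP]
    simp only [totalWidth]
    rw [Finset.sum_insert (by simp [hXR, hXY]), Finset.sum_insert hYR]
  have w2 : O.totalWidth (insert X' (insert Y' R)) =
      O.width X' + (O.width Y' + O.totalWidth R) := by
    simp only [totalWidth]
    rw [Finset.sum_insert (by simp [hX'R, hX'Y']), Finset.sum_insert hY'R]
  have c1 := totalCrossing_insert_insert (O := O) hXR hYR hXY
  rw [← hP] at c1
  have c2 := totalCrossing_insert_insert (O := O) hX'R hY'R hX'Y'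
  rw [score, score, Prod.Lex.toLex_le_toLex] at hle
  simp only [w1, w2, c1, c2] at hle
  refine ⟨by omega, fun hz => ?_⟩
  have hsum : ∑ Z ∈ R, (O.crossingNumber X' Z + O.crossingNumber Y' Z) ≤
      ∑ Z ∈ R, (O.crossingNumber X Z + O.crossingNumber Y Z) := by
    refine Finset.sum_le_sum fun Z hZ => ?_
    obtain ⟨h1, h2, h3⟩ := hRmem.mp hZ
    simp only [crossingNumber_eq_sum, ← Finset.sum_add_distrib]
    exact Finset.sum_le_sum fun z hz' => hz Z h1 h2 h3 z hz'
  omega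

end StrongOrdering

theorem exists_lower_subset {α : Type*} (f : α → ℕ) (A : Finset α) (k : ℕ) (hk : k ≤ A.card) :
    ∃ L ⊆ A, L.card = k ∧ ∀ a ∈ L, ∀ b ∈ A, b ∉ L → f a ≤ f b := by
  induction k with
  | zero => exact ⟨∅, by simp, rfl, by simp⟩
  | succ k ih =>
    obtain ⟨L, hL, hc, hlow⟩ := ih (by omega)
    have hne : (A \ L).Nonempty := by
      rw [← Finset.card_pos, Finset.card_sdiff_of_subset hL]; omega
    obtain ⟨m, hm, hmin⟩ := Finset.exists_min_image _ f hne
    rw [Finset.mem_sdiff] at hm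
    refine ⟨insert m L, ?_, ?_, ?_⟩
    · intro x hx
      rcases Finset.mem_insert.mp hx with rfl | hx
      · exact hm.1
      · exact hL hx
    · rw [Finset.card_insert_of_notMem hm.2, hc]
    · intro a ha b hb hbL
      simp only [Finset.mem_insert, not_or] at ha hbL
      rcases ha with rfl | ha
      · exact hmin b (Finset.mem_sdiff.mpr ⟨hb, hbL.2⟩)
      · exact hlow a ha b hb hbL.2

namespace StrongOrdering

variable {V : Type*} {G : SimpleGraph V}

/-- The edges `xy` and `x'y'` that cross a star, in terms of the order. -/
theorem crossWith_eq (O : StrongOrdering G) (X : CenteredStar V) {s : ℕ} (hX : X.IsStarOf G s)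
    {u w : V} (huw : G.Adj u w) (hu : X.center ∈ O.U ↔ u ∈ O.U) :
    O.crossWith X s(u, w) = (X.leaves.filter fun x =>
      (O.lt X.center u ∧ O.lt w x) ∨ (O.lt u X.center ∧ O.lt x w)).card := by
  rw [crossWith]
  congr 1
  apply Finset.filter_congr
  intro x hx
  exact O.crosses_iff (hX.2 x hx) huw hu

variable [Fintype V] {O : StrongOrdering G} {s : ℕ} {P : Finset (CenteredStar V)}

theorem le_iff_pos {x y : V} (h : x ∈ O.U ↔ y ∈ O.U) : O.le x y ↔ O.pos x ≤ O.pos y := by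
  rw [le, O.lt_iff_pos h]
  constructor
  · rintro (rfl | h')
    · exact le_rfl
    · exact h'.le
  · intro h'
    rcases h'.eq_or_lt with h'' | h''
    · exact Or.inl (O.pos_inj h h'')
    · exact Or.inr h''

omit [Fintype V] in
theorem le_side {x y : V} (h : O.le x y) : x ∈ O.U ↔ y ∈ O.U := by
  rcases h with rfl | h
  · rfl
  · exact O.lt_side h

theorem IsMinScore.isStarOf (h : O.IsMinScore s P) {X : CenteredStar V} (hX : X ∈ P) :
    X.IsStarOf G s := h.1.1 X hX

theorem IsMinScore.disjoint (h : O.IsMinScore s P) {X Y : CenteredStar V} (hX : X ∈ P)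
    (hY : Y ∈ P) (hXY : X ≠ Y) : Disjoint X.verts Y.verts := h.1.2.1 X hX Y hY hXY

omit [Fintype V] in
theorem _root_.StarPart.CenteredStar.mem_verts {X : CenteredStar V} {v : V} :
    v ∈ X.verts ↔ v = X.center ∨ v ∈ X.leaves := by simp [CenteredStar.verts]

set_option maxHeartbeats 1000000 in
/-- In a partition of minimum score, stars with centers on the same side do not cross: otherwise
give the first `s` of their leaves to the first center and the last `s` to the other one. -/
theorem IsMinScore.nonCrossing_of_lt (h : O.IsMinScore s P) {X Y : CenteredStar V} (hX : X ∈ P)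
    (hY : Y ∈ P) (hlt : O.lt X.center Y.center) : O.NonCrossing X Y := by
  by_contra hcr
  have hXY : X ≠ Y := fun e => O.ne_of_lt hlt (by rw [e])
  have sX := h.isStarOf hX
  have sY := h.isStarOf hY
  have hdis := Finset.disjoint_left.mp (h.disjoint hX hY hXY)
  have hside := O.lt_side hlt
  rw [nonCrossing_iff] at hcr
  push Not at hcr
  obtain ⟨x₀, hx₀, y₀, hy₀, hc⟩ := hcr
  rw [O.crosses_iff (sX.2 _ hx₀) (sY.2 _ hy₀) hside] at hc
  have hXs : ∀ x ∈ X.leaves, (X.center ∈ O.U ↔ x ∉ O.U) := fun x hx => O.adj_side (sX.2 x hx)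
  have hYs : ∀ x ∈ Y.leaves, (Y.center ∈ O.U ↔ x ∉ O.U) := fun x hx => O.adj_side (sY.2 x hx)
  have hXY' : Disjoint X.leaves Y.leaves := Finset.disjoint_left.mpr fun a ha hb =>
    hdis (CenteredStar.mem_verts.mpr (Or.inr ha)) (CenteredStar.mem_verts.mpr (Or.inr hb))
  set A := X.leaves ∪ Y.leaves with hA
  have hAs : ∀ x ∈ A, (X.center ∈ O.U ↔ x ∉ O.U) := by
    intro x hx
    rcases Finset.mem_union.mp hx with hx | hx
    · exact hXs x hx
    · rw [hside]; exact hYs x hx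
  have hAA : ∀ x ∈ A, ∀ y ∈ A, (x ∈ O.U ↔ y ∈ O.U) := by
    intro x hx y hy
    have h1 := hAs x hx
    have h2 := hAs y hy
    tauto
  have hAc : A.card = s + s := by rw [hA, Finset.card_union_of_disjoint hXY', sX.1, sY.1]
  obtain ⟨L, hLA, hLc, hlow⟩ := exists_lower_subset O.pos A s (by omega)
  set H := A \ L with hH
  have hHc : H.card = s := by rw [hH, Finset.card_sdiff_of_subset hLA]; omega
  have hHA : H ⊆ A := Finset.sdiff_subset
  have hLH : ∀ a ∈ L, ∀ b ∈ H, O.lt a b := by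
    intro a ha b hb
    have hb' := Finset.mem_sdiff.mp hb
    have h1 := hlow a ha b hb'.1 hb'.2
    have h2 := hAA a (hLA ha) b hb'.1
    rw [O.lt_iff_pos h2]
    refine lt_of_le_of_ne h1 fun e => hb'.2 ?_
    rwa [← O.pos_inj h2 e]
  have hdLH : Disjoint L H := Finset.disjoint_sdiff
  have hunion : L ∪ H = A := Finset.union_sdiff_of_subset hLA
  have memLH : ∀ a ∈ A, a ∉ L → a ∈ H := fun a ha hl => Finset.mem_sdiff.mpr ⟨ha, hl⟩
  have hXA : X.leaves ⊆ A := Finset.subset_union_left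
  have hYA : Y.leaves ⊆ A := Finset.subset_union_right
  -- A leaf of one star among the first `s` comes with a leaf of the other one among the last `s`.
  have adjL : ∀ l ∈ L, G.Adj X.center l := by
    intro l hl
    by_cases hlX : l ∈ X.leaves
    · exact sX.2 l hlX
    · have hlY : l ∈ Y.leaves := (Finset.mem_union.mp (hLA hl)).resolve_left hlX
      have : ¬ X.leaves ⊆ L := fun hsub => hlX (by
        rw [Finset.eq_of_subset_of_card_le hsub (by rw [hLc, sX.1])]; exact hl)
      obtain ⟨x, hx, hxL⟩ := Finset.not_subset.mp this
      exact (O.cross_adj (sX.2 x hx) (sY.2 l hlY) hlt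
        (hLH l hl x (memLH x (hXA hx) hxL))).1
  have adjH : ∀ l ∈ H, G.Adj Y.center l := by
    intro l hl
    by_cases hlY : l ∈ Y.leaves
    · exact sY.2 l hlY
    · have hlX : l ∈ X.leaves := (Finset.mem_union.mp (hHA hl)).resolve_right hlY
      have : ¬ Y.leaves ⊆ H := fun hsub => hlY (by
        rw [Finset.eq_of_subset_of_card_le hsub (by rw [hHc, sY.1])]; exact hl)
      obtain ⟨y, hy, hyH⟩ := Finset.not_subset.mp this
      have hyL : y ∈ L := by by_contra hh; exact hyH (memLH y (hYA hy) hh)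
      exact (O.cross_adj (sX.2 l hlX) (sY.2 y hy) hlt (hLH y hyL l hl)).2
  set X' : CenteredStar V := ⟨X.center, L⟩ with hX'
  set Y' : CenteredStar V := ⟨Y.center, H⟩ with hY'
  have sX' : X'.IsStarOf G s := ⟨hLc, adjL⟩
  have sY' : Y'.IsStarOf G s := ⟨hHc, adjH⟩
  have cXA : X.center ∉ A := fun hh => by have := hAs _ hh; tauto
  have cYA : Y.center ∉ A := fun hh => by have := hAs _ hh; tauto
  have hd' : Disjoint X'.verts Y'.verts := by
    rw [Finset.disjoint_left]
    intro v hv hv'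
    rw [CenteredStar.mem_verts] at hv hv'
    rcases hv with rfl | hv <;> rcases hv' with hv' | hv'
    · exact O.ne_of_lt hlt hv'
    · exact cXA (hHA hv')
    · exact cYA (hv' ▸ hLA hv)
    · exact Finset.disjoint_left.mp hdLH hv hv'
  have hv' : X'.verts ∪ Y'.verts = X.verts ∪ Y.verts := by
    ext v
    have e1 : v ∈ L ∨ v ∈ H ↔ v ∈ X.leaves ∨ v ∈ Y.leaves := by
      rw [← Finset.mem_union, hunion, hA, Finset.mem_union]
    simp only [Finset.mem_union, CenteredStar.mem_verts, hX', hY']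
    rw [or_or_or_comm, e1, or_or_or_comm]
  have hsub : O.scope X' ∪ O.scope Y' ⊆ O.scope X ∪ O.scope Y := by
    intro v hv
    by_contra hvn
    simp only [Finset.mem_union, not_or] at hvn hv
    -- The gap at `v` separates the two stars, so they were separated to begin with.
    have hab : ∃ a ∈ A, ∃ b ∈ A, O.le a v ∧ O.le v b ∧ ((a ∈ L ∧ b ∈ L) ∨ (a ∈ H ∧ b ∈ H)) := by
      rcases hv with hv | hv
      · obtain ⟨⟨a, ha, hav⟩, b, hb, hvb⟩ := O.mem_scope.mp hv
        exact ⟨a, hLA ha, b, hLA hb, hav, hvb, Or.inl ⟨ha, hb⟩⟩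
      · obtain ⟨⟨a, ha, hav⟩, b, hb, hvb⟩ := O.mem_scope.mp hv
        exact ⟨a, hHA ha, b, hHA hb, hav, hvb, Or.inr ⟨ha, hb⟩⟩
    obtain ⟨a, ha, b, hb, hav, hvb, hLHab⟩ := hab
    have hvs := le_side hav
    have hvA : ∀ x ∈ A, (x ∈ O.U ↔ v ∈ O.U) := fun x hx => (hAA x hx a ha).trans hvs
    have nX : ∀ x ∈ X.leaves, ∀ x' ∈ X.leaves, O.pos x ≤ O.pos v → O.pos v ≤ O.pos x' → False :=
      fun x hx x' hx' h1 h2 => hvn.1 (O.mem_scope.mpr ⟨⟨x, hx,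
        (le_iff_pos (hvA x (hXA hx))).mpr h1⟩, x', hx',
        (le_iff_pos (hvA x' (hXA hx')).symm).mpr h2⟩)
    have nY : ∀ x ∈ Y.leaves, ∀ x' ∈ Y.leaves, O.pos x ≤ O.pos v → O.pos v ≤ O.pos x' → False :=
      fun x hx x' hx' h1 h2 => hvn.2 (O.mem_scope.mpr ⟨⟨x, hx,
        (le_iff_pos (hvA x (hYA hx))).mpr h1⟩, x', hx',
        (le_iff_pos (hvA x' (hYA hx')).symm).mpr h2⟩)
    rw [le_iff_pos (hvA a ha)] at hav
    rw [le_iff_pos (hvA b hb).symm] at hvb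
    have sep : ∀ S T : Finset V, S ⊆ A → T ⊆ A → S.card = s → T.card = s →
        (∀ x ∈ S, ∀ x' ∈ S, O.pos x ≤ O.pos v → O.pos v ≤ O.pos x' → False) →
        (∀ x ∈ T, ∀ x' ∈ T, O.pos x ≤ O.pos v → O.pos v ≤ O.pos x' → False) →
        a ∈ S → b ∈ T → False := by
      intro S T hS hT hSc hTc nS nT haS hbT
      have hSlt : ∀ x ∈ S, O.pos x < O.pos v := fun x hx => by
        by_contra hh; exact nS a haS x hx hav (by omega)
      have hTgt : ∀ x ∈ T, O.pos v < O.pos x := fun x hx => by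
        by_contra hh; exact nT x hx b hbT (by omega) hvb
      rcases hLHab with ⟨haL, hbL⟩ | ⟨haH, hbH⟩
      · have hSL : S ⊆ L := by
          intro x hx
          by_contra hxL
          have := O.pos_lt_pos (hLH b hbL x (memLH x (hS hx) hxL))
          have := hSlt x hx
          omega
        have : b ∈ S := by
          rw [Finset.eq_of_subset_of_card_le hSL (by omega)]; exact hbL
        exact nS a haS b this hav hvb
      · have hTH : T ⊆ H := by
          intro x hx
          by_contra hxH
          have hxL : x ∈ L := by by_contra hh; exact hxH (memLH x (hT hx) hh)
          have := O.pos_lt_pos (hLH x hxL a haH)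
          have := hTgt x hx
          omega
        have : a ∈ T := by
          rw [Finset.eq_of_subset_of_card_le hTH (by omega)]; exact haH
        exact nT a this b hbT hav hvb
    rcases Finset.mem_union.mp ha with haX | haY <;> rcases Finset.mem_union.mp hb with hbX | hbY
    · exact nX a haX b hbX hav hvb
    · exact sep _ _ hXA hYA sX.1 sY.1 nX nY haX hbY
    · exact sep _ _ hYA hXA sY.1 sX.1 nY nX haY hbX
    · exact nY a haY b hbY hav hvb
  have hdsc : Disjoint (O.scope X') (O.scope Y') := by
    rw [Finset.disjoint_left]
    intro v hv hv'
    obtain ⟨-, b, hb, hvb⟩ := O.mem_scope.mp hv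
    obtain ⟨⟨a, ha, hav⟩, -⟩ := O.mem_scope.mp hv'
    have h1 := O.pos_lt_pos (hLH b hb a ha)
    have h2 := (le_iff_pos (le_side hvb)).mp hvb
    have h3 := (le_iff_pos (le_side hav)).mp hav
    omega
  have hw : O.width X' + O.width Y' ≤ O.width X + O.width Y := by
    rw [width, width, ← Finset.card_union_of_disjoint hdsc]
    exact (Finset.card_le_card hsub).trans (Finset.card_union_le _ _)
  have hz := (h.not_exchange hX hY hXY sX' sY' hd' hv' hw).2 ?_
  · have e1 : O.crossingNumber X' Y' = 0 := by
      change O.NonCrossing X' Y'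
      rw [nonCrossing_iff]
      intro x hx y hy hc'
      rw [O.crosses_iff (adjL x hx) (adjH y hy) hside] at hc'
      rcases hc' with ⟨-, h2⟩ | ⟨h2, -⟩
      · exact O.lt_asymm h2 (hLH x hx y hy)
      · exact O.lt_asymm hlt h2
    have e2 : O.NonCrossing X Y := by rw [NonCrossing]; omega
    rw [nonCrossing_iff] at e2
    exact e2 x₀ hx₀ y₀ hy₀ ((O.crosses_iff (sX.2 _ hx₀) (sY.2 _ hy₀) hside).mpr hc)
  · intro Z hZ hZX hZY z hz
    have aZ := (h.isStarOf hZ).2 z hz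
    have dX := Finset.disjoint_left.mp (h.disjoint hZ hX hZX)
    have dY := Finset.disjoint_left.mp (h.disjoint hZ hY hZY)
    obtain ⟨u, w, he, huw, hu, huX, huY, hwA⟩ : ∃ u w, s(Z.center, z) = s(u, w) ∧ G.Adj u w ∧
        (X.center ∈ O.U ↔ u ∈ O.U) ∧ u ≠ X.center ∧ u ≠ Y.center ∧ w ∉ A := by
      have nv : ∀ v ∈ Z.verts, v ≠ X.center ∧ v ≠ Y.center ∧ v ∉ A := by
        intro v hv
        refine ⟨fun e => dX hv (CenteredStar.mem_verts.mpr (Or.inl e)),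
          fun e => dY hv (CenteredStar.mem_verts.mpr (Or.inl e)), fun e => ?_⟩
        rcases Finset.mem_union.mp e with e | e
        · exact dX hv (CenteredStar.mem_verts.mpr (Or.inr e))
        · exact dY hv (CenteredStar.mem_verts.mpr (Or.inr e))
      have n1 := nv Z.center (CenteredStar.mem_verts.mpr (Or.inl rfl))
      have n2 := nv z (CenteredStar.mem_verts.mpr (Or.inr hz))
      have n3 := O.adj_side aZ
      by_cases hs : X.center ∈ O.U ↔ Z.center ∈ O.U
      · exact ⟨_, _, rfl, aZ, hs, n1.1, n1.2.1, n2.2.2⟩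
      · exact ⟨_, _, Sym2.eq_swap, aZ.symm, by tauto, n2.1, n2.2.1, n1.2.2⟩
    have hwA' : ∀ x ∈ A, O.lt w x ∨ O.lt x w := by
      intro x hx
      have h1 := O.adj_side huw
      have h2 := hAs x hx
      rcases O.total (x := w) (y := x) (by tauto) with h3 | h3 | h3
      · exact Or.inl h3
      · exact absurd (h3 ▸ hx) hwA
      · exact Or.inr h3
    rw [he, crossWith_eq O X' sX' huw hu, crossWith_eq O X sX huw hu,
      crossWith_eq O Y' sY' huw (hside.symm.trans hu), crossWith_eq O Y sY huw (hside.symm.trans hu)]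
    simp only [hX', hY']
    have count : ∀ q : V → Prop, (L.filter q).card + (H.filter q).card =
        (X.leaves.filter q).card + (Y.leaves.filter q).card := by
      intro q
      rw [← Finset.card_union_of_disjoint (Finset.disjoint_filter_filter hdLH),
        ← Finset.card_union_of_disjoint (Finset.disjoint_filter_filter hXY'),
        ← Finset.filter_union, ← Finset.filter_union, hunion]
    have nl : ∀ {a b : V}, O.lt a b → ¬ O.lt b a := fun h1 h2 => O.lt_asymm h1 h2
    rcases O.total hu with hXu | hXu | hXu
    · rcases O.total (hside.symm.trans hu) with hYu | hYu | hYu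
      · simp only [hXu, hYu, nl hXu, nl hYu, true_and, false_and, or_false]
        exact (count _).le
      · exact absurd hYu.symm huY
      · simp only [hXu, hYu, nl hXu, nl hYu, true_and, false_and, or_false, false_or]
        have c1 := count fun x => O.lt w x
        have c2 := count fun x => O.lt x w
        by_cases hl : ∃ l ∈ L, O.lt w l
        · obtain ⟨l, hl, hwl⟩ := hl
          have e1 : H.filter (fun x => O.lt x w) = ∅ := by
            rw [Finset.filter_eq_empty_iff]
            exact fun x hx => nl (O.lt_trans hwl (hLH l hl x hx))
          have e2 : H.filter (fun x => O.lt w x) = H := by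
            rw [Finset.filter_eq_self]
            exact fun x hx => O.lt_trans hwl (hLH l hl x hx)
          have e3 := Finset.card_filter_le Y.leaves (fun x => O.lt w x)
          rw [e1, Finset.card_empty]
          rw [e2, hHc] at c1
          rw [sY.1] at e3
          omega
        · push Not at hl
          have e1 : L.filter (fun x => O.lt w x) = ∅ := by
            rw [Finset.filter_eq_empty_iff]
            exact fun x hx => hl x hx
          have e2 : L.filter (fun x => O.lt x w) = L := by
            rw [Finset.filter_eq_self]
            exact fun x hx => (hwA' x (hLA hx)).resolve_left (hl x hx)
          have e3 := Finset.card_filter_le X.leaves (fun x => O.lt x w)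
          rw [e1, Finset.card_empty]
          rw [e2, hLc] at c2
          rw [sX.1] at e3
          omega
    · exact absurd hXu.symm huX
    · have hYu := O.lt_trans hXu hlt
      simp only [hXu, hYu, nl hXu, nl hYu, true_and, false_and, false_or]
      exact (count _).le

theorem IsMinScore.nonCrossing_of_same_side (h : O.IsMinScore s P) {X Y : CenteredStar V}
    (hX : X ∈ P) (hY : Y ∈ P) (hXY : X ≠ Y) (hs : X.center ∈ O.U ↔ Y.center ∈ O.U) :
    O.NonCrossing X Y := by
  rcases O.total hs with h1 | h1 | h1
  · exact h.nonCrossing_of_lt hX hY h1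
  · exact absurd (CenteredStar.mem_verts.mpr (Or.inl h1)) (Finset.disjoint_left.mp
      (h.disjoint hX hY hXY) (CenteredStar.mem_verts.mpr (Or.inl rfl)))
  · exact O.nonCrossing_comm.mpr (h.nonCrossing_of_lt hY hX h1)

end StrongOrdering

namespace StrongOrdering

variable {V : Type*} {G : SimpleGraph V}
variable [Fintype V] {O : StrongOrdering G} {s : ℕ} {P : Finset (CenteredStar V)}

/-! ### Crossing stars with centers on different sides -/

theorem IsMinScore.center_ne_leaf (h : O.IsMinScore s P) {X Y : CenteredStar V} (hX : X ∈ P)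
    (hY : Y ∈ P) (hXY : X ≠ Y) {y : V} (hy : y ∈ Y.leaves) : X.center ≠ y := fun e =>
  Finset.disjoint_left.mp (h.disjoint hX hY hXY) (CenteredStar.mem_verts.mpr (Or.inl rfl))
    (CenteredStar.mem_verts.mpr (Or.inr (e ▸ hy)))

theorem IsMinScore.leaf_ne_leaf (h : O.IsMinScore s P) {X Y : CenteredStar V} (hX : X ∈ P)
    (hY : Y ∈ P) (hXY : X ≠ Y) {x y : V} (hx : x ∈ X.leaves) (hy : y ∈ Y.leaves) : x ≠ y := fun e =>
  Finset.disjoint_left.mp (h.disjoint hX hY hXY) (CenteredStar.mem_verts.mpr (Or.inr hx))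
    (CenteredStar.mem_verts.mpr (Or.inr (e ▸ hy)))

theorem IsMinScore.center_ne_center (h : O.IsMinScore s P) {X Y : CenteredStar V} (hX : X ∈ P)
    (hY : Y ∈ P) (hXY : X ≠ Y) : X.center ≠ Y.center := fun e =>
  Finset.disjoint_left.mp (h.disjoint hX hY hXY) (CenteredStar.mem_verts.mpr (Or.inl rfl))
    (CenteredStar.mem_verts.mpr (Or.inl e))

/-- The exchange for two crossing stars `X` and `Y` with centers on different sides, where the center
of `X` lies before all leaves of `Y`: the last leaf `m` of `X` becomes the center of `Y`, and the old
center of `Y` becomes a leaf of `X`. -/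
theorem IsMinScore.swap_center (h : O.IsMinScore s P) {X Y : CenteredStar V} (hX : X ∈ P)
    (hY : Y ∈ P) (hside : X.center ∈ O.U ↔ Y.center ∉ O.U)
    (hall : ∀ y ∈ Y.leaves, O.lt X.center y) {m : V} (hm : m ∈ X.leaves)
    (hlt : O.lt Y.center m) :
    (⟨X.center, insert Y.center (X.leaves.erase m)⟩ : CenteredStar V).IsStarOf G s ∧
    (⟨m, Y.leaves⟩ : CenteredStar V).IsStarOf G s ∧
    Disjoint (⟨X.center, insert Y.center (X.leaves.erase m)⟩ : CenteredStar V).verts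
      (⟨m, Y.leaves⟩ : CenteredStar V).verts ∧
    (⟨X.center, insert Y.center (X.leaves.erase m)⟩ : CenteredStar V).verts ∪
      (⟨m, Y.leaves⟩ : CenteredStar V).verts = X.verts ∪ Y.verts := by
  have sX := h.isStarOf hX
  have sY := h.isStarOf hY
  have hXY : X ≠ Y := by rintro rfl; tauto
  have hcard : 0 < X.leaves.card := Finset.card_pos.mpr ⟨m, hm⟩
  have hYX : Y.center ∉ X.leaves := fun hh => h.center_ne_leaf hY hX hXY.symm hh rfl
  obtain ⟨y, hy⟩ : Y.leaves.Nonempty := by rw [← Finset.card_pos, sY.1, ← sX.1]; exact hcard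
  have adj : ∀ y ∈ Y.leaves, G.Adj X.center Y.center ∧ G.Adj y m := fun y hy =>
    O.cross_adj (sX.2 m hm) (sY.2 y hy).symm (hall y hy) hlt
  have nXm : X.center ≠ m := fun e => (sX.2 m hm).ne e
  refine ⟨⟨?_, ?_⟩, ⟨sY.1, fun y hy => (adj y hy).2.symm⟩, ?_, ?_⟩
  · rw [Finset.card_insert_of_notMem (by simp [hYX]), Finset.card_erase_of_mem hm, sX.1]
    have := sX.1
    omega
  · intro v hv
    rcases Finset.mem_insert.mp hv with rfl | hv
    · exact (adj y hy).1
    · exact sX.2 v (Finset.mem_of_mem_erase hv)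
  · rw [Finset.disjoint_left]
    intro v hv hv'
    simp only [CenteredStar.mem_verts, Finset.mem_insert, Finset.mem_erase] at hv hv'
    rcases hv with rfl | rfl | hv <;> rcases hv' with hv' | hv'
    · exact nXm hv'
    · exact h.center_ne_leaf hX hY hXY hv' rfl
    · exact O.ne_of_lt hlt hv'
    · exact (sY.2 _ hv').ne rfl
    · exact hv.1 hv'
    · exact h.leaf_ne_leaf hX hY hXY hv.2 hv' rfl
  · ext v
    simp only [Finset.mem_union, CenteredStar.mem_verts, Finset.mem_insert, Finset.mem_erase]
    by_cases hvm : v = m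
    · subst hvm; simp [hm]
    · simp only [hvm, ne_eq, not_false_eq_true, true_and, false_or]
      clear * -
      tauto

theorem exists_last_leaf {X : CenteredStar V} (hX : X.IsStarOf G s) {x : V} (hx : x ∈ X.leaves) :
    ∃ m ∈ X.leaves, O.le x m ∧ ∀ a ∈ X.leaves, a = m ∨ O.lt a m := by
  obtain ⟨m, hm, hmax⟩ := Finset.exists_max_image X.leaves O.pos ⟨x, hx⟩
  have hs : ∀ a ∈ X.leaves, (a ∈ O.U ↔ m ∈ O.U) := fun a ha => by
    have h1 := O.adj_side (hX.2 a ha)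
    have h2 := O.adj_side (hX.2 m hm)
    tauto
  refine ⟨m, hm, (le_iff_pos (hs x hx)).mpr (hmax x hx), fun a ha => ?_⟩
  exact (le_iff_pos (hs a ha)).mpr (hmax a ha)

omit [Fintype V] in
theorem lt_of_le_of_lt' {a b c : V} (h : O.le a b) (h' : O.lt b c) : O.lt a c := by
  rcases h with rfl | h
  · exact h'
  · exact O.lt_trans h h'

omit [Fintype V] in
theorem lt_of_lt_of_le' {a b c : V} (h : O.lt a b) (h' : O.le b c) : O.lt a c := by
  rcases h' with rfl | h'
  · exact h
  · exact O.lt_trans h h'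

/-- If the center of `X` lies before all leaves of `Y`, then the center of `Y` does not lie between
two leaves of `X`: otherwise `swap_center` shortens the scope of `X`. -/
theorem IsMinScore.not_between (h : O.IsMinScore s P) {X Y : CenteredStar V} (hX : X ∈ P)
    (hY : Y ∈ P) (hside : X.center ∈ O.U ↔ Y.center ∉ O.U)
    (hall : ∀ y ∈ Y.leaves, O.lt X.center y) {a x : V} (ha : a ∈ X.leaves) (hx : x ∈ X.leaves)
    (hac : O.lt a Y.center) (hcx : O.lt Y.center x) : False := by
  have hXY : X ≠ Y := by rintro rfl; tauto
  obtain ⟨m, hm, hxm, hmax⟩ := exists_last_leaf (O := O) (h.isStarOf hX) hx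
  have hcm : O.lt Y.center m := lt_of_lt_of_le' hcx hxm
  obtain ⟨s1, s2, d, u⟩ := h.swap_center hX hY hside hall hm hcm
  have hlt : O.width ⟨X.center, insert Y.center (X.leaves.erase m)⟩ < O.width X := by
    apply Finset.card_lt_card
    rw [Finset.ssubset_iff_of_subset]
    · refine ⟨m, O.leaf_mem_scope hm, fun hmem => ?_⟩
      obtain ⟨-, b, hb, hmb⟩ := O.mem_scope.mp hmem
      rcases Finset.mem_insert.mp hb with rfl | hb
      · exact O.lt_asymm hcm (lt_of_le_of_lt' hmb hcm |> fun h1 => absurd h1 (O.lt_irrefl m))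
      · have hb' := Finset.mem_erase.mp hb
        exact O.lt_irrefl m (lt_of_le_of_lt' hmb ((hmax b hb'.2).resolve_left hb'.1))
    · intro v hv
      obtain ⟨⟨b, hb, hbv⟩, b', hb', hvb'⟩ := O.mem_scope.mp hv
      rw [O.mem_scope]
      constructor
      · rcases Finset.mem_insert.mp hb with rfl | hb
        · exact ⟨a, ha, Or.inr (lt_of_lt_of_le' hac hbv)⟩
        · exact ⟨b, Finset.mem_of_mem_erase hb, hbv⟩
      · rcases Finset.mem_insert.mp hb' with rfl | hb'
        · exact ⟨m, hm, Or.inr (lt_of_le_of_lt' hvb' hcm)⟩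
        · exact ⟨b', Finset.mem_of_mem_erase hb', hvb'⟩
  have hwY : O.width ⟨m, Y.leaves⟩ = O.width Y := rfl
  have := (h.not_exchange hX hY hXY s1 s2 d u (by omega)).1
  omega

set_option maxHeartbeats 1000000 in
/-- If the center of `X` lies before all leaves of `Y`, then the center of `Y` lies after all leaves
of `X`. Induction on the gap between the center of `Y` and a later leaf of `X`: the vertex that follows
the center of `Y` belongs to a star that can take the role of `X` or of `Y`, until the gap closes and
`swap_center` applies. -/
theorem IsMinScore.not_lt_leaf (h : O.IsMinScore s P) : ∀ (g : ℕ) {X Y : CenteredStar V},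
    X ∈ P → Y ∈ P → (X.center ∈ O.U ↔ Y.center ∉ O.U) → (∀ y ∈ Y.leaves, O.lt X.center y) →
    ∀ {x : V}, x ∈ X.leaves → O.lt Y.center x → O.pos x ≤ O.pos Y.center + g → False := by
  intro g
  induction g with
  | zero =>
    intro X Y _ _ _ _ x _ hcx hg
    have := O.pos_lt_pos hcx
    omega
  | succ g ih =>
    intro X Y hX hY hside hall x hx hcx hg
    have hXY : X ≠ Y := by rintro rfl; tauto
    have sX := h.isStarOf hX
    have sY := h.isStarOf hY
    have hXs : ∀ a ∈ X.leaves, (a ∈ O.U ↔ Y.center ∈ O.U) := fun a ha => by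
      have h1 := O.adj_side (sX.2 a ha)
      clear * - h1 hside; tauto
    have hYs : ∀ a ∈ Y.leaves, (a ∈ O.U ↔ X.center ∈ O.U) := fun a ha => by
      have h1 := O.adj_side (sY.2 a ha)
      clear * - h1 hside; tauto
    obtain ⟨y₀, hy₀⟩ : Y.leaves.Nonempty := by
      rw [← Finset.card_pos, sY.1, ← sX.1]; exact Finset.card_pos.mpr ⟨x, hx⟩
    have hXgt : ∀ a ∈ X.leaves, O.lt Y.center a := by
      intro a ha
      rcases O.total (hXs a ha) with h1 | h1 | h1
      · exact (h.not_between hX hY hside hall ha hx h1 hcx).elim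
      · exact absurd h1.symm (h.center_ne_leaf hY hX hXY.symm ha)
      · exact h1
    -- Stars with center on the side of `Y`, beyond its center, have their leaves beyond those of `Y`.
    have hbeyond : ∀ Z ∈ P, O.lt Y.center Z.center → ∀ z ∈ Z.leaves, O.lt X.center z := by
      intro Z hZ hlt z hz
      have hYZ : Y ≠ Z := by rintro rfl; exact O.lt_irrefl _ hlt
      have nc := h.nonCrossing_of_lt hY hZ hlt
      rw [nonCrossing_iff] at nc
      have nc := nc y₀ hy₀ z hz
      have aZ := (h.isStarOf hZ).2 z hz
      rw [O.crosses_iff (sY.2 _ hy₀) aZ (O.lt_side hlt)] at nc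
      have h2 := O.lt_side hlt
      have h3 := O.adj_side aZ
      have h4 := hYs y₀ hy₀
      rcases O.total (x := y₀) (y := z) (by clear * - h2 h3 h4 hside; tauto) with h5 | h5 | h5
      · exact O.lt_trans (hall y₀ hy₀) h5
      · exact absurd h5 (h.leaf_ne_leaf hY hZ hYZ hy₀ hz)
      · exact absurd (Or.inl ⟨hlt, h5⟩) nc
    -- Stars with center on the side of `X`.
    have hnc : ∀ Z ∈ P, Z ≠ X → (Z.center ∈ O.U ↔ X.center ∈ O.U) → ∀ z ∈ Z.leaves, ∀ a ∈ X.leaves,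
        (O.lt z a ∧ O.lt Z.center X.center) ∨ (O.lt a z ∧ O.lt X.center Z.center) := by
      intro Z hZ hZX hs z hz a ha
      have nc := h.nonCrossing_of_same_side hX hZ hZX.symm hs.symm
      rw [nonCrossing_iff] at nc
      have nc := nc a ha z hz
      have aZ := (h.isStarOf hZ).2 z hz
      rw [O.crosses_iff (sX.2 _ ha) aZ hs.symm] at nc
      have h3 := O.adj_side aZ
      have h4 := hXs a ha
      have h5 := O.total (x := a) (y := z) (by clear * - h3 h4 hs hside; tauto)
      have h6 := O.total hs
      have h7 := h.leaf_ne_leaf hX hZ hZX.symm ha hz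
      have h8 := h.center_ne_center hX hZ hZX.symm
      rcases h5 with h5 | h5 | h5
      · rcases h6 with h6 | h6 | h6
        · exact absurd (Or.inr ⟨h6, h5⟩) nc
        · exact absurd h6.symm h8
        · exact Or.inr ⟨h5, h6⟩
      · exact absurd h5 h7
      · rcases h6 with h6 | h6 | h6
        · exact Or.inl ⟨h5, h6⟩
        · exact absurd h6.symm h8
        · exact absurd (Or.inl ⟨h6, h5⟩) nc
    obtain ⟨w, hwU, hwp⟩ := O.exists_succ hcx
    have hcw : O.lt Y.center w := by rw [O.lt_iff_pos hwU.symm]; omega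
    by_cases hwX : w ∈ X.leaves
    · -- The gap is closed: exchange.
      obtain ⟨m, hm, hwm, hmax⟩ := exists_last_leaf (O := O) sX hwX
      have hcm : O.lt Y.center m := hXgt m hm
      obtain ⟨s1, s2, d, u⟩ := h.swap_center hX hY hside hall hm hcm
      have hsub : O.scope ⟨X.center, insert Y.center (X.leaves.erase m)⟩ ⊆
          insert Y.center ((O.scope X).erase m) := by
        intro v hv
        obtain ⟨⟨b, hb, hbv⟩, b', hb', hvb'⟩ := O.mem_scope.mp hv
        have hge : O.le Y.center v := by
          rcases Finset.mem_insert.mp hb with rfl | hb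
          · exact hbv
          · exact Or.inr (lt_of_lt_of_le' (hXgt b (Finset.mem_of_mem_erase hb)) hbv)
        rcases hge with rfl | hcv
        · exact Finset.mem_insert_self _ _
        · have hvs := O.lt_side hcv
          rcases Finset.mem_insert.mp hb' with rfl | hb'
          · exact (O.lt_irrefl _ (lt_of_lt_of_le' hcv hvb')).elim
          · have hb'' := Finset.mem_erase.mp hb'
            have hvm := lt_of_le_of_lt' hvb' ((hmax b' hb''.2).resolve_left hb''.1)
            refine Finset.mem_insert_of_mem (Finset.mem_erase.mpr ⟨O.ne_of_lt hvm, ?_⟩)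
            refine O.mem_scope.mpr ⟨⟨w, hwX, ?_⟩, b', hb''.2, hvb'⟩
            rw [le_iff_pos (hwU.trans hvs), hwp]
            exact O.pos_lt_pos hcv
      have hw : O.width ⟨X.center, insert Y.center (X.leaves.erase m)⟩ ≤ O.width X := by
        have h1 := Finset.card_le_card hsub
        have h2 := Finset.card_insert_le Y.center ((O.scope X).erase m)
        have h3 := Finset.card_erase_of_mem (O.leaf_mem_scope hm)
        have h4 := Finset.card_pos.mpr ⟨m, O.leaf_mem_scope hm⟩
        unfold width
        omega
      have hwY : O.width ⟨m, Y.leaves⟩ = O.width Y := rfl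
      have key := (h.not_exchange hX hY hXY s1 s2 d u (by omega)).2 ?_
      · have e1 : O.NonCrossing ⟨X.center, insert Y.center (X.leaves.erase m)⟩ ⟨m, Y.leaves⟩ := by
          rw [nonCrossing_iff]
          intro b hb y hy
          have hbm : O.lt b m := by
            rcases Finset.mem_insert.mp hb with rfl | hb
            · exact hcm
            · have hb' := Finset.mem_erase.mp hb
              exact (hmax b hb'.2).resolve_left hb'.1
          rw [Sym2.eq_swap (a := m), O.crosses_iff (s1.2 b hb) (s2.2 y hy).symm
            (O.lt_side (hall y hy))]
          rintro (⟨-, h2⟩ | ⟨h2, -⟩)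
          · exact O.lt_asymm h2 hbm
          · exact O.lt_asymm h2 (hall y hy)
        have e2 : O.NonCrossing X Y := by
          have : O.crossingNumber _ _ = 0 := e1
          rw [NonCrossing]; omega
        rw [nonCrossing_iff] at e2
        refine e2 x hx y₀ hy₀ ?_
        rw [Sym2.eq_swap (a := Y.center), O.crosses_iff (sX.2 x hx) (sY.2 y₀ hy₀).symm
          (O.lt_side (hall y₀ hy₀))]
        exact Or.inl ⟨hall y₀ hy₀, hcx⟩
      · intro Z hZ hZX hZY z hz
        have aZ := (h.isStarOf hZ).2 z hz
        obtain ⟨u, v, he, huv, hu, hvm, hvout⟩ : ∃ u v, s(Z.center, z) = s(u, v) ∧ G.Adj u v ∧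
            (X.center ∈ O.U ↔ u ∈ O.U) ∧ v ≠ m ∧ (O.lt v Y.center ∨ O.lt m v) := by
          have hzs := O.adj_side aZ
          by_cases hs : X.center ∈ O.U ↔ Z.center ∈ O.U
          · refine ⟨_, _, rfl, aZ, hs, (h.leaf_ne_leaf hX hZ hZX.symm hm hz).symm, ?_⟩
            have h1 := hnc Z hZ hZX hs.symm z hz m hm
            have h2 := hnc Z hZ hZX hs.symm z hz w hwX
            rcases h1 with ⟨h1, h3⟩ | ⟨h1, -⟩
            · rcases h2 with ⟨h2, -⟩ | ⟨-, h4⟩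
              · left
                have h5 := O.total (x := z) (y := Y.center) (by clear * - hzs hs hside; tauto)
                rcases h5 with h5 | h5 | h5
                · exact h5
                · exact absurd h5.symm (h.center_ne_leaf hY hZ hZY.symm hz)
                · have := O.pos_lt_pos h2
                  have := O.pos_lt_pos h5
                  omega
              · exact (O.lt_asymm h3 h4).elim
            · exact Or.inr h1
          · refine ⟨_, _, Sym2.eq_swap, aZ.symm, by clear * - hzs hs; tauto, h.center_ne_leaf hZ hX hZX hm, ?_⟩
            have hZY' : Z.center ∈ O.U ↔ Y.center ∈ O.U := by clear * - hs hside; tauto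
            have h5 := O.total hZY'
            rcases h5 with h5 | h5 | h5
            · exact Or.inl h5
            · exact absurd h5 (h.center_ne_center hZ hY hZY)
            · right
              have hZw : O.lt w Z.center := by
                rw [O.lt_iff_pos (hwU.trans hZY'.symm)]
                have := O.pos_lt_pos h5
                have h6 : O.pos w ≠ O.pos Z.center := fun e =>
                  h.center_ne_leaf hZ hX hZX hwX (O.pos_inj (hwU.trans hZY'.symm) e).symm
                omega
              have hms := hXs m hm
              rcases O.total (hms.trans hZY'.symm) with h7 | h7 | h7
              · exact h7
              · exact absurd h7.symm (h.center_ne_leaf hZ hX hZX hm)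
              · exact (h.not_between hX hZ (by clear * - hs; tauto) (hbeyond Z hZ h5) hwX hm hZw h7).elim
        rw [he, crossWith_eq O _ s1 huv hu, crossWith_eq O X sX huv hu]
        have hmu : m ∈ O.U ↔ v ∈ O.U := by
          have h1 := hXs m hm
          have h2 := O.adj_side huv
          clear * - h1 h2 hu hside; tauto
        have hvall : ∀ b, O.le Y.center b → O.le b m → (O.lt v b ↔ O.lt v m) ∧
            (O.lt b v ↔ O.lt m v) := by
          intro b hb1 hb2
          rcases hvout with hv | hv
          · have i1 := lt_of_lt_of_le' hv hb1
            have i2 := O.lt_trans hv hcm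
            exact ⟨iff_of_true i1 i2, ⟨fun hh => (O.lt_asymm hh i1).elim,
              fun hh => (O.lt_asymm hh i2).elim⟩⟩
          · have i1 := lt_of_le_of_lt' hb2 hv
            exact ⟨⟨fun hh => (O.lt_asymm hh i1).elim, fun hh => (O.lt_asymm hh hv).elim⟩, iff_of_true i1 hv⟩
        have cX : ∀ L : Finset V, (∀ b ∈ L, O.le Y.center b ∧ O.le b m) →
            (L.filter fun x => (O.lt X.center u ∧ O.lt v x) ∨ (O.lt u X.center ∧ O.lt x v)) =
            L.filter fun _ => (O.lt X.center u ∧ O.lt v m) ∨ (O.lt u X.center ∧ O.lt m v) := by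
          intro L hL
          apply Finset.filter_congr
          intro b hb
          obtain ⟨h1, h2⟩ := hvall b (hL b hb).1 (hL b hb).2
          rw [h1, h2]
        have e1 : O.crossWith ⟨m, Y.leaves⟩ s(u, v) = O.crossWith Y s(u, v) := by
          rw [Sym2.eq_swap, crossWith_eq O _ s2 huv.symm hmu,
            crossWith_eq O Y sY huv.symm ((hXs m hm).symm.trans hmu)]
          congr 1
          apply Finset.filter_congr
          intro b _
          obtain ⟨h1, h2⟩ := hvall Y.center (Or.inl rfl) (Or.inr hcm)
          simp only [h1, h2]
        rw [e1, cX X.leaves (fun b hb => ⟨Or.inr (hXgt b hb), hmax b hb⟩), cX]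
        · have hc : (insert Y.center (X.leaves.erase m)).card = X.leaves.card := s1.1.trans sX.1.symm
          apply le_of_eq
          congr 1
          by_cases hq : (O.lt X.center u ∧ O.lt v m) ∨ (O.lt u X.center ∧ O.lt m v)
          · rw [Finset.filter_true_of_mem (fun _ _ => hq), Finset.filter_true_of_mem (fun _ _ => hq),
              hc]
          · rw [Finset.filter_false_of_mem (fun _ _ => hq),
              Finset.filter_false_of_mem (fun _ _ => hq)]
        · intro b hb
          rcases Finset.mem_insert.mp hb with rfl | hb
          · exact ⟨Or.inl rfl, Or.inr hcm⟩
          · have hb' := Finset.mem_of_mem_erase hb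
            exact ⟨Or.inr (hXgt b hb'), hmax b hb'⟩
    · -- The gap is open: replace one of the stars by the star of `w`.
      have hwx : O.lt w x := by
        rw [O.lt_iff_pos (hwU.trans (hXs x hx).symm)]
        have := O.pos_lt_pos hcx
        have h6 : O.pos w ≠ O.pos x := fun e =>
          hwX (O.pos_inj (hwU.trans (hXs x hx).symm) e ▸ hx)
        omega
      obtain ⟨Z, hZ, hwZ⟩ := h.1.2.2 w
      rcases CenteredStar.mem_verts.mp hwZ with rfl | hwl
      · exact ih hX hZ (by clear * - hwU hside; tauto) (hbeyond Z hZ hcw) hx hwx (by omega)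
      · have hZX : Z ≠ X := by rintro rfl; exact hwX hwl
        have hs : Z.center ∈ O.U ↔ X.center ∈ O.U := by
          have := O.adj_side ((h.isStarOf hZ).2 w hwl)
          clear * - this hwU hside; tauto
        rcases hnc Z hZ hZX hs w hwl x hx with ⟨-, h1⟩ | ⟨h1, -⟩
        · by_cases hg0 : g = 0
          · subst hg0
            have := O.pos_lt_pos hwx
            omega
          · exact ih hZ hY (by clear * - hs hside; tauto) (fun y hy => O.lt_trans h1 (hall y hy)) hwl hcw (by omega)
        · exact O.lt_asymm h1 hwx

theorem IsMinScore.interleaving_of_lt (h : O.IsMinScore s P) {X Y : CenteredStar V} (hX : X ∈ P)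
    (hY : Y ∈ P) (hside : X.center ∈ O.U ↔ Y.center ∉ O.U) {x y : V} (hx : x ∈ X.leaves)
    (hy : y ∈ Y.leaves) (hxy : O.lt X.center y) (hyx : O.lt Y.center x) : O.Interleaving X Y := by
  have aux : ∀ {X Y : CenteredStar V}, X ∈ P → Y ∈ P → (X.center ∈ O.U ↔ Y.center ∉ O.U) →
      ∀ {x y : V}, x ∈ X.leaves → y ∈ Y.leaves → O.lt X.center y → O.lt Y.center x →
      X.center ∈ O.scope Y := by
    intro X Y hX hY hside x y hx hy hxy hyx
    by_contra hn
    have hXY : X ≠ Y := by rintro rfl; tauto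
    refine h.not_lt_leaf (O.pos x) hX hY hside (fun b hb => ?_) hx hyx (by omega)
    have := O.adj_side ((h.isStarOf hY).2 b hb)
    rcases O.total (x := b) (y := X.center) (by tauto) with h1 | h1 | h1
    · exact (hn (O.mem_scope.mpr ⟨⟨b, hb, Or.inr h1⟩, y, hy, Or.inr hxy⟩)).elim
    · exact absurd h1.symm (h.center_ne_leaf hX hY hXY hb)
    · exact h1
  exact ⟨aux hX hY hside hx hy hxy hyx, aux hY hX (by tauto) hy hx hyx hxy⟩

theorem IsMinScore.isGood (h : O.IsMinScore s P) : O.IsGood P := by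
  intro X hX Y hY hXY
  by_cases hs : X.center ∈ O.U ↔ Y.center ∈ O.U
  · exact Or.inl (h.nonCrossing_of_same_side hX hY hXY hs)
  · by_contra hcon
    push Not at hcon
    obtain ⟨hcr, hni⟩ := hcon
    rw [nonCrossing_iff] at hcr
    push Not at hcr
    obtain ⟨x, hx, y, hy, hc⟩ := hcr
    have aX := (h.isStarOf hX).2 x hx
    have aY := (h.isStarOf hY).2 y hy
    have h1 := O.adj_side aY
    rw [Sym2.eq_swap (a := Y.center), O.crosses_iff aX aY.symm (by tauto)] at hc
    rcases hc with ⟨h2, h3⟩ | ⟨h2, h3⟩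
    · exact hni (h.interleaving_of_lt hX hY (by tauto) hx hy h2 h3)
    · exact hni ((O.interleaving_dual X Y).mp
        (h.dual.interleaving_of_lt hX hY (by simp only [dual_U]; tauto) hx hy h2 h3))

theorem IsMinScore.interleaving_unique (h : O.IsMinScore s P) {X Y Z : CenteredStar V}
    (hY : Y ∈ P) (hZ : Z ∈ P) (hXY : O.Interleaving X Y)
    (hXZ : O.Interleaving X Z) : Y = Z := by
  -- Of two stars interleaving with `X`, one has a leaf before the center of `X` and the other one a
  -- leaf after it, in an order opposite to that of their centers.
  have aux : ∀ {Y Z : CenteredStar V}, Y ∈ P → Z ∈ P → O.Interleaving X Y → O.Interleaving X Z →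
      O.lt Y.center Z.center → False := by
    intro Y Z hY hZ hXY hXZ hlt
    obtain ⟨-, b, hb, hb'⟩ := O.mem_scope.mp hXY.1
    obtain ⟨⟨a, ha, ha'⟩, -⟩ := O.mem_scope.mp hXZ.1
    have nc := h.nonCrossing_of_lt hY hZ hlt
    rw [nonCrossing_iff] at nc
    have nc := nc b hb a ha
    rw [O.crosses_iff ((h.isStarOf hY).2 b hb) ((h.isStarOf hZ).2 a ha) (O.lt_side hlt)] at nc
    have hYZ : Y ≠ Z := by rintro rfl; exact O.lt_irrefl _ hlt
    have hne := h.leaf_ne_leaf hY hZ hYZ hb ha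
    refine nc (Or.inl ⟨hlt, ?_⟩)
    rcases ha' with rfl | ha'
    · rcases hb' with rfl | hb'
      · exact absurd rfl hne
      · exact hb'
    · exact lt_of_lt_of_le' ha' hb'
  by_contra hne
  have hs : Y.center ∈ O.U ↔ Z.center ∈ O.U := by
    obtain ⟨⟨y, hy, hy'⟩, -⟩ := O.mem_scope.mp hXY.1
    obtain ⟨⟨z, hz, hz'⟩, -⟩ := O.mem_scope.mp hXZ.1
    have h1 := O.adj_side ((h.isStarOf hY).2 y hy)
    have h2 := O.adj_side ((h.isStarOf hZ).2 z hz)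
    have h3 := le_side hy'
    have h4 := le_side hz'
    tauto
  rcases O.total hs with h1 | h1 | h1
  · exact aux hY hZ hXY hXZ h1
  · exact h.center_ne_center hY hZ hne h1
  · exact aux hZ hY hXZ hXY h1

end StrongOrdering

/-! ### Star partitions as sets of stars -/

section Partition

variable {V : Type*} [Fintype V] {G : SimpleGraph V} {s : ℕ}

omit [Fintype V] in
theorem CenteredStar.IsStarOf.card_verts {X : CenteredStar V} (hX : X.IsStarOf G s) :
    X.verts.card = s + 1 := by
  rw [CenteredStar.verts, Finset.card_insert_of_notMem, hX.1]
  exact fun h => (hX.2 _ h).ne rfl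

omit [Fintype V] in
/-- A star in an induced subgraph, as a center with a set of leaves. -/
theorem exists_star_of_isContained {S : Set V} (h : (starGraph s).IsContained (G.induce S)) :
    ∃ X : CenteredStar V, X.IsStarOf G s ∧ ∀ v ∈ X.verts, v ∈ S := by
  obtain ⟨f⟩ := h
  have hinj : Function.Injective fun x => (f x : V) := Subtype.val_injective.comp f.injective
  refine ⟨⟨f (Sum.inl 0), Finset.univ.image fun j : Fin s => (f (Sum.inr j) : V)⟩, ⟨?_, ?_⟩, ?_⟩
  · change (Finset.univ.image ((fun x => (f x : V)) ∘ Sum.inr)).card = s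
    rw [Finset.card_image_of_injective _ (hinj.comp Sum.inr_injective), Finset.card_univ,
      Fintype.card_fin]
  · intro v hv
    obtain ⟨j, -, rfl⟩ := Finset.mem_image.mp hv
    have : (starGraph s).Adj (Sum.inl 0) (Sum.inr j) := by simp
    exact f.toHom.map_rel this
  · intro v hv
    rcases CenteredStar.mem_verts.mp hv with rfl | hv
    · exact (f (Sum.inl 0)).2
    · obtain ⟨j, -, rfl⟩ := Finset.mem_image.mp hv
      exact (f (Sum.inr j)).2

omit [Fintype V] in
theorem CenteredStar.IsStarOf.isContained {X : CenteredStar V} (hX : X.IsStarOf G s) :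
    (starGraph s).IsContained (G.induce (X.verts : Set V)) := by
  obtain ⟨hc, ha⟩ := hX
  let e : Fin s ≃ X.leaves := (X.leaves.equivFinOfCardEq hc).symm
  have hcm : X.center ∈ (X.verts : Set V) := by simp [CenteredStar.verts]
  have hlm : ∀ j, (e j : V) ∈ (X.verts : Set V) := fun j => by simp [CenteredStar.verts]
  let f : Fin 1 ⊕ Fin s → (X.verts : Set V) := fun x => match x with
    | .inl _ => ⟨X.center, hcm⟩
    | .inr j => ⟨e j, hlm j⟩
  have hadj : ∀ j, G.Adj X.center (e j) := fun j => ha _ (e j).2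
  refine ⟨⟨⟨f, ?_⟩, ?_⟩⟩
  · rintro (a | a) (b | b) hab
    · simp at hab
    · exact hadj b
    · exact (hadj a).symm
    · simp at hab
  · rintro (a | a) (b | b) hab
    · rw [Subsingleton.elim a b]
    · exact absurd (congrArg Subtype.val hab) (hadj b).ne
    · exact absurd (congrArg Subtype.val hab) (hadj a).ne'
    · have h1 : (⟨e a, hlm a⟩ : (X.verts : Set V)) = ⟨e b, hlm b⟩ := hab
      rw [e.injective (Subtype.ext (Subtype.mk.inj h1))]

theorem hasStarPartition_iff :
    HasStarPartition G s ↔ ∃ P : Finset (CenteredStar V), IsStarPartition G s P := by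
  have hpos : (0 : ℚ) < (s : ℚ) + 1 := by positivity
  constructor
  · rintro ⟨X, hdis, -, hcon⟩
    choose S hS hSX using fun i => exists_star_of_isContained (hcon i)
    have hd : ∀ i j, i ≠ j → Disjoint (S i).verts (S j).verts := by
      intro i j hij
      rw [Finset.disjoint_left]
      exact fun v hv hv' => Set.disjoint_left.mp (hdis i j hij) (hSX i v hv) (hSX j v hv')
    have hcard : Fintype.card V ≤ (Finset.univ.biUnion fun i => (S i).verts).card := by
      rw [Finset.card_biUnion fun i _ j _ hij => hd i j hij,
        Finset.sum_congr rfl fun i _ => (hS i).card_verts]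
      simp only [Finset.sum_const, Finset.card_univ, Fintype.card_fin, smul_eq_mul]
      have h1 := Nat.le_ceil ((Fintype.card V : ℚ) / ((s : ℚ) + 1))
      rw [div_le_iff₀ hpos] at h1
      exact_mod_cast h1
    have huniv : (Finset.univ.biUnion fun i => (S i).verts) = Finset.univ :=
      Finset.eq_univ_of_card _ (le_antisymm (Finset.card_le_univ _) hcard)
    refine ⟨Finset.univ.image S, ?_, ?_, ?_⟩
    · intro Z hZ
      obtain ⟨i, -, rfl⟩ := Finset.mem_image.mp hZ
      exact hS i
    · intro Z hZ T hT hne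
      obtain ⟨i, -, rfl⟩ := Finset.mem_image.mp hZ
      obtain ⟨j, -, rfl⟩ := Finset.mem_image.mp hT
      exact hd i j fun e => hne (by rw [e])
    · intro v
      have hv : v ∈ Finset.univ.biUnion fun i => (S i).verts := by rw [huniv]; simp
      obtain ⟨i, -, hi⟩ := Finset.mem_biUnion.mp hv
      exact ⟨S i, Finset.mem_image_of_mem _ (Finset.mem_univ i), hi⟩
  · rintro ⟨P, hstar, hdis, hcov⟩
    have huniv : P.biUnion CenteredStar.verts = Finset.univ := by
      ext v
      simpa using hcov v
    have hcard : Fintype.card V = P.card * (s + 1) := by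
      rw [← Finset.card_univ, ← huniv, Finset.card_biUnion hdis,
        Finset.sum_congr rfl fun X hX => (hstar X hX).card_verts]
      simp
    have hk : ⌈(Fintype.card V : ℚ) / ((s : ℚ) + 1)⌉₊ = P.card := by
      rw [hcard]
      push_cast
      rw [mul_div_assoc, div_self hpos.ne', mul_one, Nat.ceil_natCast]
    let e : Fin ⌈(Fintype.card V : ℚ) / ((s : ℚ) + 1)⌉₊ ≃ P :=
      (P.equivFinOfCardEq hk.symm).symm
    refine ⟨fun i => ((e i : CenteredStar V).verts : Set V), ?_, ?_, ?_⟩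
    · intro i j hij
      have hne : (e i : CenteredStar V) ≠ e j := fun h => hij (e.injective (Subtype.ext h))
      exact Finset.disjoint_coe.mpr (hdis _ (e i).2 _ (e j).2 hne)
    · ext v
      simp only [Set.mem_iUnion, Set.mem_univ, iff_true]
      obtain ⟨X, hX, hv⟩ := hcov v
      exact ⟨e.symm ⟨X, hX⟩, by simpa using hv⟩
    · intro i
      exact (hstar _ (e i).2).isContained

end Partition

/-! ### Partitions into consecutive blocks -/

/-- The pairs `(i, j)` such that the first `i` vertices of one side and the first `j` vertices of the
other side of a bipartite graph can be divided into consecutive blocks: single stars with center on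
either side, and pairs of stars that cover `s + 1` vertices of each side. `E` is the adjacency
relation between the two sides. -/
inductive Reach (E : ℕ → ℕ → Prop) (s : ℕ) : ℕ → ℕ → Prop where
  | zero : Reach E s 0 0
  | left {i j : ℕ} : Reach E s i j → (∀ b < s, E i (j + b)) → Reach E s (i + 1) (j + s)
  | right {i j : ℕ} : Reach E s i j → (∀ a < s, E (i + a) j) → Reach E s (i + s) (j + 1)
  | pair {i j : ℕ} : Reach E s i j → (∃ a ≤ s, ∀ b ≤ s, E (i + a) (j + b)) →
      (∃ b ≤ s, ∀ a ≤ s, E (i + a) (j + b)) → Reach E s (i + s + 1) (j + s + 1)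

theorem finset_eq_Ico {N : Finset ℕ} {j : ℕ} (hj : ∀ x ∈ N, j ≤ x)
    (hN : ∀ x ∈ N, ∀ k, j ≤ k → k < x → k ∈ N) : N = Finset.Ico j (j + N.card) := by
  apply Finset.eq_of_subset_of_card_le
  · intro x hx
    have hsub : Finset.Ico j (x + 1) ⊆ N := by
      intro k hk
      rw [Finset.mem_Ico] at hk
      rcases Nat.lt_succ_iff_lt_or_eq.mp hk.2 with h | rfl
      · exact hN x hx k hk.1 h
      · exact hx
    have h1 := Finset.card_le_card hsub
    have h2 := hj x hx
    rw [Nat.card_Ico] at h1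
    rw [Finset.mem_Ico]
    omega
  · simp

namespace StrongOrdering

variable {V : Type*} [Fintype V] {G : SimpleGraph V} (O : StrongOrdering G) {s : ℕ}

/-- The number of vertices on the first side. -/
noncomputable def cardU : ℕ := (Finset.univ.filter fun v => v ∈ O.U).card

/-- `f` lists the vertices of the first side in their order. -/
def Lists (f : ℕ → V) : Prop := ∀ v ∈ O.U, f (O.pos v) = v

variable {O} {uo wo : ℕ → V}

theorem Lists.mem (hu : O.Lists uo) {i : ℕ} (hi : i < O.cardU) :
    uo i ∈ O.U ∧ O.pos (uo i) = i := by
  obtain ⟨x, hx, rfl⟩ := O.exists_pos_eq_U hi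
  rw [hu x hx]
  exact ⟨hx, rfl⟩

/-- The star with center at position `a` of the first side and leaves at the positions `J` of the
second side. -/
theorem star_of_positions (hu : O.Lists uo) (hw : O.flip.Lists wo) {a : ℕ} {J : Finset ℕ}
    (ha : a < O.cardU) (hJ : ∀ b ∈ J, b < O.flip.cardU) (hc : J.card = s)
    (hadj : ∀ b ∈ J, G.Adj (uo a) (wo b)) :
    (⟨uo a, J.image wo⟩ : CenteredStar V).IsStarOf G s ∧
    ∀ v, v ∈ (⟨uo a, J.image wo⟩ : CenteredStar V).verts ↔
      (v ∈ O.U ∧ O.pos v = a) ∨ (v ∈ O.W ∧ O.pos v ∈ J) := by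
  refine ⟨⟨?_, ?_⟩, ?_⟩
  · rw [Finset.card_image_of_injOn, hc]
    intro b hb b' hb' h
    have h1 := (hw.mem (hJ b hb)).2
    have h2 := (hw.mem (hJ b' hb')).2
    rw [← h1, ← h2]
    exact congrArg _ h
  · intro v hv
    obtain ⟨b, hb, rfl⟩ := Finset.mem_image.mp hv
    exact hadj b hb
  · intro v
    rw [CenteredStar.mem_verts]
    constructor
    · rintro (rfl | hv)
      · exact Or.inl (hu.mem ha)
      · obtain ⟨b, hb, rfl⟩ := Finset.mem_image.mp hv
        have h1 := hw.mem (hJ b hb)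
        have h2 : O.pos (wo b) = b := h1.2
        exact Or.inr ⟨h1.1, by rw [h2]; exact hb⟩
    · rintro (⟨hv, rfl⟩ | ⟨hv, hp⟩)
      · exact Or.inl (hu v hv).symm
      · exact Or.inr (Finset.mem_image.mpr ⟨_, hp, hw v hv⟩)

/-- `Q` is a set of disjoint stars that cover exactly the vertices with the property `C`. -/
def Covers (G : SimpleGraph V) (s : ℕ) (Q : Finset (CenteredStar V)) (C : V → Prop) : Prop :=
  (∀ X ∈ Q, X.IsStarOf G s) ∧ (∀ X ∈ Q, ∀ Y ∈ Q, X ≠ Y → Disjoint X.verts Y.verts) ∧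
  ∀ v, (∃ X ∈ Q, v ∈ X.verts) ↔ C v

omit [Fintype V] in
theorem Covers.insert {Q : Finset (CenteredStar V)} {C C' : V → Prop} (h : Covers G s Q C)
    {X : CenteredStar V} (hX : X.IsStarOf G s) (hdis : ∀ v ∈ X.verts, ¬ C v)
    (hC : ∀ v, C' v ↔ v ∈ X.verts ∨ C v) : Covers G s (insert X Q) C' := by
  obtain ⟨h1, h2, h3⟩ := h
  have hd : ∀ Y ∈ Q, Disjoint X.verts Y.verts := fun Y hY =>
    Finset.disjoint_left.mpr fun v hv hv' => hdis v hv ((h3 v).mp ⟨Y, hY, hv'⟩)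
  refine ⟨?_, ?_, ?_⟩
  · intro Y hY
    rcases Finset.mem_insert.mp hY with rfl | hY
    · exact hX
    · exact h1 Y hY
  · intro Y hY Z hZ hne
    rcases Finset.mem_insert.mp hY with rfl | hY' <;> rcases Finset.mem_insert.mp hZ with rfl | hZ'
    · exact absurd rfl hne
    · exact hd Z hZ'
    · exact (hd Y hY').symm
    · exact h2 Y hY' Z hZ' hne
  · intro v
    rw [hC, ← h3]
    simp

omit [Fintype V] in
theorem Covers.erase {Q : Finset (CenteredStar V)} {C C' : V → Prop} (h : Covers G s Q C)
    {X : CenteredStar V} (hX : X ∈ Q) (hC : ∀ v, C' v ↔ C v ∧ v ∉ X.verts) :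
    Covers G s (Q.erase X) C' := by
  obtain ⟨h1, h2, h3⟩ := h
  refine ⟨fun Y hY => h1 Y (Finset.mem_of_mem_erase hY), fun Y hY Z hZ =>
    h2 Y (Finset.mem_of_mem_erase hY) Z (Finset.mem_of_mem_erase hZ), fun v => ?_⟩
  rw [hC, ← h3]
  constructor
  · rintro ⟨Y, hY, hv⟩
    obtain ⟨hne, hY⟩ := Finset.mem_erase.mp hY
    exact ⟨⟨Y, hY, hv⟩, fun hv' => Finset.disjoint_left.mp (h2 Y hY X hX hne) hv hv'⟩
  · rintro ⟨⟨Y, hY, hv⟩, hv'⟩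
    exact ⟨Y, Finset.mem_erase.mpr ⟨fun e => hv' (e ▸ hv), hY⟩, hv⟩

theorem exists_covers_of_reach (hu : O.Lists uo) (hw : O.flip.Lists wo) {i j : ℕ}
    (h : Reach (fun a b => G.Adj (uo a) (wo b)) s i j) (hi : i ≤ O.cardU) (hj : j ≤ O.flip.cardU) :
    ∃ Q, Covers G s Q fun v => (v ∈ O.U ∧ O.pos v < i) ∨ (v ∈ O.W ∧ O.pos v < j) := by
  have hUW := O.mem_W_iff
  induction h with
  | zero => exact ⟨∅, by simp, by simp, by simp⟩
  | @left i j _ hE ih =>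
    obtain ⟨Q, hQ⟩ := ih (by omega) (by omega)
    obtain ⟨h1, h2⟩ := star_of_positions (s := s) (a := i) (J := Finset.Ico j (j + s)) hu hw
      (by omega) (fun b hb => by rw [Finset.mem_Ico] at hb; omega) (by simp) (fun b hb => by
        rw [Finset.mem_Ico] at hb
        have := hE (b - j) (by omega)
        rwa [Nat.add_sub_cancel' hb.1] at this)
    refine ⟨_, hQ.insert h1 (fun v => ?_) fun v => ?_⟩
    · rw [h2 v, Finset.mem_Ico]
      have := hUW v
      by_cases hv : v ∈ O.U <;> simp [hv, this] <;> omega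
    · rw [h2 v, Finset.mem_Ico]
      have := hUW v
      by_cases hv : v ∈ O.U <;> simp [hv, this] <;> omega
  | @right i j _ hE ih =>
    obtain ⟨Q, hQ⟩ := ih (by omega) (by omega)
    obtain ⟨h1, h2⟩ := star_of_positions (s := s) (O := O.flip) (a := j)
      (J := Finset.Ico i (i + s)) hw hu (by omega)
      (fun b hb => by rw [Finset.mem_Ico] at hb; exact lt_of_lt_of_le hb.2 hi) (by simp)
      (fun b hb => by
        rw [Finset.mem_Ico] at hb
        have := hE (b - i) (by omega)
        rw [Nat.add_sub_cancel' hb.1] at this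
        exact this.symm)
    refine ⟨_, hQ.insert h1 (fun v => ?_) fun v => ?_⟩
    · rw [h2 v, Finset.mem_Ico, pos_flip, flip_U, flip_W]
      have := hUW v
      by_cases hv : v ∈ O.U <;> simp [hv, this] <;> omega
    · rw [h2 v, Finset.mem_Ico, pos_flip, flip_U, flip_W]
      have := hUW v
      by_cases hv : v ∈ O.U <;> simp [hv, this] <;> omega
  | @pair i j _ hE hE' ih =>
    obtain ⟨Q, hQ⟩ := ih (by omega) (by omega)
    obtain ⟨a, ha, hE⟩ := hE
    obtain ⟨b, hb, hE'⟩ := hE'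
    obtain ⟨h1, h2⟩ := star_of_positions (s := s) (a := i + a)
      (J := (Finset.Ico j (j + s + 1)).erase (j + b)) hu hw
      (by omega) (fun b hb => by rw [Finset.mem_erase, Finset.mem_Ico] at hb; omega)
      (by rw [Finset.card_erase_of_mem (by simp; omega)]; simp; omega) (fun b hb => by
        rw [Finset.mem_erase, Finset.mem_Ico] at hb
        have := hE (b - j) (by omega)
        rwa [Nat.add_sub_cancel' hb.2.1] at this)
    obtain ⟨h3, h4⟩ := star_of_positions (s := s) (O := O.flip) (a := j + b)
      (J := (Finset.Ico i (i + s + 1)).erase (i + a)) hw hu (by omega)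
      (fun b hb => by rw [Finset.mem_erase, Finset.mem_Ico] at hb; exact lt_of_lt_of_le hb.2.2 hi)
      (by rw [Finset.card_erase_of_mem (by simp; omega)]; simp; omega) (fun b hb => by
        rw [Finset.mem_erase, Finset.mem_Ico] at hb
        have := hE' (b - i) (by omega)
        rw [Nat.add_sub_cancel' hb.2.1] at this
        exact this.symm)
    have hQ' := hQ.insert h1 (C' := fun v => (v ∈ O.U ∧ (O.pos v < i ∨ O.pos v = i + a)) ∨
      (v ∈ O.W ∧ (O.pos v < j ∨ O.pos v ∈ (Finset.Ico j (j + s + 1)).erase (j + b))))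
      (fun v => by
        rw [h2 v, Finset.mem_erase, Finset.mem_Ico]
        have := hUW v
        by_cases hv : v ∈ O.U <;> simp [hv, this] <;> omega)
      (fun v => by rw [h2 v]; tauto)
    refine ⟨_, hQ'.insert h3 (fun v => ?_) fun v => ?_⟩
    · rw [h4 v, Finset.mem_erase, Finset.mem_erase, Finset.mem_Ico, Finset.mem_Ico, pos_flip,
        flip_U, flip_W]
      have := hUW v
      by_cases hv : v ∈ O.U <;> simp [hv, this] <;> omega
    · rw [h4 v, Finset.mem_erase, Finset.mem_erase, Finset.mem_Ico, Finset.mem_Ico, pos_flip,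
        flip_U, flip_W]
      have := hUW v
      by_cases hv : v ∈ O.U <;> simp [hv, this] <;> omega

/-! ### Taking blocks off a partition of minimum score -/

variable {P Q : Finset (CenteredStar V)}

/-- If the first uncovered vertex of the first side is a center, then its leaves are the first `s`
uncovered vertices of the other side. -/
theorem IsMinScore.leaves_of_first_center (h : O.IsMinScore s P) (hQP : Q ⊆ P) {i j : ℕ}
    (hQ : Covers G s Q fun v => (v ∈ O.U ∧ i ≤ O.pos v) ∨ (v ∈ O.W ∧ j ≤ O.pos v))
    {X : CenteredStar V} (hX : X ∈ Q) (hc : X.center ∈ O.U) (hi : O.pos X.center = i) :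
    X.leaves.image O.pos = Finset.Ico j (j + s) := by
  have hUW := O.mem_W_iff
  have sX := h.isStarOf (hQP hX)
  have hlU : ∀ x ∈ X.leaves, x ∉ O.U := fun x hx => (O.adj_side (sX.2 x hx)).mp hc
  have hcard : (X.leaves.image O.pos).card = s := by
    rw [Finset.card_image_of_injOn, sX.1]
    intro x hx y hy hxy
    exact O.pos_inj (iff_of_false (hlU x hx) (hlU y hy)) hxy
  rw [finset_eq_Ico (N := X.leaves.image O.pos) (j := j), hcard]
  · intro k hk
    obtain ⟨x, hx, rfl⟩ := Finset.mem_image.mp hk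
    rcases (hQ.2.2 x).mp ⟨X, hX, CenteredStar.mem_verts.mpr (Or.inr hx)⟩ with h1 | h1
    · exact absurd h1.1 (hlU x hx)
    · exact h1.2
  · intro k hk l hjl hlk
    obtain ⟨x, hx, rfl⟩ := Finset.mem_image.mp hk
    have hxW : x ∈ O.flip.U := (hUW x).mpr (hlU x hx)
    obtain ⟨v, hvW, hvp⟩ := O.flip.exists_pos_eq_U (hlk.trans (O.flip.pos_lt_card_U hxW))
    rw [pos_flip] at hvp
    rw [flip_U] at hvW
    by_contra hl
    have hvX : v ∉ X.leaves := fun hh => hl (Finset.mem_image.mpr ⟨v, hh, hvp⟩)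
    have hvU := (hUW v).mp hvW
    have hvx : O.lt v x := by rw [O.lt_iff_pos (iff_of_false hvU (hlU x hx)), hvp]; exact hlk
    obtain ⟨Z, hZ, hvZ⟩ := (hQ.2.2 v).mpr (Or.inr ⟨hvW, hvp ▸ hjl⟩)
    have hZX : X ≠ Z := by
      rintro rfl
      rcases CenteredStar.mem_verts.mp hvZ with rfl | hh
      · exact hvU hc
      · exact hvX hh
    have first : ∀ u ∈ Z.verts, u ∈ O.U → O.lt X.center u := by
      intro u hu huU
      rw [O.lt_iff_pos (iff_of_true hc huU)]
      rcases (hQ.2.2 u).mp ⟨Z, hZ, hu⟩ with h1 | h1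
      · have h2 : O.pos X.center ≠ O.pos u := fun e => Finset.disjoint_left.mp
          (h.disjoint (hQP hX) (hQP hZ) hZX) (CenteredStar.mem_verts.mpr (Or.inl rfl))
          (O.pos_inj (iff_of_true hc huU) e ▸ hu)
        omega
      · exact absurd huU ((hUW u).mp h1.1)
    have sZ := h.isStarOf (hQP hZ)
    rcases CenteredStar.mem_verts.mp hvZ with rfl | hvl
    · -- `v` is a center: its star would interleave with `X`, but has no leaf before the center of `X`.
      obtain ⟨z, hz⟩ : Z.leaves.Nonempty := by
        rw [← Finset.card_pos, sZ.1, ← sX.1]; exact Finset.card_pos.mpr ⟨x, hx⟩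
      have zU : ∀ z ∈ Z.leaves, z ∈ O.U := fun z hz => by
        have := O.adj_side (sZ.2 z hz); tauto
      rcases h.isGood X (hQP hX) Z (hQP hZ) hZX with nc | il
      · rw [nonCrossing_iff] at nc
        refine nc x hx z hz ?_
        rw [Sym2.eq_swap (a := Z.center), O.crosses_iff (sX.2 x hx) (sZ.2 z hz).symm
          (iff_of_true hc (zU z hz))]
        exact Or.inl ⟨first z (CenteredStar.mem_verts.mpr (Or.inr hz)) (zU z hz), hvx⟩
      · obtain ⟨⟨a, ha, hac⟩, -⟩ := O.mem_scope.mp il.1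
        have := first a (CenteredStar.mem_verts.mpr (Or.inr ha)) (zU a ha)
        exact O.lt_irrefl _ (lt_of_le_of_lt' hac this)
    · have hZU : Z.center ∈ O.U := by have := O.adj_side (sZ.2 v hvl); tauto
      have nc := h.nonCrossing_of_same_side (hQP hX) (hQP hZ) hZX (iff_of_true hc hZU)
      rw [nonCrossing_iff] at nc
      refine nc x hx v hvl ?_
      rw [O.crosses_iff (sX.2 x hx) (sZ.2 v hvl) (iff_of_true hc hZU)]
      exact Or.inl ⟨first Z.center (CenteredStar.mem_verts.mpr (Or.inl rfl)) hZU, hvx⟩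

/-- If the first uncovered vertices of both sides are leaves, of `Y` and of `X`, then the leaves of `Y`
and the center of `X` are the first `s + 1` uncovered vertices of their side. -/
theorem IsMinScore.leaves_of_first_leaf (h : O.IsMinScore s P) (hQP : Q ⊆ P) {i j : ℕ}
    (hQ : Covers G s Q fun v => (v ∈ O.U ∧ i ≤ O.pos v) ∨ (v ∈ O.W ∧ j ≤ O.pos v))
    {X Y : CenteredStar V} (hX : X ∈ Q) (hY : Y ∈ Q) (hc : X.center ∈ O.U) {u : V}
    (hu : u ∈ Y.leaves) (huU : u ∈ O.U) (hup : O.pos u = i) (hil : O.Interleaving X Y) :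
    (insert X.center Y.leaves).image O.pos = Finset.Ico i (i + (s + 1)) := by
  have hUW := O.mem_W_iff
  have sX := h.isStarOf (hQP hX)
  have sY := h.isStarOf (hQP hY)
  have hYc : Y.center ∉ O.U := by have := O.adj_side (sY.2 u hu); tauto
  have hXY : X ≠ Y := by rintro rfl; exact hYc hc
  have hlU : ∀ x ∈ insert X.center Y.leaves, x ∈ O.U := by
    intro x hx
    rcases Finset.mem_insert.mp hx with rfl | hx
    · exact hc
    · have := O.adj_side (sY.2 x hx); tauto
  have hcY : X.center ∉ Y.leaves := fun hh => h.center_ne_leaf (hQP hX) (hQP hY) hXY hh rfl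
  have hcard : ((insert X.center Y.leaves).image O.pos).card = s + 1 := by
    rw [Finset.card_image_of_injOn, Finset.card_insert_of_notMem hcY, sY.1]
    intro x hx y hy hxy
    exact O.pos_inj (iff_of_true (hlU x hx) (hlU y hy)) hxy
  rw [finset_eq_Ico (N := (insert X.center Y.leaves).image O.pos) (j := i), hcard]
  · intro k hk
    obtain ⟨x, hx, rfl⟩ := Finset.mem_image.mp hk
    have hcov : ∃ Z ∈ Q, x ∈ Z.verts := by
      rcases Finset.mem_insert.mp hx with rfl | hx
      · exact ⟨X, hX, CenteredStar.mem_verts.mpr (Or.inl rfl)⟩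
      · exact ⟨Y, hY, CenteredStar.mem_verts.mpr (Or.inr hx)⟩
    rcases (hQ.2.2 x).mp hcov with h1 | h1
    · exact h1.2
    · exact absurd (hlU x hx) ((hUW x).mp h1.1)
  · intro k hk l hil' hlk
    obtain ⟨x, hx, rfl⟩ := Finset.mem_image.mp hk
    obtain ⟨v, hvU, hvp⟩ := O.exists_pos_eq_U (hlk.trans (O.pos_lt_card_U (hlU x hx)))
    by_contra hl
    have hv : v ∉ insert X.center Y.leaves := fun hh => hl (Finset.mem_image.mpr ⟨v, hh, hvp⟩)
    rw [Finset.mem_insert, not_or] at hv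
    -- There is a leaf `y` of `Y` beyond `v`, while the leaf `u` lies before `v`.
    obtain ⟨y, hy, hvy⟩ : ∃ y ∈ Y.leaves, O.lt v y := by
      have hvx : O.lt v x := by rw [O.lt_iff_pos (iff_of_true hvU (hlU x hx)), hvp]; exact hlk
      rcases Finset.mem_insert.mp hx with rfl | hx
      · obtain ⟨-, b, hb, hb'⟩ := O.mem_scope.mp hil.1
        exact ⟨b, hb, lt_of_lt_of_le' hvx hb'⟩
      · exact ⟨x, hx, hvx⟩
    have huv : O.lt u v := by
      rw [O.lt_iff_pos (iff_of_true huU hvU)]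
      have : O.pos u ≠ O.pos v := fun e => hv.2 (O.pos_inj (iff_of_true huU hvU) e ▸ hu)
      omega
    obtain ⟨Z, hZ, hvZ⟩ := (hQ.2.2 v).mpr (Or.inl ⟨hvU, hvp ▸ hil'⟩)
    have sZ := h.isStarOf (hQP hZ)
    have hZY : Y ≠ Z := by
      rintro rfl
      rcases CenteredStar.mem_verts.mp hvZ with rfl | hh
      · exact hYc hvU
      · exact hv.2 hh
    rcases CenteredStar.mem_verts.mp hvZ with rfl | hvl
    · have zW : ∀ z ∈ Z.leaves, z ∉ O.U := fun z hz => (O.adj_side (sZ.2 z hz)).mp hvU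
      obtain ⟨z, hz⟩ : Z.leaves.Nonempty := by
        rw [← Finset.card_pos, sZ.1, ← sY.1]; exact Finset.card_pos.mpr ⟨u, hu⟩
      rcases h.isGood Y (hQP hY) Z (hQP hZ) hZY with nc | il
      · rw [nonCrossing_iff] at nc
        rcases O.total (iff_of_false hYc (zW z hz)) with h1 | h1 | h1
        · refine nc y hy z hz ?_
          rw [Sym2.eq_swap (b := z), O.crosses_iff (sY.2 y hy) (sZ.2 z hz).symm
            (iff_of_false hYc (zW z hz))]
          exact Or.inl ⟨h1, hvy⟩
        · exact h.center_ne_leaf (hQP hY) (hQP hZ) hZY hz h1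
        · refine nc u hu z hz ?_
          rw [Sym2.eq_swap (b := z), O.crosses_iff (sY.2 u hu) (sZ.2 z hz).symm
            (iff_of_false hYc (zW z hz))]
          exact Or.inr ⟨h1, huv⟩
      · exact hv.1 (by rw [h.interleaving_unique (hQP hX) (hQP hZ) hil.symm il])
    · have hZU : Z.center ∉ O.U := by have := O.adj_side (sZ.2 v hvl); tauto
      have hs := iff_of_false hYc hZU
      have nc := h.nonCrossing_of_same_side (hQP hY) (hQP hZ) hZY hs
      rw [nonCrossing_iff] at nc
      rcases O.total hs with h1 | h1 | h1
      · refine nc y hy v hvl ?_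
        rw [O.crosses_iff (sY.2 y hy) (sZ.2 v hvl) hs]
        exact Or.inl ⟨h1, hvy⟩
      · exact h.center_ne_center (hQP hY) (hQP hZ) hZY h1
      · refine nc u hu v hvl ?_
        rw [O.crosses_iff (sY.2 u hu) (sZ.2 v hvl) hs]
        exact Or.inr ⟨h1, huv⟩

theorem verts_of_image_pos {X : CenteredStar V} {i j s : ℕ} (hX : X.IsStarOf G s)
    (hc : X.center ∈ O.U) (hi : O.pos X.center = i)
    (hl : X.leaves.image O.pos = Finset.Ico j (j + s)) (v : V) :
    v ∈ X.verts ↔ (v ∈ O.U ∧ O.pos v = i) ∨ (v ∉ O.U ∧ j ≤ O.pos v ∧ O.pos v < j + s) := by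
  have hlU : ∀ x ∈ X.leaves, x ∉ O.U := fun x hx => (O.adj_side (hX.2 x hx)).mp hc
  rw [CenteredStar.mem_verts, ← Finset.mem_Ico, ← hl]
  constructor
  · rintro (rfl | hv)
    · exact Or.inl ⟨hc, hi⟩
    · exact Or.inr ⟨hlU v hv, Finset.mem_image_of_mem _ hv⟩
  · rintro (⟨hv, hp⟩ | ⟨hv, hp⟩)
    · exact Or.inl (O.pos_inj (iff_of_true hv hc) (hp.trans hi.symm))
    · obtain ⟨x, hx, hxp⟩ := Finset.mem_image.mp hp
      rw [← O.pos_inj (iff_of_false (hlU x hx) hv) hxp]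
      exact Or.inr hx

theorem IsMinScore.reach_of_covers (h : O.IsMinScore s P) (hs : 1 ≤ s) (hu : O.Lists uo)
    (hw : O.flip.Lists wo) : ∀ (m : ℕ) {Q : Finset (CenteredStar V)} {i j : ℕ}, Q.card ≤ m → Q ⊆ P →
    Covers G s Q (fun v => (v ∈ O.U ∧ i ≤ O.pos v) ∨ (v ∈ O.W ∧ j ≤ O.pos v)) →
    i ≤ O.cardU → j ≤ O.flip.cardU → Reach (fun a b => G.Adj (uo a) (wo b)) s i j →
    Reach (fun a b => G.Adj (uo a) (wo b)) s O.cardU O.flip.cardU := by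
  have hUW := O.mem_W_iff
  intro m
  induction m with
  | zero =>
    intro Q i j hm hQP hQ hi hj hR
    have hQ0 : Q = ∅ := Finset.card_eq_zero.mp (by omega)
    subst hQ0
    have e1 : i = O.cardU := by
      by_contra hne
      obtain ⟨v, hv, hvp⟩ := O.exists_pos_eq_U (lt_of_le_of_ne hi hne)
      obtain ⟨X, hX, -⟩ := (hQ.2.2 v).mpr (Or.inl ⟨hv, hvp.ge⟩)
      simp at hX
    have e2 : j = O.flip.cardU := by
      by_contra hne
      obtain ⟨v, hv, hvp⟩ := O.flip.exists_pos_eq_U (lt_of_le_of_ne hj hne)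
      obtain ⟨X, hX, -⟩ := (hQ.2.2 v).mpr (Or.inr ⟨hv, hvp.ge⟩)
      simp at hX
    rwa [← e1, ← e2]
  | succ m ih =>
    intro Q i j hm hQP hQ hi hj hR
    rcases Q.eq_empty_or_nonempty with rfl | ⟨X₀, hX₀⟩
    · exact ih (by simp) hQP hQ hi hj hR
    have hposU : ∀ {k l : ℕ} {S : Finset V}, S.image O.pos = Finset.Ico k l → k < l →
        (∀ x ∈ S, x ∈ O.U) → l ≤ O.cardU := by
      intro k l S hS hkl hSU
      have : l - 1 ∈ S.image O.pos := by rw [hS, Finset.mem_Ico]; omega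
      obtain ⟨x, hx, hxp⟩ := Finset.mem_image.mp this
      have : O.pos x < O.cardU := O.pos_lt_card_U (hSU x hx)
      omega
    have hposW : ∀ {k l : ℕ} {S : Finset V}, S.image O.pos = Finset.Ico k l → k < l →
        (∀ x ∈ S, x ∈ O.W) → l ≤ O.flip.cardU := by
      intro k l S hS hkl hSU
      have : l - 1 ∈ S.image O.pos := by rw [hS, Finset.mem_Ico]; omega
      obtain ⟨x, hx, hxp⟩ := Finset.mem_image.mp this
      have : O.pos x < O.flip.cardU := O.flip.pos_lt_card_U (hSU x hx)
      omega
    have hij : i < O.cardU ∧ j < O.flip.cardU := by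
      have sX := h.isStarOf (hQP hX₀)
      obtain ⟨x, hx⟩ : X₀.leaves.Nonempty := by rw [← Finset.card_pos, sX.1]; omega
      have hss := O.adj_side (sX.2 x hx)
      have h1 := (hQ.2.2 _).mp ⟨X₀, hX₀, CenteredStar.mem_verts.mpr (Or.inl rfl)⟩
      have h2 := (hQ.2.2 _).mp ⟨X₀, hX₀, CenteredStar.mem_verts.mpr (Or.inr hx)⟩
      have aux : ∀ {a b : V}, a ∈ O.U → b ∈ O.W → i ≤ O.pos a → j ≤ O.pos b →
          i < O.cardU ∧ j < O.flip.cardU := fun ha hb h3 h4 =>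
        ⟨lt_of_le_of_lt h3 (O.pos_lt_card_U ha), lt_of_le_of_lt h4 (O.flip.pos_lt_card_U hb)⟩
      rcases h1 with ⟨h1, h1'⟩ | ⟨h1, h1'⟩ <;> rcases h2 with ⟨h2, h2'⟩ | ⟨h2, h2'⟩
      · exact absurd h2 (hss.mp h1)
      · exact aux h1 h2 h1' h2'
      · exact aux h2 h1 h2' h1'
      · exact absurd (hss.mpr ((hUW x).mp h2)) ((hUW _).mp h1)
    have hcardlt : ∀ {Z}, Z ∈ Q → (Q.erase Z).card ≤ m := fun hZ => by
      rw [Finset.card_erase_of_mem hZ]; omega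
    have hQflip : Covers G s Q fun v =>
        (v ∈ O.flip.U ∧ j ≤ O.flip.pos v) ∨ (v ∈ O.flip.W ∧ i ≤ O.flip.pos v) :=
      ⟨hQ.1, hQ.2.1, fun v => (hQ.2.2 v).trans or_comm⟩
    obtain ⟨u, huU, hup⟩ := O.exists_pos_eq_U hij.1
    obtain ⟨w, hwW, hwp⟩ := O.flip.exists_pos_eq_U hij.2
    rw [pos_flip] at hwp
    rw [flip_U] at hwW
    have hwU := (hUW w).mp hwW
    obtain ⟨Y, hY, huY⟩ := (hQ.2.2 u).mpr (Or.inl ⟨huU, hup.ge⟩)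
    obtain ⟨X, hX, hwX⟩ := (hQ.2.2 w).mpr (Or.inr ⟨hwW, hwp.ge⟩)
    have sX := h.isStarOf (hQP hX)
    have sY := h.isStarOf (hQP hY)
    rcases CenteredStar.mem_verts.mp huY with rfl | hul
    · have hl := h.leaves_of_first_center hQP hQ hY huU hup
      have hv := verts_of_image_pos sY huU hup hl
      have hleafW : ∀ x ∈ Y.leaves, x ∈ O.W := fun x hx =>
        (hUW x).mpr ((O.adj_side (sY.2 x hx)).mp huU)
      refine ih (hcardlt hY) ((Finset.erase_subset _ _).trans hQP)
        (hQ.erase (C' := fun v => (v ∈ O.U ∧ i + 1 ≤ O.pos v) ∨ (v ∈ O.W ∧ j + s ≤ O.pos v)) hY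
          fun v => ?_) (by omega) (hposW hl (by omega) hleafW) (hR.left fun b hb => ?_)
      · rw [hv v]
        have := hUW v
        by_cases hvU : v ∈ O.U <;> simp [hvU, this] <;> omega
      · have hb' : j + b ∈ Y.leaves.image O.pos := by rw [hl, Finset.mem_Ico]; omega
        obtain ⟨x, hx, hxp⟩ := Finset.mem_image.mp hb'
        have h1 := hw x (hleafW x hx)
        have h2 := hu _ huU
        rw [pos_flip, hxp] at h1
        rw [hup] at h2
        rw [h1, h2]
        exact sY.2 x hx
    rcases CenteredStar.mem_verts.mp hwX with rfl | hwl
    · have hl := h.flip.leaves_of_first_center hQP hQflip hX hwW hwp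
      have hv := verts_of_image_pos (O := O.flip) sX hwW hwp hl
      have hleafU : ∀ x ∈ X.leaves, x ∈ O.U := fun x hx => by
        have := O.adj_side (sX.2 x hx); tauto
      refine ih (hcardlt hX) ((Finset.erase_subset _ _).trans hQP)
        (hQ.erase (C' := fun v => (v ∈ O.U ∧ i + s ≤ O.pos v) ∨ (v ∈ O.W ∧ j + 1 ≤ O.pos v)) hX
          fun v => ?_) (hposU hl (by omega) hleafU) (by omega) (hR.right fun b hb => ?_)
      · rw [hv v, pos_flip, flip_U]
        have := hUW v
        by_cases hvU : v ∈ O.U <;> simp [hvU, this] <;> omega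
      · have hb' : i + b ∈ X.leaves.image O.flip.pos := by rw [hl, Finset.mem_Ico]; omega
        obtain ⟨x, hx, hxp⟩ := Finset.mem_image.mp hb'
        have h1 := hu x (hleafU x hx)
        have h2 := hw _ hwW
        rw [pos_flip] at hxp
        rw [hxp] at h1
        rw [pos_flip, hwp] at h2
        rw [h1, h2]
        exact (sX.2 x hx).symm
    -- Both first vertices are leaves.
    have hXc : X.center ∈ O.U := by have := O.adj_side (sX.2 w hwl); tauto
    have hYc : Y.center ∉ O.U := by have := O.adj_side (sY.2 u hul); tauto
    have hXY : X ≠ Y := by rintro rfl; exact hYc hXc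
    have hucX : O.lt u X.center := by
      rw [O.lt_iff_pos (iff_of_true huU hXc)]
      rcases (hQ.2.2 _).mp ⟨X, hX, CenteredStar.mem_verts.mpr (Or.inl rfl)⟩ with h1 | h1
      · have : O.pos u ≠ O.pos X.center := fun e => h.center_ne_leaf (hQP hX) (hQP hY) hXY hul
          (O.pos_inj (iff_of_true huU hXc) e).symm
        omega
      · exact absurd hXc ((hUW _).mp h1.1)
    have hwcY : O.lt w Y.center := by
      rw [O.lt_iff_pos (iff_of_false hwU hYc)]
      rcases (hQ.2.2 _).mp ⟨Y, hY, CenteredStar.mem_verts.mpr (Or.inl rfl)⟩ with h1 | h1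
      · exact absurd h1.1 hYc
      · have : O.pos w ≠ O.pos Y.center := fun e => h.center_ne_leaf (hQP hY) (hQP hX) hXY.symm hwl
          (O.pos_inj (iff_of_false hwU hYc) e).symm
        omega
    have hil : O.Interleaving X Y := by
      rcases h.isGood X (hQP hX) Y (hQP hY) hXY with nc | il
      · rw [nonCrossing_iff] at nc
        refine absurd ?_ (nc w hwl u hul)
        rw [Sym2.eq_swap (b := u), O.crosses_iff (sX.2 w hwl) (sY.2 u hul).symm
          (iff_of_true hXc huU)]
        exact Or.inr ⟨hucX, hwcY⟩
      · exact il
    have hadj : G.Adj X.center Y.center :=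
      (O.cross_adj (sX.2 w hwl).symm (sY.2 u hul) hwcY hucX).2.symm
    have hlU := h.leaves_of_first_leaf hQP hQ hX hY hXc hul huU hup hil
    have hlW := h.flip.leaves_of_first_leaf hQP hQflip hY hX ((hUW _).mpr hYc) hwl hwW hwp
      (show O.flip.Interleaving Y X from hil.symm)
    have hSU : ∀ x ∈ insert X.center Y.leaves, x ∈ O.U := by
      intro x hx
      rcases Finset.mem_insert.mp hx with rfl | hx
      · exact hXc
      · have := O.adj_side (sY.2 x hx); tauto
    have hSW : ∀ x ∈ insert Y.center X.leaves, x ∈ O.W := by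
      intro x hx
      rw [hUW]
      rcases Finset.mem_insert.mp hx with rfl | hx
      · exact hYc
      · exact (O.adj_side (sX.2 x hx)).mp hXc
    have memU : ∀ v ∈ O.U, (v ∈ insert X.center Y.leaves ↔ i ≤ O.pos v ∧ O.pos v < i + (s + 1)) := by
      intro v hv
      rw [← Finset.mem_Ico, ← hlU]
      refine ⟨fun hh => Finset.mem_image_of_mem _ hh, fun hh => ?_⟩
      obtain ⟨x, hx, hxp⟩ := Finset.mem_image.mp hh
      rwa [← O.pos_inj (iff_of_true (hSU x hx) hv) hxp]
    have memW : ∀ v ∈ O.W, (v ∈ insert Y.center X.leaves ↔ j ≤ O.pos v ∧ O.pos v < j + (s + 1)) := by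
      intro v hv
      rw [← Finset.mem_Ico, ← hlW]
      refine ⟨fun hh => Finset.mem_image_of_mem _ hh, fun hh => ?_⟩
      obtain ⟨x, hx, hxp⟩ := Finset.mem_image.mp hh
      rwa [← O.pos_inj (iff_of_false ((hUW x).mp (hSW x hx)) ((hUW v).mp hv)) hxp]
    have hQ2 := (hQ.erase (C' := fun v => ((v ∈ O.U ∧ i ≤ O.pos v) ∨ (v ∈ O.W ∧ j ≤ O.pos v)) ∧
      v ∉ X.verts) hX fun v => Iff.rfl).erase
      (C' := fun v => (v ∈ O.U ∧ i + s + 1 ≤ O.pos v) ∨ (v ∈ O.W ∧ j + s + 1 ≤ O.pos v))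
      (Finset.mem_erase.mpr ⟨hXY.symm, hY⟩) fun v => by
        rw [CenteredStar.mem_verts, CenteredStar.mem_verts]
        by_cases hvU : v ∈ O.U
        · have h1 := memU v hvU
          have h2 : v ∉ X.leaves := fun hh => (O.adj_side (sX.2 v hh)).mp hXc hvU
          have h3 : v ≠ Y.center := fun e => hYc (e ▸ hvU)
          have h4 := hUW v
          rw [Finset.mem_insert] at h1
          simp only [hvU, h2, h3, h4, not_true_eq_false, false_and, or_false, false_or, true_and]
          rw [and_assoc, ← not_or, h1]
          omega
        · have hvW := (hUW v).mpr hvU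
          have h1 := memW v hvW
          have h2 : v ∉ Y.leaves := fun hh => by have := O.adj_side (sY.2 v hh); tauto
          have h3 : v ≠ X.center := fun e => hvU (e ▸ hXc)
          rw [Finset.mem_insert] at h1
          simp only [hvU, hvW, h2, h3, false_and, or_false, false_or, true_and]
          rw [and_assoc, ← not_or, or_comm, h1]
          omega
    have getU : ∀ a ≤ s, uo (i + a) ∈ insert X.center Y.leaves := by
      intro a ha
      have : i + a ∈ (insert X.center Y.leaves).image O.pos := by rw [hlU, Finset.mem_Ico]; omega
      obtain ⟨x, hx, hxp⟩ := Finset.mem_image.mp this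
      rw [← hxp, hu x (hSU x hx)]; exact hx
    have getW : ∀ b ≤ s, wo (j + b) ∈ insert Y.center X.leaves := by
      intro b hb
      have : j + b ∈ (insert Y.center X.leaves).image O.pos := by
        have e : (insert Y.center X.leaves).image O.pos = Finset.Ico j (j + (s + 1)) := hlW
        rw [e, Finset.mem_Ico]; omega
      obtain ⟨x, hx, hxp⟩ := Finset.mem_image.mp this
      have := hw x (hSW x hx)
      rw [pos_flip, hxp] at this
      rw [this]; exact hx
    refine ih ?_ (((Finset.erase_subset _ _).trans (Finset.erase_subset _ _)).trans hQP) hQ2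
      (hposU hlU (by omega) hSU) (hposW hlW (by omega) hSW) (hR.pair ?_ ?_)
    · rw [Finset.card_erase_of_mem (Finset.mem_erase.mpr ⟨hXY.symm, hY⟩)]
      have := hcardlt hX
      omega
    · have h1 := (memU _ hXc).mp (Finset.mem_insert_self _ _)
      refine ⟨O.pos X.center - i, by omega, fun b hb => ?_⟩
      rw [Nat.add_sub_cancel' h1.1, hu _ hXc]
      rcases Finset.mem_insert.mp (getW b hb) with h2 | h2
      · rw [h2]; exact hadj
      · exact sX.2 _ h2
    · have h1 := (memW _ ((hUW _).mpr hYc)).mp (Finset.mem_insert_self _ _)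
      refine ⟨O.pos Y.center - j, by omega, fun a ha => ?_⟩
      have h3 := hw _ ((hUW _).mpr hYc)
      rw [pos_flip] at h3
      rw [Nat.add_sub_cancel' h1.1, h3]
      rcases Finset.mem_insert.mp (getU a ha) with h2 | h2
      · rw [h2]; exact hadj
      · exact (sY.2 _ h2).symm

omit [Fintype V] in
theorem reach_of_s_eq_zero {E : ℕ → ℕ → Prop} (i j : ℕ) : Reach E 0 i j := by
  induction i with
  | zero =>
    induction j with
    | zero => exact .zero
    | succ j ih => exact ih.right (by simp)
  | succ i ih => exact ih.left (by simp)

/-- A graph with a strong ordering has a star partition if and only if it has one that consists of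
consecutive blocks. -/
theorem reach_iff_hasStarPartition (hu : O.Lists uo) (hw : O.flip.Lists wo) :
    Reach (fun a b => G.Adj (uo a) (wo b)) s O.cardU O.flip.cardU ↔ HasStarPartition G s := by
  rw [hasStarPartition_iff]
  constructor
  · intro h
    obtain ⟨Q, h1, h2, h3⟩ := exists_covers_of_reach hu hw h le_rfl le_rfl
    refine ⟨Q, h1, h2, fun v => (h3 v).mpr ?_⟩
    by_cases hv : v ∈ O.U
    · exact Or.inl ⟨hv, O.pos_lt_card_U hv⟩
    · have hv' := (O.mem_W_iff v).mpr hv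
      exact Or.inr ⟨hv', O.flip.pos_lt_card_U hv'⟩
  · rintro ⟨P₀, hP₀⟩
    rcases Nat.eq_zero_or_pos s with rfl | hs
    · exact reach_of_s_eq_zero _ _
    · obtain ⟨P, hP, hmin⟩ := (InvImage.wf O.score wellFounded_lt).has_min
        {P | IsStarPartition G s P} ⟨P₀, hP₀⟩
      have hm : O.IsMinScore s P := ⟨hP, fun Q hQ => not_lt.mp (hmin Q hQ)⟩
      refine hm.reach_of_covers hs hu hw P.card (i := 0) (j := 0) le_rfl (Finset.Subset.refl P)
        ⟨hP.1, hP.2.1, fun v => ⟨fun _ => ?_, fun _ => hP.2.2 v⟩⟩ (Nat.zero_le _) (Nat.zero_le _)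
        .zero
      by_cases hv : v ∈ O.U
      · exact Or.inl ⟨hv, Nat.zero_le _⟩
      · exact Or.inr ⟨(O.mem_W_iff v).mpr hv, Nat.zero_le _⟩

end StrongOrdering

/-! ### Layerings and their roots -/

/-- The outcome of breadth-first searches that start a new component, in a layer far from all previous
ones, at a vertex of maximum priority: `lam v` is the layer of `v`. Every vertex has a neighbor in the
previous layer or is such a root. -/
structure Layering {V : Type*} (G : SimpleGraph V) (prio lam : V → ℕ) : Prop where
  near : ∀ {u v}, G.Adj u v → lam v ≤ lam u + 1
  parent : ∀ v, (∃ u, G.Adj u v ∧ lam u + 1 = lam v) ∨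
    ((∀ w, lam w = lam v → w = v) ∧ (∀ w, lam w + 1 ≠ lam v) ∧
      ∀ w, lam v ≤ lam w → prio w ≤ prio v)

/-- The roots of a layering. -/
def IsRoot {V : Type*} (prio lam : V → ℕ) (v : V) : Prop :=
  (∀ w, lam w = lam v → w = v) ∧ (∀ w, lam w + 1 ≠ lam v) ∧ ∀ w, lam v ≤ lam w → prio w ≤ prio v

namespace Layering

variable {V : Type*} {G : SimpleGraph V} {prio lam : V → ℕ} (L : Layering G prio lam)

include L

theorem same_side (O : StrongOrdering G) {u v : V} (h : lam u = lam v) : u ∈ O.U ↔ v ∈ O.U := by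
  induction hd : lam u generalizing u v with
  | zero =>
    rcases L.parent u with ⟨p, -, hp⟩ | hr
    · omega
    · rw [hr.1 v h.symm]
  | succ d ih =>
    rcases L.parent u with ⟨p, hpu, hp⟩ | hr
    · rcases L.parent v with ⟨q, hqv, hq⟩ | hr
      · have h1 := ih (u := p) (v := q) (by omega) (by omega)
        have h2 := O.adj_side hpu
        have h3 := O.adj_side hqv
        tauto
      · rw [hr.1 u h]
    · rw [hr.1 v h.symm]

theorem reachable_of_eq {u v : V} (h : lam u = lam v) : G.Reachable u v := by
  induction hd : lam u generalizing u v with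
  | zero =>
    rcases L.parent u with ⟨p, -, hp⟩ | hr
    · omega
    · rw [hr.1 v h.symm]
  | succ d ih =>
    rcases L.parent u with ⟨p, hpu, hp⟩ | hr
    · rcases L.parent v with ⟨q, hqv, hq⟩ | hr
      · exact (hpu.symm.reachable.trans (ih (u := p) (v := q) (by omega) (by omega))).trans
          hqv.reachable
      · rw [hr.1 u h]
    · rw [hr.1 v h.symm]

theorem adj_layer (O : StrongOrdering G) {u v : V} (h : G.Adj u v) :
    lam v = lam u + 1 ∨ lam u = lam v + 1 := by
  have h1 := L.near h
  have h2 := L.near h.symm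
  have h3 : lam u ≠ lam v := fun e => by
    have h4 := L.same_side O e
    have h5 := O.adj_side h
    tauto
  omega

theorem le_of_reachable_root {r v : V} (hr : IsRoot prio lam r) (h : G.Reachable r v) :
    lam r ≤ lam v := by
  obtain ⟨p⟩ := h.symm
  induction p with
  | nil => exact le_rfl
  | cons hadj _ ih =>
    have h0 := ih hr (SimpleGraph.Walk.reachable ‹_›).symm
    by_contra hlt
    have h1 := L.near hadj
    rename_i a b c _
    have h2 : b = c := hr.1 b (by omega)
    subst h2
    have := hr.2.1 a
    omega

theorem root_unique {r r' : V} (hr : IsRoot prio lam r) (hr' : IsRoot prio lam r')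
    (h : G.Reachable r r') : r = r' :=
  hr'.1 r (le_antisymm (L.le_of_reachable_root hr h) (L.le_of_reachable_root hr' h.symm))

theorem exists_root (v : V) : ∃ r, IsRoot prio lam r ∧ G.Reachable r v := by
  induction hd : lam v generalizing v with
  | zero =>
    rcases L.parent v with ⟨p, -, hp⟩ | hr
    · omega
    · exact ⟨v, hr, .refl v⟩
  | succ d ih =>
    rcases L.parent v with ⟨p, hpv, hp⟩ | hr
    · obtain ⟨r, hr, hrp⟩ := ih p (by omega)
      exact ⟨r, hr, hrp.trans hpv.reachable⟩
    · exact ⟨v, hr, .refl v⟩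

/-- A vertex of the component of the root `r` other than `r` has a neighbor in the previous layer. -/
theorem exists_parent {r v : V} (hr : IsRoot prio lam r) (h : G.Reachable r v) (hne : v ≠ r) :
    ∃ p, G.Adj p v ∧ lam p + 1 = lam v ∧ G.Reachable r p := by
  rcases L.parent v with ⟨p, hpv, hp⟩ | hr'
  · exact ⟨p, hpv, hp, h.trans hpv.symm.reachable⟩
  · exact absurd (L.root_unique hr hr' h).symm hne

end Layering

theorem StrongOrdering.convex {V : Type*} {G : SimpleGraph V} (O : StrongOrdering G) {a b v p q : V}
    (ha : G.Adj p a) (hb : G.Adj p b) (hv : G.Adj v q) (hav : O.lt a v) (hvb : O.lt v b) :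
    G.Adj p v := by
  have h1 := O.adj_side ha
  have h2 := O.adj_side hv
  have h3 := O.lt_side hav
  rcases O.total (x := p) (y := q) (by tauto) with h | rfl | h
  · exact (O.cross_adj hv hb.symm hvb h).1.symm
  · exact hv.symm
  · exact (O.cross_adj ha.symm hv hav h).2.symm

namespace Layering

variable {V : Type*} {G : SimpleGraph V} {prio lam : V → ℕ} (L : Layering G prio lam)

include L

/-- Along the strong ordering of one side of a component, the layer number has no interior strict
maximum. -/
theorem not_peak {r : V} (hr : IsRoot prio lam r) : ∀ (N : ℕ) (O : StrongOrdering G) {a a' v : V},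
    lam a + lam a' ≤ N → G.Reachable r a → G.Reachable r a' → G.Reachable r v → O.lt a v →
    O.lt v a' → lam a < lam v → lam a' < lam v → False := by
  intro N
  induction N using Nat.strong_induction_on with
  | _ N ih =>
  have main : ∀ (O : StrongOrdering G) {a a' v : V}, lam a' ≤ lam a →
      lam a + lam a' ≤ N → G.Reachable r a → G.Reachable r a' → G.Reachable r v → O.lt a v →
      O.lt v a' → lam a < lam v → lam a' < lam v → False := by
    intro O a a' v hle hN ha ha' hv hav hva' hl hl'
    have hra' := L.le_of_reachable_root hr ha'
    have hsame := (O.lt_side hav).trans (O.lt_side hva')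
    have hrv : v ≠ r := by rintro rfl; have := L.le_of_reachable_root hr ha; omega
    obtain ⟨q, hqv, hq, -⟩ := L.exists_parent hr hv hrv
    have hno : ∀ p b, G.Adj p a → G.Adj p b → lam p + 1 = lam a → O.lt v b → False := by
      intro p b hpa hpb hp hvb
      have := L.near (O.convex hpa hpb hqv.symm hav hvb)
      omega
    by_cases har : a = r
    · subst har
      have := hr.1 a' (by omega)
      subst this
      exact O.lt_asymm hav hva'
    obtain ⟨p, hpa, hp, hrp⟩ := L.exists_parent hr ha har
    by_cases hpr : p = r
    · subst hpr
      have ha'p : a' ≠ p := by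
        rintro rfl
        have := O.adj_side hpa
        tauto
      obtain ⟨p', hpa', hp', hrp'⟩ := L.exists_parent hr ha' ha'p
      have := L.le_of_reachable_root hr hrp'
      have := hr.1 p' (by omega)
      subst this
      exact hno p' a' hpa hpa' hp hva'
    · obtain ⟨g, hgp, hg, hrg⟩ := L.exists_parent hr hrp hpr
      have hs1 := O.adj_side hpa
      have hs2 := O.adj_side hgp
      have hs3 := O.lt_side hav
      rcases O.total (x := g) (y := v) (by tauto) with h | h | h
      · exact ih (lam g + lam a') (by omega) O le_rfl hrg ha' hv h hva' (by omega) hl'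
      · rw [h] at hg; omega
      · exact hno p g hpa hgp.symm hp h
  intro O a a' v hN ha ha' hv hav hva' hl hl'
  rcases le_total (lam a') (lam a) with h | h
  · exact main O h hN ha ha' hv hav hva' hl hl'
  · exact main O.dual h (by omega) ha' ha hv hva' hav hl' hl

/-- A vertex in the last layer of its component which has minimum degree there is a twin of the first
vertex of its side, for the strong ordering or for the reversed one. -/
theorem exists_first_twin [Fintype V] (O : StrongOrdering G) {r : V}
    (hmax : ∀ v, G.Reachable r v → lam v ≤ lam r)
    (hdeg : ∀ v, G.Reachable r v → lam v = lam r →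
      (Finset.univ.filter fun x => G.Adj r x).card ≤ (Finset.univ.filter fun x => G.Adj v x).card) :
    ∃ O' : StrongOrdering G, ∃ f, (∀ x, G.Adj f x ↔ G.Adj r x) ∧
      ∀ v, G.Reachable r v → (v ∈ O'.U ↔ r ∈ O'.U) → f = v ∨ O'.lt f v := by
  obtain ⟨r₀, hr₀, hr₀r⟩ := L.exists_root r
  have hlow : ∀ v, G.Reachable r v → lam r₀ ≤ lam v := fun v hv =>
    L.le_of_reachable_root hr₀ (hr₀r.trans hv)
  have hfirst : ∀ O' : StrongOrdering G, ∃ f, G.Reachable r f ∧ (f ∈ O'.U ↔ r ∈ O'.U) ∧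
      ∀ v, G.Reachable r v → (v ∈ O'.U ↔ r ∈ O'.U) → f = v ∨ O'.lt f v := by
    intro O'
    obtain ⟨f, hf, hmin⟩ := Finset.exists_min_image
      (Finset.univ.filter fun v => G.Reachable r v ∧ (v ∈ O'.U ↔ r ∈ O'.U)) O'.pos
      ⟨r, by simp⟩
    simp only [Finset.mem_filter, Finset.mem_univ, true_and] at hf hmin
    exact ⟨f, hf.1, hf.2, fun v hv hvs =>
      (StrongOrdering.le_iff_pos (hf.2.trans hvs.symm)).mpr (hmin v ⟨hv, hvs⟩)⟩
  by_cases hrr : r = r₀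
  · subst hrr
    refine ⟨O, r, fun _ => Iff.rfl, fun v hv _ => Or.inl ?_⟩
    exact (hr₀.1 v (le_antisymm (hmax v hv) (hlow v hv))).symm
  obtain ⟨p, hpr, hp, hr₀p⟩ := L.exists_parent hr₀ hr₀r hrr
  by_cases hp0 : p = r₀
  · subst hp0
    -- The component consists of the root and its neighbors, which are all twins.
    have honly : ∀ v, G.Reachable r v → lam v = lam r → ∀ x, G.Adj v x ↔ x = p := by
      intro v hv hvr
      have key : ∀ x, G.Adj v x → x = p := by
        intro x hx
        have h1 := hmax x (hv.trans hx.reachable)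
        have h2 := L.adj_layer O hx
        exact hr₀.1 x (by omega)
      have hvp : v ≠ p := by rintro rfl; omega
      obtain ⟨y, hyv, -, -⟩ := L.exists_parent hr₀ (hr₀r.trans hv) hvp
      intro x
      refine ⟨key x, ?_⟩
      rintro rfl
      rw [← key y hyv.symm]
      exact hyv.symm
    obtain ⟨f, hf, hfs, hfmin⟩ := hfirst O
    have hfr : lam f = lam r := by
      have h1 := hmax f hf
      have h2 := hlow f hf
      by_contra hne
      have h3 := hr₀.1 f (by omega)
      have h4 := O.adj_side hpr
      rw [h3] at hfs
      tauto
    exact ⟨O, f, fun x => (honly f hf hfr x).trans (honly r (.refl r) rfl x).symm, hfmin⟩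
  · obtain ⟨g, hgp, hg, hr₀g⟩ := L.exists_parent hr₀ hr₀p hp0
    have hrg : G.Reachable r g := hr₀r.symm.trans hr₀g
    obtain ⟨O', hO'⟩ : ∃ O' : StrongOrdering G, O'.lt r g := by
      have h1 := O.adj_side hpr
      have h2 := O.adj_side hgp
      rcases O.total (x := r) (y := g) (by tauto) with h | h | h
      · exact ⟨O, h⟩
      · rw [h] at hp; omega
      · exact ⟨O.dual, h⟩
    have hpeak : ∀ {a b}, G.Reachable r a → G.Reachable r b → O'.lt a r → O'.lt r b →
        lam a < lam r → lam b < lam r → False := fun ha hb h1 h2 h3 h4 =>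
      L.not_peak hr₀ _ O' le_rfl (hr₀r.trans ha) (hr₀r.trans hb) hr₀r h1 h2 h3 h4
    obtain ⟨f, hf, hfs, hfmin⟩ := hfirst O'
    refine ⟨O', f, ?_, hfmin⟩
    rcases hfmin r (.refl r) Iff.rfl with rfl | hfr
    · exact fun _ => Iff.rfl
    have hlam : lam f = lam r := by
      have h1 := hmax f hf
      by_contra hne
      exact hpeak hf hrg hfr hO' (by omega) (by omega)
    have hsub : (Finset.univ.filter fun x => G.Adj f x) ⊆ Finset.univ.filter fun x => G.Adj r x := by
      intro q hq
      simp only [Finset.mem_filter, Finset.mem_univ, true_and] at hq ⊢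
      have hrq : G.Reachable r q := hf.trans hq.reachable
      have h1 := hmax q hrq
      have h2 := L.adj_layer O hq
      have h3 := L.le_of_reachable_root hr₀ hr₀g
      have hq0 : q ≠ r₀ := by rintro rfl; omega
      obtain ⟨g', hg'q, hg', hr₀g'⟩ := L.exists_parent hr₀ (hr₀r.trans hrq) hq0
      have s1 := O'.adj_side hq
      have s2 := O'.adj_side hg'q
      rcases O'.total (x := g') (y := r) (by tauto) with h | h | h
      · exact (hpeak (hr₀r.symm.trans hr₀g') hrg h hO' (by omega) (by omega)).elim
      · rw [h] at hg'; omega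
      · exact (O'.convex hq.symm hg'q.symm hpr.symm hfr h).symm
    have heq := Finset.eq_of_subset_of_card_le hsub (hdeg f hf hlam)
    intro x
    have := Finset.ext_iff.mp heq x
    simpa using this

/-! ### Neighborhoods within a layer are nested -/

/-- `p` or a twin of `p` does not lie after `p'`. -/
def _root_.StarPart.StrongOrdering.TwinLe (O : StrongOrdering G) (p p' : V) : Prop :=
  ∃ f, (∀ x, G.Adj f x ↔ G.Adj p x) ∧ (f = p' ∨ O.lt f p')

omit L in
theorem _root_.StarPart.StrongOrdering.TwinLe.cross {O : StrongOrdering G} {p p' v v' : V}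
    (h : O.TwinLe p p') (hv : G.Adj p v) (hv' : G.Adj p' v') (hlt : O.lt v' v) :
    G.Adj p v' ∧ G.Adj p' v := by
  obtain ⟨f, hf, rfl | hf'⟩ := h
  · exact ⟨(hf _).mp hv', (hf _).mpr hv⟩
  · have := O.cross_adj ((hf _).mpr hv) hv' hf' hlt
    exact ⟨(hf _).mp this.1, this.2⟩

theorem twinLe {O : StrongOrdering G} {r : V} (hr : IsRoot prio lam r)
    (hfirst : ∀ v, G.Reachable r v → (v ∈ O.U ↔ r ∈ O.U) → O.TwinLe r v) {v v' : V}
    (hv : G.Reachable r v) (hv' : G.Reachable r v') (hs : v ∈ O.U ↔ v' ∈ O.U)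
    (hlam : lam v + 2 ≤ lam v') : O.TwinLe v v' := by
  induction hd : lam v using Nat.strong_induction_on generalizing v v' with
  | _ d ih =>
  by_cases hvr : v = r
  · subst hvr; exact hfirst v' hv' hs.symm
  obtain ⟨p, hpv, hp, hrp⟩ := L.exists_parent hr hv hvr
  have hv'r : v' ≠ r := by rintro rfl; have := L.le_of_reachable_root hr hv; omega
  obtain ⟨p', hpv', hp', hrp'⟩ := L.exists_parent hr hv' hv'r
  have h1 := O.adj_side hpv
  have h2 := O.adj_side hpv'
  have hpp := ih (lam p) (by omega) hrp hrp' (by tauto) (by omega) rfl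
  rcases O.total hs with h | h | h
  · exact ⟨v, fun _ => Iff.rfl, Or.inr h⟩
  · exact ⟨v, fun _ => Iff.rfl, Or.inl h⟩
  · have := L.near (hpp.cross hpv hpv' h).1
    omega

theorem nested_of_lt {O : StrongOrdering G} {r : V} (hr : IsRoot prio lam r)
    (hfirst : ∀ v, G.Reachable r v → (v ∈ O.U ↔ r ∈ O.U) → O.TwinLe r v) {v v' : V}
    (hv : G.Reachable r v) (hlam : lam v = lam v') (hlt : O.lt v v') :
    (∀ p, lam p + 1 = lam v → G.Adj p v' → G.Adj p v) ∧
    ∀ x, lam x = lam v + 1 → G.Adj x v → G.Adj x v' := by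
  have hv' : G.Reachable r v' := hv.trans (L.reachable_of_eq hlam)
  have hne := O.ne_of_lt hlt
  have hvr : v ≠ r := by rintro rfl; exact hne (hr.1 v' hlam.symm).symm
  have hv'r : v' ≠ r := by rintro rfl; exact hne (hr.1 v hlam)
  constructor
  · intro p hp hpv'
    obtain ⟨q, hqv, hq, -⟩ := L.exists_parent hr hv hvr
    have hrp : G.Reachable r p := hv'.trans hpv'.symm.reachable
    have s1 := O.adj_side hpv'
    have s2 := O.adj_side hqv
    have s3 := O.lt_side hlt
    rcases O.total (x := p) (y := q) (by tauto) with h | rfl | h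
    · exact (O.cross_adj hpv' hqv h hlt).1
    · exact hqv
    · have hpr : p ≠ r := by
        rintro rfl
        exact O.ne_of_lt h (hr.1 q (by omega))
      obtain ⟨g, hgp, hg, hrg⟩ := L.exists_parent hr hrp hpr
      have s4 := O.adj_side hgp
      have := L.twinLe hr hfirst hrg hv (by tauto) (by omega)
      exact (this.cross hgp hqv.symm h).2.symm
  · intro x hx hxv
    obtain ⟨p', hpv', hp', hrp'⟩ := L.exists_parent hr hv' hv'r
    have s1 := O.adj_side hpv'
    have s2 := O.adj_side hxv
    have s3 := O.lt_side hlt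
    have := L.twinLe hr hfirst hrp' (hv.trans hxv.symm.reachable) (by tauto) (by omega)
    exact (this.cross hpv' hxv hlt).2

end Layering

/-- Of any two vertices in a layer, the first one has more neighbors in the previous layer and fewer
in the next layer, with respect to inclusion, or vice versa. -/
def NestedLayers {V : Type*} (G : SimpleGraph V) (lam : V → ℕ) : Prop :=
  ∀ v v', lam v = lam v' →
    ((∀ p, lam p + 1 = lam v → G.Adj p v' → G.Adj p v) ∧
      ∀ x, lam x = lam v + 1 → G.Adj x v → G.Adj x v') ∨
    ((∀ p, lam p + 1 = lam v → G.Adj p v → G.Adj p v') ∧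
      ∀ x, lam x = lam v + 1 → G.Adj x v' → G.Adj x v)

/-- The layering whose roots maximize the layer number of another layering, and among these vertices
minimize the degree, has nested layers. -/
theorem Layering.nestedLayers {V : Type*} [Fintype V] {G : SimpleGraph V} (O : StrongOrdering G)
    {prio₀ lam₀ prio lam : V → ℕ} (L₀ : Layering G prio₀ lam₀) (L : Layering G prio lam)
    (hprio : ∀ u v, prio u ≤ prio v → lam₀ u ≤ lam₀ v ∧ (lam₀ u = lam₀ v →
      (Finset.univ.filter fun x => G.Adj v x).card ≤
        (Finset.univ.filter fun x => G.Adj u x).card)) : NestedLayers G lam := by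
  intro v v' hlam
  obtain ⟨r, hr, hrv⟩ := L.exists_root v
  have hp : ∀ w, G.Reachable r w → prio w ≤ prio r := fun w hw =>
    hr.2.2 w (L.le_of_reachable_root hr hw)
  obtain ⟨O', f, hf, hfirst⟩ := L₀.exists_first_twin O (r := r) (fun w hw => (hprio w r (hp w hw)).1)
    (fun w hw hwr => (hprio w r (hp w hw)).2 hwr)
  have hfirst' : ∀ w, G.Reachable r w → (w ∈ O'.U ↔ r ∈ O'.U) → O'.TwinLe r w :=
    fun w hw hs => ⟨f, hf, hfirst w hw hs⟩
  rcases O'.total (L.same_side O' hlam) with h | rfl | h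
  · exact Or.inl (L.nested_of_lt hr hfirst' hrv hlam h)
  · exact Or.inl ⟨fun _ _ h => h, fun _ _ h => h⟩
  · have := L.nested_of_lt hr hfirst' (hrv.trans (L.reachable_of_eq hlam)) hlam.symm h
    rw [← hlam] at this
    exact Or.inr this

/-! ### The strong ordering by layers -/

section LayerOrder

variable {n : ℕ} (G : SimpleGraph (Fin n)) (lam : Fin n → ℕ)

/-- The number of neighbors in the previous layer. -/
noncomputable def inDeg (v : Fin n) : ℕ :=
  (Finset.univ.filter fun x => G.Adj x v ∧ lam x + 1 = lam v).card

/-- The number of neighbors in the next layer. -/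
noncomputable def outDeg (v : Fin n) : ℕ :=
  (Finset.univ.filter fun x => G.Adj x v ∧ lam x = lam v + 1).card

/-- The sorting key of a vertex: first the layer, then the number of neighbors in the next layer minus
that in the previous layer (shifted by `n` to be nonnegative). -/
noncomputable def layerKey (v : Fin n) : ℕ :=
  lam v * (2 * n + 2) + (n + outDeg G lam v - inDeg G lam v)

theorem inDeg_le (v : Fin n) : inDeg G lam v ≤ n :=
  (Finset.card_le_univ _).trans (by simp)

theorem outDeg_le (v : Fin n) : outDeg G lam v ≤ n :=
  (Finset.card_le_univ _).trans (by simp)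

variable {G lam}

theorem layer_of_key_le {u v : Fin n} (h : layerKey G lam u ≤ layerKey G lam v) :
    lam u < lam v ∨ (lam u = lam v ∧
      outDeg G lam u + inDeg G lam v ≤ outDeg G lam v + inDeg G lam u) := by
  have h1 := inDeg_le G lam u
  have h2 := inDeg_le G lam v
  have h3 := outDeg_le G lam u
  have h4 := outDeg_le G lam v
  unfold layerKey at h
  rcases lt_trichotomy (lam u) (lam v) with hlt | heq | hgt
  · exact Or.inl hlt
  · rw [heq] at h
    exact Or.inr ⟨heq, by omega⟩
  · exfalso
    have : (lam v + 1) * (2 * n + 2) ≤ lam u * (2 * n + 2) := Nat.mul_le_mul_right _ hgt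
    rw [add_mul] at this
    omega

theorem NestedLayers.of_key_le (hN : NestedLayers G lam) {u v : Fin n}
    (h : layerKey G lam u ≤ layerKey G lam v) (hlam : lam u = lam v) :
    (∀ p, lam p + 1 = lam u → G.Adj p v → G.Adj p u) ∧
    ∀ x, lam x = lam u + 1 → G.Adj x u → G.Adj x v := by
  rcases hN u v hlam with h1 | ⟨h1, h2⟩
  · exact h1
  · have hd : outDeg G lam u + inDeg G lam v ≤ outDeg G lam v + inDeg G lam u := by
      rcases layer_of_key_le h with h3 | h3
      · omega
      · exact h3.2
    have sIn : (Finset.univ.filter fun x => G.Adj x u ∧ lam x + 1 = lam u) ⊆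
        Finset.univ.filter fun x => G.Adj x v ∧ lam x + 1 = lam v := by
      intro x hx
      simp only [Finset.mem_filter, Finset.mem_univ, true_and] at hx ⊢
      exact ⟨h1 x hx.2 hx.1, hx.2.trans hlam⟩
    have sOut : (Finset.univ.filter fun x => G.Adj x v ∧ lam x = lam v + 1) ⊆
        Finset.univ.filter fun x => G.Adj x u ∧ lam x = lam u + 1 := by
      intro x hx
      simp only [Finset.mem_filter, Finset.mem_univ, true_and] at hx ⊢
      have hx2 : lam x = lam u + 1 := by rw [hlam]; exact hx.2
      exact ⟨h2 x hx2 hx.1, hx2⟩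
    have c1 := Finset.card_le_card sIn
    have c2 := Finset.card_le_card sOut
    unfold inDeg outDeg at hd
    have e1 := Finset.eq_of_subset_of_card_le sIn (by omega)
    have e2 := Finset.eq_of_subset_of_card_le sOut (by omega)
    constructor
    · intro p hp hpv
      have : p ∈ Finset.univ.filter fun x => G.Adj x v ∧ lam x + 1 = lam v := by
        simpa using ⟨hpv, hp.trans hlam⟩
      rw [← e1] at this
      simpa using (Finset.mem_filter.mp this).2.1
    · intro x hx hxu
      have : x ∈ Finset.univ.filter fun x => G.Adj x u ∧ lam x = lam u + 1 := by
        simpa using ⟨hxu, hx⟩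
      rw [← e2] at this
      simpa using (Finset.mem_filter.mp this).2.1

/-- The strong ordering by layers: the sides are the even and the odd layers, and the vertices of either
side are sorted by `layerKey`, with ties broken by the vertex numbers. -/
noncomputable def layerOrdering (hadj : ∀ {u v}, G.Adj u v → lam v = lam u + 1 ∨ lam u = lam v + 1)
    (hN : NestedLayers G lam) : StrongOrdering G where
  U := {v | lam v % 2 = 0}
  W := {v | lam v % 2 = 1}
  bipartite := by
    refine ⟨?_, fun u v h => ?_⟩
    · rw [Set.disjoint_left]
      intro v hv hv'
      simp only [Set.mem_ofPred_eq] at hv hv'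
      omega
    · simp only [Set.mem_ofPred_eq]
      have := hadj h
      omega
  cover := by
    ext v
    simp only [Set.mem_union, Set.mem_ofPred_eq, Set.mem_univ, iff_true]
    omega
  lt x y := lam x % 2 = lam y % 2 ∧ (layerKey G lam x < layerKey G lam y ∨
    (layerKey G lam x = layerKey G lam y ∧ x < y))
  lt_same_side := by
    intro x y h
    simp only [Set.mem_ofPred_eq]
    omega
  lt_irrefl := by simp
  lt_trans := by
    rintro x y z ⟨h1, h2⟩ ⟨h3, h4⟩
    simp only [Fin.lt_def] at h2 h4 ⊢
    omega
  total_U := by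
    intro x y hx hy
    simp only [Set.mem_ofPred_eq] at hx hy
    simp only [Fin.lt_def, Fin.ext_iff]
    omega
  total_W := by
    intro x y hx hy
    simp only [Set.mem_ofPred_eq] at hx hy
    simp only [Fin.lt_def, Fin.ext_iff]
    omega
  strong := by
    rintro u u' w w' - - - - huw hu'w' ⟨h1, h2⟩ ⟨h3, h4⟩
    have k1 : layerKey G lam u ≤ layerKey G lam u' := by omega
    have k2 : layerKey G lam w' ≤ layerKey G lam w := by omega
    have l1 := hadj huw
    have l2 := hadj hu'w'
    have l3 : lam u ≤ lam u' := by rcases layer_of_key_le k1 with h | h <;> omega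
    have l4 : lam w' ≤ lam w := by rcases layer_of_key_le k2 with h | h <;> omega
    by_cases hu : lam u = lam u'
    · have nu := hN.of_key_le k1 hu
      by_cases hw : lam w' = lam w
      · have nw := hN.of_key_le k2 hw
        rcases l1 with l1 | l1
        · exact ⟨nw.1 u (by omega) huw, (nu.2 w l1 huw.symm).symm⟩
        · exact ⟨(nu.1 w' (by omega) hu'w'.symm).symm, nw.2 u' (by omega) hu'w'⟩
      · exact ⟨(nu.1 w' (by omega) hu'w'.symm).symm, (nu.2 w (by omega) huw.symm).symm⟩
    · have hw : lam w' = lam w := by omega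
      have nw := hN.of_key_le k2 hw
      exact ⟨nw.1 u (by omega) huw, nw.2 u' (by omega) hu'w'⟩

end LayerOrder

/-- A bipartite permutation graph has a strong ordering: number the vertices as in a permutation
diagram. -/
theorem IsBipartitePermutationGraph.nonempty_strongOrdering {V : Type*} [Fintype V]
    {G : SimpleGraph V} (h : IsBipartitePermutationGraph G) : Nonempty (StrongOrdering G) := by
  obtain ⟨hb, e, π, he⟩ := h
  obtain ⟨c⟩ := hb
  have hc : ∀ {u v}, G.Adj u v → c u ≠ c v := fun h => c.valid h
  have h01 : ∀ v, c v = 0 ∨ c v = 1 := fun v => by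
    have := (c v).2
    rcases (by omega : (c v).1 = 0 ∨ (c v).1 = 1) with h | h
    · exact Or.inl (Fin.ext h)
    · exact Or.inr (Fin.ext h)
  have inj : ∀ {x y}, (π (e x)).1 = (π (e y)).1 → x = y := fun h =>
    e.injective (π.injective (Fin.ext h))
  have mono : ∀ {x y}, c x = c y → e x < e y → (π (e x)).1 < (π (e y)).1 := by
    intro x y hxy hlt
    by_contra hn
    have hne : (π (e x)).1 ≠ (π (e y)).1 := fun h => by
      rw [inj h] at hlt
      exact lt_irrefl _ hlt
    exact hc ((he x y).mpr (Or.inl ⟨hlt, Fin.lt_def.mpr (by omega)⟩)) hxy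
  refine ⟨{
    U := {v | c v = 0}
    W := {v | c v = 1}
    bipartite := ⟨?_, ?_⟩
    cover := ?_
    lt := fun x y => c x = c y ∧ e x < e y
    lt_same_side := ?_
    lt_irrefl := fun x h => lt_irrefl _ h.2
    lt_trans := fun h h' => ⟨h.1.trans h'.1, h.2.trans h'.2⟩
    total_U := ?_
    total_W := ?_
    strong := ?_ }⟩
  · rw [Set.disjoint_left]
    intro v (hv : c v = 0) (hv' : c v = 1)
    rw [hv] at hv'
    exact absurd hv' (by decide)
  · intro u v huv
    have := hc huv
    rcases h01 u with h1 | h1 <;> rcases h01 v with h2 | h2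
    · exact absurd (h1.trans h2.symm) this
    · exact Or.inl ⟨h1, h2⟩
    · exact Or.inr ⟨h1, h2⟩
    · exact absurd (h1.trans h2.symm) this
  · ext v
    simpa using h01 v
  · rintro x y ⟨hxy, -⟩
    rcases h01 x with h1 | h1
    · exact Or.inl ⟨h1, hxy.symm.trans h1⟩
    · exact Or.inr ⟨h1, hxy.symm.trans h1⟩
  · intro x y (hx : c x = 0) (hy : c y = 0)
    rcases lt_trichotomy (e x) (e y) with h | h | h
    · exact Or.inl ⟨hx.trans hy.symm, h⟩
    · exact Or.inr (Or.inl (e.injective h))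
    · exact Or.inr (Or.inr ⟨hy.trans hx.symm, h⟩)
  · intro x y (hx : c x = 1) (hy : c y = 1)
    rcases lt_trichotomy (e x) (e y) with h | h | h
    · exact Or.inl ⟨hx.trans hy.symm, h⟩
    · exact Or.inr (Or.inl (e.injective h))
    · exact Or.inr (Or.inr ⟨hy.trans hx.symm, h⟩)
  · rintro u u' w w' - - - - huw hu'w' ⟨hu, hu'⟩ ⟨hw, hw'⟩
    have m1 := mono hu hu'
    have m2 := mono hw hw'
    rw [he] at huw hu'w' ⊢
    rw [he]
    simp only [Fin.lt_def] at *
    omega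

/-! ### Breadth-first search -/

section Search

variable {n : ℕ} {G : SimpleGraph (Fin n)} {prio lam : Fin n → ℕ} {t c : ℕ} {D : Finset (Fin n)}

/-- The state of the search after `t` rounds: `D` is the set of processed vertices, `lam` is the layer
number of the visited vertices and `0` for the other ones, and `c` is the current layer. -/
structure SearchInv (G : SimpleGraph (Fin n)) (prio : Fin n → ℕ) (t : ℕ) (lam : Fin n → ℕ)
    (D : Finset (Fin n)) (c : ℕ) : Prop where
  card : D.card = t
  visited : ∀ v ∈ D, lam v ≠ 0
  adj : ∀ v ∈ D, ∀ w, G.Adj v w → lam w ≠ 0 ∧ lam w ≤ lam v + 1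
  le_cur : ∀ v ∈ D, lam v ≤ c
  front : ∀ v, v ∉ D → lam v ≠ 0 → c ≤ lam v ∧ lam v ≤ c + 1
  cur_le : c ≤ 2 * t
  parent : ∀ v, lam v ≠ 0 → (∃ u, G.Adj u v ∧ lam u + 1 = lam v ∧ lam u ≠ 0) ∨
    (v ∈ D ∧ lam v % 2 = 0 ∧ (∀ w, lam w = lam v → w = v) ∧ (∀ w, lam w + 1 ≠ lam v) ∧
      ∀ w, lam w = 0 ∨ lam v ≤ lam w → prio w ≤ prio v)

theorem searchInv_zero : SearchInv G prio 0 (fun _ => 0) ∅ 0 where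
  card := rfl
  visited := by simp
  adj := by simp
  le_cur := by simp
  front := by simp
  cur_le := le_rfl
  parent := by simp

theorem SearchInv.le (h : SearchInv G prio t lam D c) (v : Fin n) : lam v ≤ 2 * t + 1 := by
  have h1 := h.cur_le
  by_cases hv : v ∈ D
  · have := h.le_cur v hv; omega
  · by_cases h0 : lam v = 0
    · omega
    · have := (h.front v hv h0).2; omega

/-- The layer numbers after `v` has been made a root, unless it has been visited before. -/
def rootLayer (t : ℕ) (lam : Fin n → ℕ) (v : Fin n) : Fin n → ℕ :=
  fun w => if w = v ∧ lam v = 0 then 2 * t + 2 else lam w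

/-- The layer numbers after the neighbors of `v` have been visited. -/
noncomputable def nextLayer (G : SimpleGraph (Fin n)) (lam : Fin n → ℕ) (v : Fin n) : Fin n → ℕ :=
  fun w => if G.Adj v w ∧ lam w = 0 then lam v + 1 else lam w

theorem SearchInv.step (h : SearchInv G prio t lam D c) {v : Fin n} (hv : v ∉ D)
    (hvis : lam v ≠ 0 → ∀ u, u ∉ D → lam u ≠ 0 → lam v ≤ lam u)
    (hnew : lam v = 0 → ∀ u, u ∉ D → lam u = 0 ∧ prio u ≤ prio v) :
    ∃ c', SearchInv G prio (t + 1) (nextLayer G (rootLayer t lam v) v) (insert v D) c' := by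
  set m := rootLayer t lam v with hm
  have hcur := h.cur_le
  have mD : ∀ u ∈ D, m u = lam u := fun u hu => by
    have : u ≠ v := fun e => hv (e ▸ hu)
    simp [hm, rootLayer, this]
  have mne : ∀ u, lam u ≠ 0 → m u = lam u := fun u hu => by
    simp only [hm, rootLayer]
    rw [if_neg]
    rintro ⟨rfl, h0⟩
    exact hu h0
  have mv : lam v ≠ 0 ∧ m = lam ∨ lam v = 0 ∧ m v = 2 * t + 2 ∧ ∀ u, u ≠ v → m u = lam u := by
    by_cases h0 : lam v = 0
    · exact Or.inr ⟨h0, by simp [hm, rootLayer, h0], fun u hu => by simp [hm, rootLayer, hu]⟩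
    · exact Or.inl ⟨h0, by funext u; simp [hm, rootLayer, h0]⟩
  have mv0 : m v ≠ 0 := by
    rcases mv with ⟨h1, h2⟩ | ⟨h1, h2, -⟩
    · rwa [h2]
    · omega
  have cm : c ≤ m v ∧ m v ≤ 2 * t + 2 := by
    rcases mv with ⟨h1, h2⟩ | ⟨h1, h2, -⟩
    · have := h.front v hv h1
      rw [h2]; omega
    · omega
  have front : ∀ u, u ∉ D → m u ≠ 0 → m v ≤ m u ∧ m u ≤ m v + 1 := by
    intro u hu hu0
    rcases mv with ⟨h1, h2⟩ | ⟨h1, h2, h3⟩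
    · rw [h2] at hu0 ⊢
      have := hvis h1 u hu hu0
      have := h.front u hu hu0
      have := h.front v hv h1
      omega
    · by_cases huv : u = v
      · subst huv; omega
      · rw [h3 u huv] at hu0
        exact absurd (hnew h1 u hu).1 hu0
  have parent : ∀ x, m x ≠ 0 → (∃ u, G.Adj u x ∧ m u + 1 = m x ∧ m u ≠ 0) ∨
      (x ∈ insert v D ∧ m x % 2 = 0 ∧ (∀ w, m w = m x → w = x) ∧ (∀ w, m w + 1 ≠ m x) ∧
        ∀ w, m w = 0 ∨ m x ≤ m w → prio w ≤ prio x) := by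
    intro x hx
    rcases mv with ⟨h1, h2⟩ | ⟨h1, h2, h3⟩
    · rw [h2] at hx ⊢
      rcases h.parent x hx with hp | ⟨hp1, hp2⟩
      · exact Or.inl hp
      · exact Or.inr ⟨Finset.mem_insert_of_mem hp1, hp2⟩
    · by_cases hxv : x = v
      · subst hxv
        have small : ∀ w, w ≠ x → m w ≤ 2 * t := by
          intro w hw
          rw [h3 w hw]
          by_cases hwD : w ∈ D
          · exact (h.le_cur w hwD).trans hcur
          · rw [(hnew h1 w hwD).1]; omega
        refine Or.inr ⟨Finset.mem_insert_self _ _, by omega, fun w hw => ?_, fun w hw => ?_,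
          fun w hw => ?_⟩
        · by_contra hne
          have := small w hne; omega
        · by_cases hne : w = x
          · subst hne; omega
          · have := small w hne; omega
        · by_cases hne : w = x
          · rw [hne]
          · have := small w hne
            have hw0 : m w = 0 := by omega
            have hwD : w ∉ D := fun hwD => h.visited w hwD (by rw [← mD w hwD]; exact hw0)
            exact (hnew h1 w hwD).2
      · rw [h3 x hxv] at hx ⊢
        rcases h.parent x hx with ⟨u, hu1, hu2, hu3⟩ | ⟨hp1, hp2, hp3, hp4, hp5⟩
        · exact Or.inl ⟨u, hu1, by rw [mne u hu3]; exact hu2, by rw [mne u hu3]; exact hu3⟩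
        · have hxc := h.le_cur x hp1
          refine Or.inr ⟨Finset.mem_insert_of_mem hp1, hp2, fun w hw => ?_, fun w hw => ?_,
            fun w hw => ?_⟩
          · by_cases hwv : w = v
            · subst hwv; omega
            · exact hp3 w (by rw [← h3 w hwv]; exact hw)
          · by_cases hwv : w = v
            · subst hwv; omega
            · exact hp4 w (by rw [← h3 w hwv]; exact hw)
          · by_cases hwv : w = v
            · subst hwv; exact hp5 w (Or.inl h1)
            · exact hp5 w (by rw [← h3 w hwv]; exact hw)
  have lne : ∀ u, m u ≠ 0 → nextLayer G m v u = m u := fun u hu => by simp [nextLayer, hu]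
  have lcase : ∀ u, nextLayer G m v u = m u ∨ (G.Adj v u ∧ m u = 0 ∧
      nextLayer G m v u = m v + 1) := by
    intro u
    by_cases hu : G.Adj v u ∧ m u = 0
    · exact Or.inr ⟨hu.1, hu.2, by simp [nextLayer, hu]⟩
    · exact Or.inl (by simp [nextLayer, hu])
  have visD : ∀ u ∈ D, m u ≠ 0 := fun u hu => by rw [mD u hu]; exact h.visited u hu
  have visD' : ∀ u ∈ insert v D, m u ≠ 0 := fun u hu => by
    rcases Finset.mem_insert.mp hu with rfl | hu
    · exact mv0
    · exact visD u hu
  refine ⟨m v, ?_, ?_, ?_, ?_, ?_, ?_, ?_⟩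
  · rw [Finset.card_insert_of_notMem hv, h.card]
  · intro u hu
    rw [lne u (visD' u hu)]
    exact visD' u hu
  · intro u hu w huw
    rw [lne u (visD' u hu)]
    rcases Finset.mem_insert.mp hu with rfl | hu
    · rcases lcase w with hw | ⟨-, -, hw⟩
      · have hw0 : m w ≠ 0 := fun h0 => by simp [nextLayer, huw, h0] at hw
        rw [hw]
        refine ⟨hw0, ?_⟩
        by_cases hwD : w ∈ D
        · rw [mD w hwD]
          have := h.le_cur w hwD
          omega
        · exact (front w hwD hw0).2
      · rw [hw]; omega
    · have h1 := h.adj u hu w huw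
      have h2 := mne w h1.1
      rw [lne w (by rw [h2]; exact h1.1), h2, mD u hu]
      exact h1
  · intro u hu
    rw [lne u (visD' u hu)]
    rcases Finset.mem_insert.mp hu with rfl | hu
    · exact le_rfl
    · rw [mD u hu]
      have := h.le_cur u hu
      omega
  · intro u hu hu0
    rw [Finset.mem_insert, not_or] at hu
    rcases lcase u with h1 | ⟨-, -, h1⟩
    · rw [h1] at hu0 ⊢
      exact front u hu.2 hu0
    · omega
  · omega
  · intro x hx
    rcases lcase x with h1 | ⟨h1, h2, h3⟩
    · rw [h1] at hx ⊢
      rcases parent x hx with ⟨u, hu1, hu2, hu3⟩ | ⟨hp1, hp2, hp3, hp4, hp5⟩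
      · exact Or.inl ⟨u, hu1, by rw [lne u hu3]; exact hu2, by rw [lne u hu3]; exact hu3⟩
      · -- The new layer number is larger than that of every root.
        have hxv : m x ≤ m v := by
          rcases Finset.mem_insert.mp hp1 with rfl | hxD
          · exact le_rfl
          · rw [mD x hxD]
            have := h.le_cur x hxD
            omega
        refine Or.inr ⟨hp1, hp2, fun w hw => ?_, fun w hw => ?_, fun w hw => ?_⟩
        · rcases lcase w with h4 | ⟨-, -, h4⟩
          · exact hp3 w (by rw [← h4]; exact hw)
          · omega
        · rcases lcase w with h4 | ⟨-, -, h4⟩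
          · exact hp4 w (by rw [← h4]; exact hw)
          · omega
        · rcases lcase w with h4 | ⟨-, h4, -⟩
          · exact hp5 w (by rw [← h4]; exact hw)
          · exact hp5 w (Or.inl h4)
    · exact Or.inl ⟨v, h1, by rw [lne v mv0, h3], by rw [lne v mv0]; exact mv0⟩

theorem SearchInv.layering (h : SearchInv G prio n lam D c) : Layering G prio lam := by
  have hD : ∀ v, v ∈ D := by
    have : D = Finset.univ := Finset.eq_univ_of_card _ (by rw [h.card, Fintype.card_fin])
    simp [this]
  refine ⟨fun {u v} huv => (h.adj u (hD u) v huv).2, fun v => ?_⟩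
  rcases h.parent v (h.visited v (hD v)) with ⟨u, h1, h2, -⟩ | ⟨-, -, h1, h2, h3⟩
  · exact Or.inl ⟨u, h1, h2⟩
  · exact Or.inr ⟨h1, h2, fun w hw => h3 w (Or.inr hw)⟩

end Search

/-! ### The tables of the dynamic program -/

section Tables

variable (E : ℕ → ℕ → Prop)

/-- The number of consecutive `b < j`, counted down from `j`, with `E i b`. -/
noncomputable def runLength (i : ℕ) : ℕ → ℕ
  | 0 => 0
  | j + 1 => if E i j then runLength i j + 1 else 0

theorem le_runLength_iff {i j s : ℕ} :
    s ≤ runLength E i j ↔ s ≤ j ∧ ∀ b < s, E i (j - s + b) := by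
  induction j generalizing s with
  | zero =>
    simp only [runLength]
    constructor
    · intro h; exact ⟨h, fun b hb => by omega⟩
    · exact fun h => h.1
  | succ j ih =>
    simp only [runLength]
    rcases s with - | s
    · simp
    by_cases hE : E i j
    · rw [if_pos hE, Nat.succ_le_succ_iff, ih]
      constructor
      · rintro ⟨h1, h2⟩
        refine ⟨by omega, fun b hb => ?_⟩
        rcases Nat.lt_succ_iff_lt_or_eq.mp hb with hb | rfl
        · have := h2 b hb
          rwa [show j + 1 - (s + 1) + b = j - s + b by omega]
        · rwa [show j + 1 - (b + 1) + b = j by omega]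
      · rintro ⟨h1, h2⟩
        refine ⟨by omega, fun b hb => ?_⟩
        have := h2 b (by omega)
        rwa [show j + 1 - (s + 1) + b = j - s + b by omega] at this
    · rw [if_neg hE]
      constructor
      · omega
      · rintro ⟨h1, h2⟩
        have := h2 s (by omega)
        rw [show j + 1 - (s + 1) + s = j by omega] at this
        exact absurd this hE

/-- One plus the largest `a < i` with `p a`, and `0` if there is none. -/
noncomputable def lastBelow (p : ℕ → Prop) : ℕ → ℕ
  | 0 => 0
  | i + 1 => if p i then i + 1 else lastBelow p i

theorem lt_lastBelow_iff {p : ℕ → Prop} {i k : ℕ} : k < lastBelow p i ↔ ∃ a, k ≤ a ∧ a < i ∧ p a := by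
  induction i with
  | zero => simp [lastBelow]
  | succ i ih =>
    simp only [lastBelow]
    by_cases hp : p i
    · rw [if_pos hp]
      constructor
      · exact fun h => ⟨i, by omega, by omega, hp⟩
      · rintro ⟨a, h1, h2, -⟩; omega
    · rw [if_neg hp, ih]
      constructor
      · rintro ⟨a, h1, h2, h3⟩; exact ⟨a, h1, by omega, h3⟩
      · rintro ⟨a, h1, h2, h3⟩
        have : a ≠ i := by rintro rfl; exact hp h3
        exact ⟨a, h1, by omega, h3⟩

theorem lastBelow_le (p : ℕ → Prop) (i : ℕ) : lastBelow p i ≤ i := by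
  by_contra h
  obtain ⟨a, h1, h2, -⟩ := (lt_lastBelow_iff (p := p) (i := i) (k := i)).mp (by omega)
  omega

theorem runLength_le (i j : ℕ) : runLength E i j ≤ j :=
  ((le_runLength_iff E).mp le_rfl).1

/-- The recursion for `Reach` in terms of the tables. -/
theorem reach_iff_tables {s i j : ℕ} : Reach E s i j ↔ (i = 0 ∧ j = 0) ∨
    (0 < i ∧ s ≤ j ∧ Reach E s (i - 1) (j - s) ∧ s ≤ runLength E (i - 1) j) ∨
    (s ≤ i ∧ 0 < j ∧ Reach E s (i - s) (j - 1) ∧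
      s ≤ runLength (fun b a => E a b) (j - 1) i) ∨
    (s + 1 ≤ i ∧ s + 1 ≤ j ∧ Reach E s (i - (s + 1)) (j - (s + 1)) ∧
      i - (s + 1) < lastBelow (fun a => s + 1 ≤ runLength E a j) i ∧
      j - (s + 1) < lastBelow (fun b => s + 1 ≤ runLength (fun b a => E a b) b i) j) := by
  simp only [lt_lastBelow_iff, le_runLength_iff]
  constructor
  · intro h
    cases h with
    | zero => exact Or.inl ⟨rfl, rfl⟩
    | @left i j h hE =>
      refine Or.inr (Or.inl ⟨by omega, by omega, ?_, by omega, fun b hb => ?_⟩)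
      · rwa [Nat.add_sub_cancel, Nat.add_sub_cancel]
      · rw [Nat.add_sub_cancel, Nat.add_sub_cancel]; exact hE b hb
    | @right i j h hE =>
      refine Or.inr (Or.inr (Or.inl ⟨by omega, by omega, ?_, by omega, fun b hb => ?_⟩))
      · rwa [Nat.add_sub_cancel, Nat.add_sub_cancel]
      · rw [Nat.add_sub_cancel, Nat.add_sub_cancel]; exact hE b hb
    | @pair i j h hE hE' =>
      obtain ⟨a, ha, hE⟩ := hE
      obtain ⟨b, hb, hE'⟩ := hE'
      have e1 : i + s + 1 - (s + 1) = i := by omega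
      have e2 : j + s + 1 - (s + 1) = j := by omega
      rw [e1, e2]
      exact Or.inr (Or.inr (Or.inr ⟨by omega, by omega, h,
        ⟨i + a, by omega, by omega, by omega, fun b hb => hE b (by omega)⟩,
        ⟨j + b, by omega, by omega, by omega, fun a ha => hE' a (by omega)⟩⟩))
  · rintro (⟨rfl, rfl⟩ | ⟨h1, h2, h3, -, h4⟩ | ⟨h1, h2, h3, -, h4⟩ |
      ⟨h1, h2, h3, ⟨a, ha1, ha2, -, ha⟩, ⟨b, hb1, hb2, -, hb⟩⟩)
    · exact .zero
    · have := h3.left h4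
      rwa [Nat.sub_add_cancel h1, Nat.sub_add_cancel h2] at this
    · have := h3.right h4
      rwa [Nat.sub_add_cancel h1, Nat.sub_add_cancel h2] at this
    · have := h3.pair ⟨a - (i - (s + 1)), by omega, fun c hc => by
          rw [Nat.add_sub_cancel' ha1]; exact ha c (by omega)⟩
        ⟨b - (j - (s + 1)), by omega, fun c hc => by
          rw [Nat.add_sub_cancel' hb1]; exact hb c (by omega)⟩
      rwa [add_assoc, add_assoc, Nat.sub_add_cancel h1, Nat.sub_add_cancel h2] at this

end Tables

/-! ### Tests and generic loops -/

namespace Ex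

/-- The negation of a test: `1` if `a` is zero, and `0` otherwise. -/
def not (a : Ex) : Ex := .sub (.c 1) a

/-- The truth value of a test: `0` if `a` is zero, and `1` otherwise. -/
def bit (a : Ex) : Ex := a.not.not

/-- A test for `a < b`. -/
def lt (a b : Ex) : Ex := .sub b a

/-- A test for `a ≤ b`. -/
def le (a b : Ex) : Ex := .sub (.add b (.c 1)) a

/-- A test for `a = b`. -/
def eq (a b : Ex) : Ex := .sub (.sub (.c 1) (.sub a b)) (.sub b a)

variable (h : Store) (a b : Ex)

@[simp] theorem val_not : a.not.val h = if a.val h = 0 then 1 else 0 := by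
  simp only [not, val]; split_ifs <;> omega

@[simp] theorem val_bit : a.bit.val h = if a.val h = 0 then 0 else 1 := by
  simp only [bit, val_not]; split_ifs <;> simp_all

theorem lt_ne_zero : (lt a b).val h ≠ 0 ↔ a.val h < b.val h := by simp only [lt, val]; omega

theorem le_ne_zero : (le a b).val h ≠ 0 ↔ a.val h ≤ b.val h := by simp only [le, val]; omega

theorem eq_ne_zero : (eq a b).val h ≠ 0 ↔ a.val h = b.val h := by simp only [eq, val]; omega

theorem mul_ne_zero' : (mul a b).val h ≠ 0 ↔ a.val h ≠ 0 ∧ b.val h ≠ 0 := by simp [val]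

theorem add_ne_zero' : (add a b).val h ≠ 0 ↔ a.val h ≠ 0 ∨ b.val h ≠ 0 := by
  simp only [val]; omega

theorem not_ne_zero : a.not.val h ≠ 0 ↔ a.val h = 0 := by simp

end Ex

namespace Cmd

variable {M n : ℕ} {inp : ℕ → ℕ → ℕ}

/-- Counts in register `c` the values of register `i` below `reg b` that satisfy a test. -/
def count (i b c : ℕ) (e : Ex) : Cmd :=
  .seq (.set c (.c 0)) (.loop i b (.ite e (.set c (.add (.r c) (.c 1))) .skip))

theorem wp_count {i b c : ℕ} {e : Ex} {h : Store} (p : ℕ → Prop) (hic : i ≠ c) (hbc : b ≠ c)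
    (hM : h.reg b ≤ M)
    (he : ∀ k < h.reg b, ∀ h', h'.arr = h.arr → (∀ j, j ≠ i → j ≠ c → h'.reg j = h.reg j) →
      h'.reg i = k → (e.val h' ≠ 0 ↔ p k)) :
    wp M n inp (count i b c e)
      (fun h' => h'.reg c = ((Finset.range (h.reg b)).filter p).card) h := by
  refine ⟨by simp [Ex.val], ?_⟩
  refine wp_loop (fun k h' => h'.reg c = ((Finset.range k).filter p).card) (by simp [Ex.val]) ?_ ?_
  · intro k hk h' hI hF
    have hk' : k < h.reg b := by simpa [hbc] using hk
    have h1 : (h'.setReg i k).arr = h.arr := by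
      rw [Store.setReg_arr]
      funext l
      rw [hF.2 l rfl]; rfl
    have h2 : ∀ j, j ≠ i → j ≠ c → (h'.setReg i k).reg j = h.reg j := by
      intro j hj hj'
      have := hF.1 j (by simp [writesReg, hj.symm, hj'.symm])
      simp [hj, this, hj']
    have hev := he k hk' _ h1 h2 (by simp)
    have hle : ((Finset.range k).filter p).card ≤ k :=
      (Finset.card_filter_le _ _).trans (by simp)
    refine ⟨fun h0 => ⟨?_, ?_⟩, fun h0 => ?_⟩
    · simp only [Ex.val, Store.setReg_reg, hic.symm, if_false, hI]
      omega
    · have hp := hev.mp h0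
      simp only [Ex.val, Store.setReg_reg, hic.symm, if_false, if_true, hI]
      rw [Finset.range_add_one, Finset.filter_insert, if_pos hp,
        Finset.card_insert_of_notMem (by simp)]
    · have hp : ¬ p k := fun hp => hev.mpr hp h0
      change (h'.setReg i k).reg c = _
      simp only [Store.setReg_reg, hic.symm, if_false, hI]
      rw [Finset.range_add_one, Finset.filter_insert, if_neg hp]
  · intro h' hI _
    simpa [hic.symm, hbc] using hI

/-- Fills the array `k` at the indices below `reg b` with the values of an expression. -/
def fill (i b k : ℕ) (e : Ex) : Cmd := .loop i b (.put k (.r i) (.c 0) e)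

theorem wp_fill {i b k : ℕ} {e : Ex} {h : Store} (f : ℕ → ℕ)
    (he : ∀ x < h.reg b, ∀ h', (∀ l, l ≠ k → h'.arr l = h.arr l) →
      (∀ j, j ≠ i → h'.reg j = h.reg j) → h'.reg i = x → e.val h' = f x ∧ f x ≤ M) :
    wp M n inp (fill i b k e) (fun h' => ∀ x < h.reg b, h'.arr k x 0 = f x) h := by
  refine wp_loop (fun y h' => ∀ x < y, h'.arr k x 0 = f x) (by simp) ?_ ?_
  · intro y hy h' hI hF
    have hev := he y hy (h'.setReg i y)
      (fun l hl => by rw [Store.setReg_arr, hF.2 l (by simp [writesArr, hl.symm])])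
      (fun j hj => by simp [hj, hF.1 j (by simp [writesReg, hj.symm])]) (by simp)
    refine ⟨by rw [hev.1]; exact hev.2, fun x hx => ?_⟩
    rw [hev.1]
    simp only [Ex.val, Store.setReg_reg, Store.setArr_arr, Store.setReg_arr, if_true, true_and,
      and_true]
    by_cases hxy : x = y
    · simp [hxy]
    · rw [if_neg hxy]; exact hI x (by omega)
  · intro h' hI _
    exact hI

/-- Fills the array `k` at the indices below `reg b` with the numbers of successful tests. -/
def fillCount (k : ℕ) (e : Ex) : Cmd :=
  .loop 4 0 (.seq (count 5 0 6 e) (.put k (.r 4) (.c 0) (.r 6)))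

theorem wp_fillCount {k : ℕ} {e : Ex} {h : Store} (p : ℕ → ℕ → Prop) (hM : h.reg 0 ≤ M)
    (he : ∀ x < h.reg 0, ∀ y < h.reg 0, ∀ h', (∀ l, l ≠ k → h'.arr l = h.arr l) →
      (∀ j, j ≠ 4 → j ≠ 5 → j ≠ 6 → h'.reg j = h.reg j) → h'.reg 4 = x → h'.reg 5 = y →
      (e.val h' ≠ 0 ↔ p x y)) :
    wp M n inp (fillCount k e) (fun h' => ∀ x < h.reg 0,
      h'.arr k x 0 = ((Finset.range (h.reg 0)).filter (p x)).card) h := by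
  refine wp_loop (fun y h' => ∀ x < y,
      h'.arr k x 0 = ((Finset.range (h.reg 0)).filter (p x)).card) (by simp) ?_ ?_
  · intro y hy h' hI hF
    have h0 : (h'.setReg 4 y).reg 0 = h.reg 0 := by simp [hF.1 0 rfl]
    have ha : ∀ l, l ≠ k → h'.arr l = h.arr l := fun l hl =>
      hF.2 l (by simp [writesArr, count, hl.symm])
    have hr : ∀ j, j ≠ 4 → j ≠ 5 → j ≠ 6 → h'.reg j = h.reg j := fun j h4 h5 h6 =>
      hF.1 j (by simp [writesReg, count, h4.symm, h5.symm, h6.symm])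
    refine wp_seq (wp_count (p y) (by decide) (by decide) (by rw [h0]; exact hM) ?_) ?_
    · rw [h0]
      intro z hz h'' e1 e2 e3
      refine he y hy z hz h'' (fun l hl => ?_) (fun j h4 h5 h6 => ?_) ?_ e3
      · rw [e1, Store.setReg_arr, ha l hl]
      · rw [e2 j h5 h6, Store.setReg_reg, if_neg h4, hr j h4 h5 h6]
      · rw [e2 4 (by decide) (by decide)]; simp
    · intro h'' hc hF'
      rw [h0] at hc
      have h4 : h''.reg 4 = y := by rw [hF'.1 4 rfl]; simp
      have hak : h''.arr k = h'.arr k := by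
        rw [hF'.2 k (by simp [writesArr, count]), Store.setReg_arr]
      refine ⟨?_, fun x hx => ?_⟩
      · simp only [Ex.val, hc]
        exact ((Finset.card_filter_le _ _).trans (by simp)).trans hM
      · simp only [Ex.val, Store.setArr_arr, h4, hc, hak, true_and, and_true]
        by_cases hxy : x = y
        · simp [hxy]
        · rw [if_neg hxy]; exact hI x (by omega)
  · intro h' hI _
    exact hI

/-- Fills the array `k` at the pairs of indices up to `n`, row by row. -/
def fillTable (k : ℕ) (e : Ex) : Cmd := .loop 4 3 (.loop 5 3 (.put k (.r 4) (.r 5) e))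

theorem wp_fillTable {k : ℕ} {e : Ex} {h : Store} (f : ℕ → ℕ → ℕ) (h3 : h.reg 3 = n + 1)
    (he : ∀ x ≤ n, ∀ y ≤ n, ∀ h', (∀ l, l ≠ k → h'.arr l = h.arr l) →
      (∀ j, j ≠ 4 → j ≠ 5 → h'.reg j = h.reg j) → h'.reg 4 = x → h'.reg 5 = y →
      (∀ x' y', x' ≤ n → y' ≤ n → (x' < x ∨ (x' = x ∧ y' < y)) → h'.arr k x' y' = f x' y') →
      e.val h' = f x y ∧ f x y ≤ M) :
    wp M n inp (fillTable k e) (fun h' => ∀ x ≤ n, ∀ y ≤ n, h'.arr k x y = f x y) h := by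
  refine wp_loop (fun x h' => ∀ x' < x, ∀ y' ≤ n, h'.arr k x' y' = f x' y') (by simp) ?_ ?_
  · intro x hx h' hI hF
    rw [h3] at hx
    have hr3 : (h'.setReg 4 x).reg 3 = n + 1 := by simp [hF.1 3 rfl, h3]
    have ha : ∀ l, l ≠ k → h'.arr l = h.arr l := fun l hl => hF.2 l (by simp [writesArr, hl.symm])
    have hr : ∀ j, j ≠ 4 → j ≠ 5 → h'.reg j = h.reg j := fun j h4 h5 =>
      hF.1 j (by simp [writesReg, h4.symm, h5.symm])
    refine wp_loop (fun y h'' => (∀ x' < x, ∀ y' ≤ n, h''.arr k x' y' = f x' y') ∧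
      ∀ y' < y, h''.arr k x y' = f x y') ⟨hI, by simp⟩ ?_ ?_
    · intro y hy h'' hI' hF'
      rw [hr3] at hy
      have hev := he x (by omega) y (by omega) (h''.setReg 5 y)
        (fun l hl => by
          rw [Store.setReg_arr, hF'.2 l (by simp [writesArr, hl.symm]), Store.setReg_arr, ha l hl])
        (fun j h4 h5 => by
          rw [Store.setReg_reg, if_neg h5, hF'.1 j (by simp [writesReg, h5.symm]),
            Store.setReg_reg, if_neg h4, hr j h4 h5])
        (by rw [Store.setReg_reg, if_neg (by decide), hF'.1 4 rfl]; simp)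
        (by simp)
        (by
          rintro x' y' hx' hy' (hlt | ⟨rfl, hlt⟩)
          · exact hI'.1 x' hlt y' hy'
          · exact hI'.2 y' hlt)
      have h4 : h''.reg 4 = x := by rw [hF'.1 4 rfl]; simp
      refine ⟨by rw [hev.1]; exact hev.2, ?_, ?_⟩
      · intro x' hx' y' hy'
        rw [hev.1]
        simp only [Ex.val, Store.setReg_reg, Store.setArr_arr, Store.setReg_arr]
        rw [if_neg (by simp [h4]; omega)]
        exact hI'.1 x' hx' y' hy'
      · intro y' hy'
        rw [hev.1]
        simp only [Ex.val, Store.setReg_reg, Store.setArr_arr, Store.setReg_arr]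
        by_cases hyy : y' = y
        · simp [h4, hyy]
        · rw [if_neg (by simp [hyy])]
          exact hI'.2 y' (by omega)
    · intro h'' hI' _
      rw [hr3] at hI' ⊢
      intro x' hx' y' hy'
      rw [Store.setReg_arr]
      rcases Nat.lt_succ_iff_lt_or_eq.mp hx' with hlt | rfl
      · exact hI'.1 x' hlt y' hy'
      · exact hI'.2 y' (by omega)
  · intro h' hI _ x hx y hy
    rw [h3] at hI
    exact hI x (by omega) y hy

end Cmd

namespace Cmd

variable {M n : ℕ} {inp : ℕ → ℕ → ℕ}

/-- Stores in register `c` an index below `reg b` that maximizes a score, where `e` and `e'` are the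
scores of the contents of the registers `i` and `c`. -/
def argmax (i b c : ℕ) (e e' : Ex) : Cmd :=
  .seq (.set c (.c 0)) (.loop i b (.ite (.lt e' e) (.set c (.r i)) .skip))

theorem wp_argmax {i b c : ℕ} {e e' : Ex} {h : Store} (f : ℕ → ℕ) (hic : i ≠ c) (hbc : b ≠ c)
    (hM : h.reg b ≤ M) (hpos : 0 < h.reg b)
    (he : ∀ h', h'.arr = h.arr → (∀ j, j ≠ i → j ≠ c → h'.reg j = h.reg j) →
      e.val h' = f (h'.reg i) ∧ e'.val h' = f (h'.reg c)) :
    wp M n inp (argmax i b c e e')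
      (fun h' => h'.reg c < h.reg b ∧ ∀ x < h.reg b, f x ≤ f (h'.reg c)) h := by
  refine ⟨by simp [Ex.val], ?_⟩
  refine wp_loop (fun k h' => h'.reg c < h.reg b ∧ ∀ x < k, f x ≤ f (h'.reg c))
    (by simpa [Ex.val] using hpos) ?_ ?_
  · intro k hk h' hI hF
    have hk' : k < h.reg b := by simpa [hbc] using hk
    have hev := he (h'.setReg i k)
      (by rw [Store.setReg_arr]; funext l; rw [hF.2 l rfl]; rfl)
      (fun j hj hj' => by
        have := hF.1 j (by simp [writesReg, hj.symm, hj'.symm])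
        simp [hj, this, hj'])
    have hi : (h'.setReg i k).reg i = k := by simp
    have hc : (h'.setReg i k).reg c = h'.reg c := by simp [hic.symm]
    rw [hi, hc] at hev
    refine ⟨fun h0 => ⟨?_, ?_, ?_⟩, fun h0 => ⟨?_, ?_⟩⟩
    · simp only [Ex.val, hi]; omega
    · simpa [Ex.val] using hk'
    · rw [Ex.lt_ne_zero, hev.1, hev.2] at h0
      simp only [Ex.val, Store.setReg_reg, if_true]
      intro x hx
      rcases Nat.lt_succ_iff_lt_or_eq.mp hx with hx | rfl
      · exact (hI.2 x hx).trans h0.le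
      · exact le_rfl
    · rw [hc]; exact hI.1
    · rw [hc]
      intro x hx
      rcases Nat.lt_succ_iff_lt_or_eq.mp hx with hx | rfl
      · exact hI.2 x hx
      · by_contra hn
        exact (Ex.lt_ne_zero _ _ _).mpr (by rw [hev.1, hev.2]; omega) h0
  · intro h' hI _
    simpa [hic.symm, hbc] using hI

end Cmd

/-! ### The search as a command -/

/-- The store holds the input: `n + 1` in register `3`, a bound on all later values in register `8`, and
the adjacency matrix in array `0`. -/
structure Loaded {n : ℕ} (G : SimpleGraph (Fin n)) (h : Store) : Prop where
  reg_zero : h.reg 0 = n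
  reg_three : h.reg 3 = n + 1
  reg_eight : h.reg 8 = 4 * (n + 2) * (n + 2)
  adj : ∀ i j : Fin n, h.arr 0 i j = if G.Adj i j then 1 else 0

theorem Loaded.frame {n : ℕ} {G : SimpleGraph (Fin n)} {h h' : Store} {p : Cmd} (hL : Loaded G h)
    (hF : Cmd.Frame p h h') (h0 : p.writesReg 0 = false) (h3 : p.writesReg 3 = false)
    (h8 : p.writesReg 8 = false) (ha : p.writesArr 0 = false) : Loaded G h' :=
  ⟨by rw [hF.1 0 h0, hL.reg_zero], by rw [hF.1 3 h3, hL.reg_three], by rw [hF.1 8 h8, hL.reg_eight],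
    fun i j => by rw [hF.2 0 ha, hL.adj]⟩

namespace Cmd

/-- The score by which the search chooses the next vertex `x`: unprocessed visited vertices come first,
in the order of their layers, followed by the unvisited vertices by decreasing priority. -/
def scoreEx (x : Ex) : Ex :=
  .mul (.not (.arr 2 x (.c 0)))
    (.add (.mul (.bit (.arr 1 x (.c 0))) (.sub (.r 8) (.arr 1 x (.c 0))))
      (.mul (.not (.arr 1 x (.c 0))) (.add (.arr 3 x (.c 0)) (.c 1))))

/-- Makes the chosen vertex a root, unless it has been visited before. -/
def makeRoot : Cmd :=
  .ite (.arr 1 (.r 7) (.c 0)) .skip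
    (.seq (.put 1 (.r 7) (.c 0) (.add (.mul (.c 2) (.r 4)) (.c 2))) (.put 5 (.r 7) (.c 0) (.c 0)))

/-- Visits the neighbors of the chosen vertex. -/
def spread : Cmd :=
  .loop 5 0 (.ite (.mul (.arr 0 (.r 7) (.r 5)) (.not (.arr 1 (.r 5) (.c 0))))
    (.seq (.put 1 (.r 5) (.c 0) (.add (.arr 1 (.r 7) (.c 0)) (.c 1)))
      (.put 5 (.r 5) (.c 0) (.not (.arr 5 (.r 7) (.c 0))))) .skip)

/-- Breadth-first search with the priorities in array `3`; the layers go to array `1` and their parities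
to array `5`, and array `2` marks the processed vertices. -/
def search : Cmd :=
  .seq (fill 4 0 1 (.c 0)) (.seq (fill 4 0 2 (.c 0))
    (.loop 4 0 (.seq (argmax 5 0 7 (scoreEx (.r 5)) (scoreEx (.r 7)))
      (.seq makeRoot (.seq (.put 2 (.r 7) (.c 0) (.c 1)) spread)))))

section Search

variable {M n : ℕ} {inp : ℕ → ℕ → ℕ} {G : SimpleGraph (Fin n)}

/-- The arrays `1` and `5` hold the layers and their parities. -/
def HasLayers (h : Store) (lam : Fin n → ℕ) : Prop :=
  ∀ v : Fin n, h.arr 1 v 0 = lam v ∧ (lam v ≠ 0 → h.arr 5 v 0 = lam v % 2)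

/-- The array `2` marks the elements of `D`. -/
def HasMarks (h : Store) (D : Finset (Fin n)) : Prop :=
  ∀ v : Fin n, h.arr 2 v 0 = if v ∈ D then 1 else 0

theorem wp_makeRoot {h : Store} {lam : Fin n → ℕ} {v : Fin n} {t : ℕ} (hl : HasLayers h lam)
    (h7 : h.reg 7 = v) (h4 : h.reg 4 = t) (hM : 2 * t + 2 ≤ M) :
    wp M n inp makeRoot (fun h' => HasLayers h' (rootLayer t lam v)) h := by
  have hv : (Ex.arr 1 (.r 7) (.c 0)).val h = lam v := by simp [Ex.val, h7, (hl v).1]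
  refine ⟨fun h0 w => ?_, fun h0 => ⟨?_, ?_, fun w => ?_⟩⟩
  · rw [hv] at h0
    rw [show rootLayer t lam v w = lam w by simp [rootLayer, h0]]
    exact hl w
  · simpa [Ex.val, h4] using hM
  · simp [Ex.val]
  · rw [hv] at h0
    simp only [Ex.val, Store.setArr_arr, Store.setArr_reg, h7, h4, rootLayer, h0, and_true]
    by_cases hw : w = v
    · subst hw; simp
    · have : (w : ℕ) ≠ v := fun e => hw (Fin.ext e)
      simpa [hw, this] using hl w

theorem wp_spread {h : Store} {lam : Fin n → ℕ} {v : Fin n} (hL : Loaded G h)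
    (hl : HasLayers h lam) (h7 : h.reg 7 = v) (hv : lam v ≠ 0) (hM : lam v + 1 ≤ M) :
    wp M n inp spread (fun h' => HasLayers h' (nextLayer G lam v)) h := by
  have hM1 : 1 ≤ M := by omega
  refine wp_loop (fun k h' => HasLayers h' fun w => if (w : ℕ) < k then nextLayer G lam v w else lam w)
    (by simpa using hl) ?_ ?_
  · intro k hk h' hI hF
    rw [hL.reg_zero] at hk
    set w : Fin n := ⟨k, hk⟩ with hw
    have hL' := hL.frame hF rfl rfl rfl rfl
    have h7' : h'.reg 7 = v := by rw [hF.1 7 rfl, h7]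
    have hnv : nextLayer G lam v v = lam v := by simp [nextLayer]
    have hIv : h'.arr 1 v 0 = lam v ∧ h'.arr 5 v 0 = lam v % 2 := by
      have := hI v
      simp only [hnv, ite_self] at this
      exact ⟨this.1, this.2 hv⟩
    have hIw : h'.arr 1 k 0 = lam w := by
      have := (hI w).1
      simpa [hw] using this
    have ha : h'.arr 0 v k = if G.Adj v w then 1 else 0 := hL'.adj v w
    refine ⟨fun h0 => ⟨?_, ?_, fun x => ?_⟩, fun h0 x => ?_⟩
    · simp only [Ex.val, Store.setReg_reg, Store.setReg_arr, if_neg (show (7 : ℕ) ≠ 5 by decide), h7',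
        hIv.1]
      exact hM
    · simp only [Ex.val_not]
      split_ifs <;> omega
    · rw [Ex.mul_ne_zero', Ex.not_ne_zero] at h0
      simp only [Ex.val, Store.setReg_reg, Store.setReg_arr, if_neg (show (7 : ℕ) ≠ 5 by decide), h7',
        hIw, ha, if_true] at h0
      have hvw : G.Adj v w := by by_contra hn; simp [hn] at h0
      simp only [Ex.val, Ex.val_not, Store.setReg_reg, Store.setReg_arr, Store.setArr_arr,
        Store.setArr_reg, if_neg (show (7 : ℕ) ≠ 5 by decide), h7', if_true, true_and, and_true]
      by_cases hx : x = w
      · subst hx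
        have : (v : ℕ) ≠ k := fun e => by
          have : v = w := Fin.ext e
          rw [this] at hvw
          exact hvw.ne rfl
        have hn : nextLayer G lam v w = lam v + 1 := by
          simp only [nextLayer]; rw [if_pos ⟨hvw, h0.2⟩]
        have hwk : (w : ℕ) = k := rfl
        simp only [hwk, Nat.lt_succ_self, if_true, hn, hIv.1, hIv.2]
        simp [this]
        split_ifs <;> omega
      · have hxk : (x : ℕ) ≠ k := fun e => hx (Fin.ext e)
        have := hI x
        simp only [if_neg hxk, show ((x : ℕ) < k + 1) = ((x : ℕ) < k) by
          apply propext; omega]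
        simpa [hxk] using this
    · have hn : ¬ (G.Adj v w ∧ lam w = 0) := by
        intro hh
        refine (Ex.mul_ne_zero' _ _ _).mpr ⟨?_, (Ex.not_ne_zero _ _).mpr ?_⟩ h0
        · simp [Ex.val, h7', ha, hh.1]
        · simp [Ex.val, hIw, hh.2]
      have hx := hI x
      by_cases hxw : x = w
      · subst hxw
        have : nextLayer G lam v w = lam w := by simp only [nextLayer]; rw [if_neg hn]
        simp only [this, ite_self] at hx ⊢
        exact hx
      · have hxk : (x : ℕ) ≠ k := fun e => hxw (Fin.ext e)
        simp only [show ((x : ℕ) < k + 1) = ((x : ℕ) < k) by apply propext; omega]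
        exact hx
  · intro h' hI _ w
    have := hI w
    simpa [hL.reg_zero] using this

theorem wp_search {h : Store} {prio : Fin n → ℕ} (hL : Loaded G h) (hM : 4 * (n + 2) * (n + 2) ≤ M)
    (hp : ∀ v : Fin n, h.arr 3 v 0 = prio v) (hprio : ∀ v, prio v + 2 * n + 2 < 4 * (n + 2) * (n + 2)) :
    wp M n inp search (fun h' => ∃ lam, Layering G prio lam ∧ (∀ v, lam v ≤ 2 * n + 1) ∧
      ∀ v : Fin n, h'.arr 1 v 0 = lam v ∧ h'.arr 5 v 0 = lam v % 2) h := by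
  have hnM : 2 * n + 2 ≤ M := by nlinarith
  refine wp_seq (wp_fill (fun _ => 0) fun x _ h' _ _ _ => ⟨rfl, Nat.zero_le _⟩) fun h₁ H₁ F₁ => ?_
  refine wp_seq (wp_fill (fun _ => 0) fun x _ h' _ _ _ => ⟨rfl, Nat.zero_le _⟩) fun h₂ H₂ F₂ => ?_
  have hL₁ : Loaded G h₁ := hL.frame F₁ rfl rfl rfl rfl
  have hL₂ : Loaded G h₂ := hL₁.frame F₂ rfl rfl rfl rfl
  rw [hL.reg_zero] at H₁
  rw [hL₁.reg_zero] at H₂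
  have hp₂ : ∀ v : Fin n, h₂.arr 3 v 0 = prio v := fun v => by rw [F₂.2 3 rfl, F₁.2 3 rfl, hp]
  refine wp_loop (fun t h' => ∃ lam D c, SearchInv G prio t lam D c ∧ HasLayers h' lam ∧
    HasMarks h' D) ⟨_, _, _, searchInv_zero, fun v => ⟨?_, fun h0 => absurd rfl h0⟩, fun v => ?_⟩ ?_ ?_
  · rw [F₂.2 1 rfl, H₁ v v.2]
  · rw [H₂ v v.2]; simp
  · rintro t ht h₃ ⟨lam, D, c, hS, hl, hm⟩ F₃
    rw [hL₂.reg_zero] at ht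
    have hle : ∀ v, lam v ≤ 2 * n := fun v => by have := hS.le v; omega
    have hL₃ : Loaded G h₃ := hL₂.frame F₃ rfl rfl rfl rfl
    have hp₃ : ∀ v : Fin n, h₃.arr 3 v 0 = prio v := fun v => by rw [F₃.2 3 rfl, hp₂]
    have r₃ : ∀ j, j ≠ 4 → (h₃.setReg 4 t).reg j = h₃.reg j := fun j hj => by simp [hj]
    have sc : ∀ h' : Store, h'.arr = (h₃.setReg 4 t).arr →
        (∀ j, j ≠ 5 → j ≠ 7 → h'.reg j = (h₃.setReg 4 t).reg j) → ∀ e : Ex,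
        (scoreEx e).val h' = if h₃.arr 2 (e.val h') 0 = 0 then
          if h₃.arr 1 (e.val h') 0 = 0 then h₃.arr 3 (e.val h') 0 + 1
          else 4 * (n + 2) * (n + 2) - h₃.arr 1 (e.val h') 0 else 0 := by
      intro h' ea er e
      have e8 : h'.reg 8 = 4 * (n + 2) * (n + 2) := by
        rw [er 8 (by decide) (by decide), r₃ 8 (by decide), hL₃.reg_eight]
      simp only [scoreEx, Ex.val, Ex.val_not, Ex.val_bit, e8, ea, Store.setReg_arr]
      split_ifs <;> simp
    refine wp_seq (wp_argmax (fun x => if h₃.arr 2 x 0 = 0 then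
        if h₃.arr 1 x 0 = 0 then h₃.arr 3 x 0 + 1
        else 4 * (n + 2) * (n + 2) - h₃.arr 1 x 0 else 0) (by decide) (by decide)
      (by rw [r₃ 0 (by decide), hL₃.reg_zero]; omega) (by rw [r₃ 0 (by decide), hL₃.reg_zero]; omega)
      fun h' ea er => ⟨sc h' ea er _, sc h' ea er _⟩) ?_
    rintro h₄ ⟨H₄, H₄'⟩ F₄
    rw [r₃ 0 (by decide), hL₃.reg_zero] at H₄ H₄'
    set v : Fin n := ⟨h₄.reg 7, H₄⟩ with hv
    have h7 : h₄.reg 7 = v := rfl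
    have best : ∀ u : Fin n, (if u ∈ D then 0 else if lam u = 0 then prio u + 1 else
        4 * (n + 2) * (n + 2) - lam u) ≤ if v ∈ D then 0 else if lam v = 0 then prio v + 1 else
        4 * (n + 2) * (n + 2) - lam v := by
      intro u
      have := H₄' u u.2
      rw [h7] at this
      simp only [hm u, hm v, (hl u).1, (hl v).1, hp₃] at this
      by_cases h1 : u ∈ D
      · simp [h1]
      · by_cases h2 : v ∈ D <;> simpa [h1, h2] using this
    clear H₄'
    obtain ⟨u₀, hu₀⟩ : ∃ u, u ∉ D := by
      by_contra! hall
      have : D = Finset.univ := Finset.eq_univ_of_forall hall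
      have := hS.card
      simp_all
    have hbig : ∀ u, lam u < 4 * (n + 2) * (n + 2) := fun u => by
      have := hle u; have := hprio u; omega
    have hvD : v ∉ D := by
      intro hvD
      have := best u₀
      rw [if_neg hu₀, if_pos hvD] at this
      have := hbig u₀
      split_ifs at * <;> omega
    have hvis : lam v ≠ 0 → ∀ u, u ∉ D → lam u ≠ 0 → lam v ≤ lam u := by
      intro h0 u hu hu0
      have := best u
      rw [if_neg hu, if_neg hvD, if_neg h0, if_neg hu0] at this
      have := hbig u
      omega
    have hnew : lam v = 0 → ∀ u, u ∉ D → lam u = 0 ∧ prio u ≤ prio v := by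
      intro h0 u hu
      have := best u
      rw [if_neg hu, if_neg hvD, if_pos h0] at this
      have h1 := hprio v
      have h2 := hle u
      split_ifs at this <;> omega
    obtain ⟨c', hS'⟩ := hS.step hvD hvis hnew
    have hL₄ : Loaded G h₄ := by
      refine Loaded.frame (h := h₃.setReg 4 t) ⟨?_, ?_, ?_, hL₃.adj⟩ F₄ rfl rfl rfl rfl
      · rw [r₃ 0 (by decide), hL₃.reg_zero]
      · rw [r₃ 3 (by decide), hL₃.reg_three]
      · rw [r₃ 8 (by decide), hL₃.reg_eight]
    have hl₄ : HasLayers h₄ lam := fun u => by rw [F₄.2 1 rfl, F₄.2 5 rfl]; exact hl u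
    have hm₄ : HasMarks h₄ D := fun u => by rw [F₄.2 2 rfl]; exact hm u
    have h4 : h₄.reg 4 = t := by rw [F₄.1 4 rfl]; simp
    refine wp_seq (wp_makeRoot hl₄ h7 h4 (by omega)) fun h₅ H₅ F₅ => ?_
    have hL₅ : Loaded G h₅ := hL₄.frame F₅ rfl rfl rfl rfl
    have h7₅ : h₅.reg 7 = v := by rw [F₅.1 7 rfl]
    refine ⟨by simp only [Ex.val]; omega, ?_⟩
    have hroot : rootLayer t lam v v ≠ 0 ∧ rootLayer t lam v v + 1 ≤ 2 * n + 1 := by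
      have := hle v
      simp only [rootLayer, true_and]
      split_ifs <;> omega
    have hL₆ : Loaded G (h₅.setArr 2 (h₅.reg 7) 0 1) :=
      ⟨hL₅.reg_zero, hL₅.reg_three, hL₅.reg_eight, hL₅.adj⟩
    refine wp_mono (fun h' hh => ⟨_, _, _, hS', hh.1, fun u => ?_⟩)
      (wp_frame (wp_spread hL₆ H₅ h7₅ hroot.1 (by omega)))
    rw [hh.2.2 2 rfl]
    simp only [Ex.val, Store.setArr_arr, h7₅, and_true, F₅.2 2 rfl]
    by_cases huv : u = v
    · subst huv; simp
    · have : (u : ℕ) ≠ v := fun e => huv (Fin.ext e)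
      simp [this, huv, hm₄ u]
  · rintro h₃ ⟨lam, D, c, hS, hl, -⟩ -
    rw [hL₂.reg_zero] at hS
    have hD : ∀ v, v ∈ D := by
      have : D = Finset.univ := Finset.eq_univ_of_card _ (by rw [hS.card, Fintype.card_fin])
      simp [this]
    exact ⟨lam, hS.layering, hS.le, fun v => ⟨(hl v).1, (hl v).2 (hS.visited v (hD v))⟩⟩

end Search

end Cmd

/-! ### Computing a strong ordering -/

theorem card_filter_range {n : ℕ} (p : ℕ → Prop) :
    ((Finset.range n).filter p).card = (Finset.univ.filter fun v : Fin n => p v).card := by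
  rw [Finset.card_filter, Finset.card_filter, Finset.sum_range]

/-- The adjacency matrix with indices in `ℕ`. -/
noncomputable def inputMatrix {n : ℕ} (G : SimpleGraph (Fin n)) (i j : ℕ) : ℕ :=
  if ∃ a b : Fin n, (a : ℕ) = i ∧ (b : ℕ) = j ∧ G.Adj a b then 1 else 0

theorem inputMatrix_apply {n : ℕ} (G : SimpleGraph (Fin n)) (a b : Fin n) :
    inputMatrix G a b = if G.Adj a b then 1 else 0 := by
  simp only [inputMatrix]
  congr 1
  apply propext
  constructor
  · rintro ⟨a', b', h1, h2, h⟩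
    rwa [Fin.ext h1, Fin.ext h2] at h
  · exact fun h => ⟨a, b, rfl, rfl, h⟩

namespace Cmd

section

variable {M n : ℕ} {inp : ℕ → ℕ → ℕ} {G : SimpleGraph (Fin n)}

theorem wp_fill_fin {k : ℕ} {e : Ex} {h : Store} (f : Fin n → ℕ) (h0 : h.reg 0 = n)
    (he : ∀ v : Fin n, ∀ h', (∀ l, l ≠ k → h'.arr l = h.arr l) →
      (∀ j, j ≠ 4 → h'.reg j = h.reg j) → h'.reg 4 = (v : ℕ) → e.val h' = f v ∧ f v ≤ M) :
    wp M n inp (fill 4 0 k e) (fun h' => ∀ v : Fin n, h'.arr k v 0 = f v) h := by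
  refine wp_mono (fun h' hh v => ?_)
    (wp_fill (M := M) (fun x => if hx : x < n then f ⟨x, hx⟩ else 0) fun x hx h' e1 e2 e3 => ?_)
  · have := hh v (by rw [h0]; exact v.2)
    simpa using this
  · rw [h0] at hx
    simpa [hx] using he ⟨x, hx⟩ h' e1 e2 e3

theorem wp_fillCount_fin {k : ℕ} {e : Ex} {h : Store} (P : Fin n → Fin n → Prop) (h0 : h.reg 0 = n)
    (hM : n ≤ M) (he : ∀ v w : Fin n, ∀ h', (∀ l, l ≠ k → h'.arr l = h.arr l) →
      (∀ j, j ≠ 4 → j ≠ 5 → j ≠ 6 → h'.reg j = h.reg j) → h'.reg 4 = (v : ℕ) → h'.reg 5 = (w : ℕ) →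
      (e.val h' ≠ 0 ↔ P v w)) :
    wp M n inp (fillCount k e) (fun h' => ∀ v : Fin n,
      h'.arr k v 0 = (Finset.univ.filter (P v)).card) h := by
  refine wp_mono (fun h' hh v => ?_)
    (wp_fillCount (M := M) (fun x y => ∃ (hx : x < n) (hy : y < n), P ⟨x, hx⟩ ⟨y, hy⟩) (h0 ▸ hM)
      fun x hx y hy h' e1 e2 e3 e4 => ?_)
  · have := hh v (by rw [h0]; exact v.2)
    rw [this, h0, card_filter_range]
    simp
  · rw [h0] at hx hy
    simpa [hx, hy] using he ⟨x, hx⟩ ⟨y, hy⟩ h' e1 e2 e3 e4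

theorem wp_count_fin {i c : ℕ} {e : Ex} {h : Store} (P : Fin n → Prop) (hic : i ≠ c) (hc : 0 ≠ c)
    (h0 : h.reg 0 = n) (hM : n ≤ M)
    (he : ∀ v : Fin n, ∀ h', h'.arr = h.arr → (∀ j, j ≠ i → j ≠ c → h'.reg j = h.reg j) →
      h'.reg i = (v : ℕ) → (e.val h' ≠ 0 ↔ P v)) :
    wp M n inp (count i 0 c e) (fun h' => h'.reg c = (Finset.univ.filter P).card) h := by
  refine wp_mono (fun h' hh => ?_)
    (wp_count (M := M) (fun x => ∃ hx : x < n, P ⟨x, hx⟩) hic hc (h0 ▸ hM)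
      fun x hx h' e1 e2 e3 => ?_)
  · rw [hh, h0, card_filter_range]
    simp
  · rw [h0] at hx
    simpa [hx] using he ⟨x, hx⟩ h' e1 e2 e3

/-- Copies the input to array `0` and computes the bound in register `8`. -/
def load : Cmd :=
  .seq (.set 8 (.mul (.mul (.c 4) (.add (.r 0) (.c 2))) (.add (.r 0) (.c 2))))
    (.loop 4 0 (.loop 5 0 (.fetch 0 4 5)))

theorem wp_load {h : Store} (h0 : h.reg 0 = n) (h3 : h.reg 3 = n + 1)
    (hM : 4 * (n + 2) * (n + 2) ≤ M) :
    wp M n (inputMatrix G) load (Loaded G) h := by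
  refine ⟨by simpa [Ex.val, h0] using hM, ?_⟩
  have e8 : Ex.val h (((Ex.c 4).mul ((Ex.r 0).add (Ex.c 2))).mul ((Ex.r 0).add (Ex.c 2))) =
    4 * (n + 2) * (n + 2) := by simp [Ex.val, h0]
  rw [e8]
  set h₁ := h.setReg 8 (4 * (n + 2) * (n + 2)) with hh₁
  have r0 : h₁.reg 0 = n := by simp [hh₁, h0]
  refine wp_loop (fun x h' => ∀ x' < x, ∀ y < n, h'.arr 0 x' y = inputMatrix G x' y) (by simp) ?_ ?_
  · intro x hx h' hI hF
    rw [r0] at hx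
    have r0' : (h'.setReg 4 x).reg 0 = n := by simp [hF.1 0 rfl, r0]
    refine wp_loop (fun y h'' => (∀ x' < x, ∀ y < n, h''.arr 0 x' y = inputMatrix G x' y) ∧
      ∀ y' < y, h''.arr 0 x y' = inputMatrix G x y') ⟨hI, by simp⟩ ?_ ?_
    · intro y hy h'' hI' hF'
      rw [r0'] at hy
      have h4 : h''.reg 4 = x := by rw [hF'.1 4 rfl]; simp
      refine ⟨by simpa [h4] using hx, by simpa using hy, fun x' hx' y' hy' => ?_, fun y' hy' => ?_⟩
      · simp only [Store.setArr_arr, Store.setReg_reg, Store.setReg_arr]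
        rw [if_neg (by simp [h4]; omega)]
        exact hI'.1 x' hx' y' hy'
      · simp only [Store.setArr_arr, Store.setReg_reg, Store.setReg_arr]
        by_cases hyy : y' = y
        · simp [h4, hyy]
        · rw [if_neg (by simp [hyy])]
          exact hI'.2 y' (by omega)
    · intro h'' hI' _ x' hx' y hy
      rw [r0'] at hI'
      rcases Nat.lt_succ_iff_lt_or_eq.mp hx' with hlt | rfl
      · exact hI'.1 x' hlt y hy
      · exact hI'.2 y hy
  · intro h' hI hF
    rw [r0] at hI
    refine ⟨?_, ?_, ?_, fun i j => ?_⟩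
    · simp [hF.1 0 rfl, r0]
    · simp [hF.1 3 rfl, hh₁, h3]
    · simp [hF.1 8 rfl, hh₁]
    · rw [Store.setReg_arr, hI i i.2 j j.2, inputMatrix_apply]

/-- Computes a layering with nested layers by two searches. -/
def layers : Cmd :=
  .seq (fill 4 0 3 (.c 0)) (.seq search (.seq (fillCount 4 (.arr 0 (.r 4) (.r 5)))
    (.seq (fill 4 0 3 (.add (.mul (.arr 1 (.r 4) (.c 0)) (.r 3))
      (.sub (.r 0) (.arr 4 (.r 4) (.c 0))))) search)))

theorem wp_layers {h : Store} (O : StrongOrdering G) (hL : Loaded G h)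
    (hM : 4 * (n + 2) * (n + 2) ≤ M) :
    wp M n inp layers (fun h' => ∃ lam : Fin n → ℕ,
      (∀ {u v}, G.Adj u v → lam v = lam u + 1 ∨ lam u = lam v + 1) ∧ NestedLayers G lam ∧
      (∀ v, lam v ≤ 2 * n + 1) ∧
      ∀ v : Fin n, h'.arr 1 v 0 = lam v ∧ h'.arr 5 v 0 = lam v % 2) h := by
  refine wp_seq (wp_fill_fin (fun _ => 0) hL.reg_zero fun v h' _ _ _ => ⟨rfl, Nat.zero_le _⟩)
    fun h₁ H₁ F₁ => ?_
  have L₁ : Loaded G h₁ := hL.frame F₁ rfl rfl rfl rfl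
  refine wp_seq (wp_search L₁ hM H₁ fun v => by nlinarith) ?_
  rintro h₂ ⟨lam₀, hlay₀, hle₀, H₂⟩ F₂
  have L₂ : Loaded G h₂ := L₁.frame F₂ rfl rfl rfl rfl
  refine wp_seq (wp_fillCount_fin (fun v w => G.Adj v w) L₂.reg_zero (by nlinarith) ?_) ?_
  · intro v w h' e1 e2 e3 e4
    simp [Ex.val, e3, e4, e1 0 (by decide), L₂.adj]
  intro h₃ H₃ F₃
  have L₃ : Loaded G h₃ := L₂.frame F₃ rfl rfl rfl rfl
  have hd : ∀ v : Fin n, (Finset.univ.filter fun w => G.Adj v w).card ≤ n := fun v =>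
    (Finset.card_le_univ _).trans (by simp)
  have hb : ∀ v, lam₀ v * (n + 1) + (n - (Finset.univ.filter fun w => G.Adj v w).card) +
      2 * n + 2 < 4 * (n + 2) * (n + 2) := by
    intro v
    have := Nat.mul_le_mul_right (n + 1) (hle₀ v)
    have : n - (Finset.univ.filter fun w => G.Adj v w).card ≤ n := Nat.sub_le _ _
    nlinarith
  refine wp_seq (wp_fill_fin (fun v => lam₀ v * (n + 1) +
    (n - (Finset.univ.filter fun w => G.Adj v w).card)) L₃.reg_zero ?_) ?_
  · intro v h' e1 e2 e3
    refine ⟨?_, by have := hb v; omega⟩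
    simp only [Ex.val, e3, e1 1 (by decide), e1 4 (by decide), e2 3 (by decide), e2 0 (by decide),
      L₃.reg_zero, L₃.reg_three, H₃]
    rw [F₃.2 1 rfl, (H₂ v).1]
  intro h₄ H₄ F₄
  have L₄ : Loaded G h₄ := L₃.frame F₄ rfl rfl rfl rfl
  refine wp_mono ?_ (wp_search L₄ hM H₄ hb)
  rintro h₅ ⟨lam, hlay, hle, H₅⟩
  refine ⟨lam, fun huv => hlay.adj_layer O huv, hlay₀.nestedLayers O hlay fun u v huv => ?_, hle, H₅⟩
  have h1 := hd u
  have h2 := hd v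
  constructor
  · by_contra hn
    have := Nat.mul_le_mul_right (n + 1) (show lam₀ v + 1 ≤ lam₀ u by omega)
    rw [add_mul] at this
    omega
  · intro he
    rw [he] at huv
    omega

/-- Computes the sorting keys, lists the vertices of the two sides (rows `0` and `1` of array `9`) in the
order of these keys, and counts them in the registers `9` and `10`. -/
def sortSides : Cmd :=
  .seq (fillCount 6 (.mul (.arr 0 (.r 5) (.r 4))
    (.eq (.add (.arr 1 (.r 5) (.c 0)) (.c 1)) (.arr 1 (.r 4) (.c 0)))))
  (.seq (fillCount 7 (.mul (.arr 0 (.r 5) (.r 4))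
    (.eq (.arr 1 (.r 5) (.c 0)) (.add (.arr 1 (.r 4) (.c 0)) (.c 1)))))
  (.seq (fill 4 0 8 (.add (.mul (.arr 1 (.r 4) (.c 0)) (.add (.mul (.c 2) (.r 0)) (.c 2)))
    (.sub (.add (.r 0) (.arr 7 (.r 4) (.c 0))) (.arr 6 (.r 4) (.c 0)))))
  (.seq (.loop 4 0 (.seq
    (count 5 0 6 (.mul (.eq (.arr 5 (.r 5) (.c 0)) (.arr 5 (.r 4) (.c 0)))
      (.add (.lt (.arr 8 (.r 5) (.c 0)) (.arr 8 (.r 4) (.c 0)))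
        (.mul (.eq (.arr 8 (.r 5) (.c 0)) (.arr 8 (.r 4) (.c 0))) (.lt (.r 5) (.r 4))))))
    (.put 9 (.arr 5 (.r 4) (.c 0)) (.r 6) (.r 4))))
  (.seq (count 4 0 9 (.not (.arr 5 (.r 4) (.c 0)))) (count 4 0 10 (.arr 5 (.r 4) (.c 0)))))))

/-- The rows `0` and `1` of array `9` list the two sides of a strong ordering, whose cardinalities are
in the registers `9` and `10`. -/
structure Sorted (O : StrongOrdering G) (h : Store) : Prop where
  reg_nine : h.reg 9 = O.cardU
  reg_ten : h.reg 10 = O.flip.cardU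
  left : ∀ v ∈ O.U, h.arr 9 0 (O.pos v) = v
  right : ∀ v ∈ O.W, h.arr 9 1 (O.pos v) = v

theorem wp_sortSides {h : Store} {lam : Fin n → ℕ} (hL : Loaded G h)
    (hM : 4 * (n + 2) * (n + 2) ≤ M)
    (hadj : ∀ {u v}, G.Adj u v → lam v = lam u + 1 ∨ lam u = lam v + 1) (hN : NestedLayers G lam)
    (hle : ∀ v, lam v ≤ 2 * n + 1)
    (hl : ∀ v : Fin n, h.arr 1 v 0 = lam v ∧ h.arr 5 v 0 = lam v % 2) :
    wp M n inp sortSides (Sorted (layerOrdering hadj hN)) h := by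
  have hnM : n + 1 ≤ M := by nlinarith
  refine wp_seq (wp_fillCount_fin (fun v w => G.Adj w v ∧ lam w + 1 = lam v) hL.reg_zero
    (by omega) ?_) fun h₁ H₁ F₁ => ?_
  · intro v w h' e1 e2 e3 e4
    rw [Ex.mul_ne_zero', Ex.eq_ne_zero]
    simp [Ex.val, e3, e4, e1 0 (by decide), e1 1 (by decide), hL.adj, hl]
  have L₁ : Loaded G h₁ := hL.frame F₁ rfl rfl rfl rfl
  have hl₁ : ∀ v : Fin n, h₁.arr 1 v 0 = lam v ∧ h₁.arr 5 v 0 = lam v % 2 := fun v => by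
    rw [F₁.2 1 rfl, F₁.2 5 rfl]; exact hl v
  refine wp_seq (wp_fillCount_fin (fun v w => G.Adj w v ∧ lam w = lam v + 1) L₁.reg_zero
    (by omega) ?_) fun h₂ H₂ F₂ => ?_
  · intro v w h' e1 e2 e3 e4
    rw [Ex.mul_ne_zero', Ex.eq_ne_zero]
    simp [Ex.val, e3, e4, e1 0 (by decide), e1 1 (by decide), L₁.adj, hl₁]
  have L₂ : Loaded G h₂ := L₁.frame F₂ rfl rfl rfl rfl
  have hl₂ : ∀ v : Fin n, h₂.arr 1 v 0 = lam v ∧ h₂.arr 5 v 0 = lam v % 2 := fun v => by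
    rw [F₂.2 1 rfl, F₂.2 5 rfl]; exact hl₁ v
  refine wp_seq (wp_fill_fin (layerKey G lam) L₂.reg_zero ?_) fun h₃ H₃ F₃ => ?_
  · intro v h' e1 e2 e3
    constructor
    · simp only [Ex.val, e3, e1 1 (by decide), e1 6 (by decide), e1 7 (by decide), e2 0 (by decide),
        L₂.reg_zero, hl₂, H₂, F₂.2 6 rfl, H₁, layerKey, inDeg, outDeg]
      congr!
    · have h1 := Nat.mul_le_mul_right (2 * n + 2) (hle v)
      have h2 := outDeg_le G lam v
      simp only [layerKey]
      have : n + outDeg G lam v - inDeg G lam v ≤ 2 * n := by omega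
      nlinarith
  have L₃ : Loaded G h₃ := L₂.frame F₃ rfl rfl rfl rfl
  have hl₃ : ∀ v : Fin n, h₃.arr 5 v 0 = lam v % 2 := fun v => by
    rw [F₃.2 5 rfl]; exact (hl₂ v).2
  set O := layerOrdering hadj hN with hO
  have hU : ∀ v, v ∈ O.U ↔ lam v % 2 = 0 := fun v => Iff.rfl
  have hW : ∀ v, v ∈ O.W ↔ lam v % 2 = 1 := fun v => Iff.rfl
  have hlt : ∀ w v, O.lt w v ↔ lam w % 2 = lam v % 2 ∧ (layerKey G lam w < layerKey G lam v ∨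
    (layerKey G lam w = layerKey G lam v ∧ w < v)) := fun w v => Iff.rfl
  have hpos : ∀ v, O.pos v ≤ n := fun v => (Finset.card_le_univ _).trans (by simp)
  refine wp_seq (Q := fun h' => ∀ v : Fin n, h'.arr 9 (lam v % 2) (O.pos v) = v)
    (wp_loop (fun k h' => ∀ v : Fin n, (v : ℕ) < k → h'.arr 9 (lam v % 2) (O.pos v) = v)
      (by simp) ?_ ?_) fun h₄ H₄ F₄ => ?_
  · intro k hk h' hI hF
    rw [L₃.reg_zero] at hk
    set v : Fin n := ⟨k, hk⟩ with hv
    have L' : Loaded G h' := L₃.frame hF rfl rfl rfl rfl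
    have key : ∀ w : Fin n, h'.arr 8 w 0 = layerKey G lam w := fun w => by rw [hF.2 8 rfl, H₃]
    have side : ∀ w : Fin n, h'.arr 5 w 0 = lam w % 2 := fun w => by rw [hF.2 5 rfl, hl₃]
    refine wp_seq (wp_count_fin (fun w => O.lt w v) (by decide) (by decide)
      (by simp [L'.reg_zero]) (by omega) ?_) fun h₅ H₅ F₅ => ?_
    · intro w h'' e1 e2 e3
      have e4 : h''.reg 4 = v := by rw [e2 4 (by decide) (by decide)]; simp [hv]
      simp only [Ex.mul_ne_zero', Ex.add_ne_zero', Ex.eq_ne_zero, Ex.lt_ne_zero, hlt, Fin.lt_def]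
      simp only [Ex.val, e3, e4, e1, Store.setReg_arr, key, side]
    · have h4 : h₅.reg 4 = v := by rw [F₅.1 4 rfl]; simp [hv]
      have h5 : h₅.arr 5 v 0 = lam v % 2 := by rw [F₅.2 5 rfl]; exact side v
      have h6 : h₅.reg 6 = O.pos v := H₅
      refine ⟨by simp only [Ex.val, h4]; omega, fun w hw => ?_⟩
      simp only [Ex.val, Store.setArr_arr, h4, h5, h6, true_and]
      by_cases hwv : w = v
      · subst hwv; simp
      · rw [if_neg, F₅.2 9 rfl]
        · exact hI w (by
            have : (w : ℕ) ≠ k := fun e => hwv (Fin.ext e)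
            omega)
        · rintro ⟨h1, h2⟩
          exact hwv (O.pos_inj (by rw [hU, hU, h1]) h2)
  · intro h' hI _ v
    exact hI v (by rw [L₃.reg_zero]; exact v.2)
  have L₄ : Loaded G h₄ := L₃.frame F₄ rfl rfl rfl rfl
  have hl₄ : ∀ v : Fin n, h₄.arr 5 v 0 = lam v % 2 := fun v => by rw [F₄.2 5 rfl, hl₃]
  refine wp_seq (wp_count_fin (fun v => v ∈ O.U) (by decide) (by decide) L₄.reg_zero (by omega) ?_)
    fun h₅ H₅ F₅ => ?_
  · intro v h' e1 e2 e3
    rw [Ex.not_ne_zero, hU]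
    simp [Ex.val, e3, e1, hl₄]
  have L₅ : Loaded G h₅ := L₄.frame F₅ rfl rfl rfl rfl
  refine wp_mono (fun h' hh => ?_) (wp_frame (wp_count_fin (fun v => v ∈ O.W) (by decide) (by decide)
    L₅.reg_zero (by omega) ?_))
  · obtain ⟨H₆, F₆⟩ := hh
    refine ⟨by rw [F₆.1 9 rfl, H₅]; rfl, H₆, fun v hv => ?_, fun v hv => ?_⟩
    · rw [F₆.2 9 rfl, F₅.2 9 rfl, ← (hU v).mp hv, H₄ v]
    · rw [F₆.2 9 rfl, F₅.2 9 rfl, ← (hW v).mp hv, H₄ v]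
  · intro v h' e1 e2 e3
    rw [hW]
    simp [Ex.val, e3, e1, F₅.2 5 rfl, hl₄]

end

end Cmd

/-! ### The dynamic program as a command -/

namespace Cmd

/-- The adjacency of the `i`-th vertex of the first side and the `j`-th vertex of the second side. -/
def edge (i j : Ex) : Ex := .arr 0 (.arr 9 (.c 0) i) (.arr 9 (.c 1) j)

/-- Lengths of the runs of neighbors on the second side. -/
def runsRight : Cmd := fillTable 10
  (.mul (.mul (.bit (.r 5)) (.bit (edge (.r 4) (.sub (.r 5) (.c 1)))))
    (.add (.arr 10 (.r 4) (.sub (.r 5) (.c 1))) (.c 1)))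

/-- Lengths of the runs of neighbors on the first side. -/
def runsLeft : Cmd := fillTable 11
  (.mul (.mul (.bit (.r 4)) (.bit (edge (.sub (.r 4) (.c 1)) (.r 5))))
    (.add (.arr 11 (.sub (.r 4) (.c 1)) (.r 5)) (.c 1)))

/-- The last possible centers of a star whose `s + 1` candidates for leaves are consecutive on the
second side. -/
def lastLeft : Cmd := fillTable 12
  (.mul (.bit (.r 4)) (.add
    (.mul (.bit (.le (.add (.r 1) (.c 1)) (.arr 10 (.sub (.r 4) (.c 1)) (.r 5)))) (.r 4))
    (.mul (.not (.le (.add (.r 1) (.c 1)) (.arr 10 (.sub (.r 4) (.c 1)) (.r 5))))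
      (.arr 12 (.sub (.r 4) (.c 1)) (.r 5)))))

/-- The last possible centers of a star whose `s + 1` candidates for leaves are consecutive on the
first side. -/
def lastRight : Cmd := fillTable 13
  (.mul (.bit (.r 5)) (.add
    (.mul (.bit (.le (.add (.r 1) (.c 1)) (.arr 11 (.r 4) (.sub (.r 5) (.c 1))))) (.r 5))
    (.mul (.not (.le (.add (.r 1) (.c 1)) (.arr 11 (.r 4) (.sub (.r 5) (.c 1)))))
      (.arr 13 (.r 4) (.sub (.r 5) (.c 1))))))

/-- The prefixes of the two sides that can be partitioned. -/
def reachTable : Cmd := fillTable 14 (.bit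
  (.add (.mul (.eq (.r 4) (.c 0)) (.eq (.r 5) (.c 0)))
  (.add (.mul (.lt (.c 0) (.r 4)) (.mul (.le (.r 1) (.r 5))
    (.mul (.arr 14 (.sub (.r 4) (.c 1)) (.sub (.r 5) (.r 1)))
      (.le (.r 1) (.arr 10 (.sub (.r 4) (.c 1)) (.r 5))))))
  (.add (.mul (.le (.r 1) (.r 4)) (.mul (.lt (.c 0) (.r 5))
    (.mul (.arr 14 (.sub (.r 4) (.r 1)) (.sub (.r 5) (.c 1)))
      (.le (.r 1) (.arr 11 (.r 4) (.sub (.r 5) (.c 1)))))))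
  (.mul (.le (.add (.r 1) (.c 1)) (.r 4)) (.mul (.le (.add (.r 1) (.c 1)) (.r 5))
    (.mul (.arr 14 (.sub (.r 4) (.add (.r 1) (.c 1))) (.sub (.r 5) (.add (.r 1) (.c 1))))
      (.mul (.lt (.sub (.r 4) (.add (.r 1) (.c 1))) (.arr 12 (.r 4) (.r 5)))
        (.lt (.sub (.r 5) (.add (.r 1) (.c 1))) (.arr 13 (.r 4) (.r 5)))))))))))

/-- The dynamic program; the table entry for the whole graph goes to register `11`. -/
def decideReach : Cmd :=
  .seq runsRight (.seq runsLeft (.seq lastLeft (.seq lastRight (.seq reachTable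
    (.set 11 (.arr 14 (.r 9) (.r 10)))))))

variable {M n s : ℕ} {inp : ℕ → ℕ → ℕ} {h : Store} {E : ℕ → ℕ → Prop}

theorem wp_runsRight (h3 : h.reg 3 = n + 1) (hM : n ≤ M)
    (hE : ∀ i j, h.arr 0 (h.arr 9 0 i) (h.arr 9 1 j) ≠ 0 ↔ E i j) :
    wp M n inp runsRight (fun h' => ∀ i ≤ n, ∀ j ≤ n, h'.arr 10 i j = runLength E i j) h := by
  refine wp_fillTable _ h3 fun x hx y hy h' e1 e2 e3 e4 e5 =>
    ⟨?_, (runLength_le E x y).trans (hy.trans hM)⟩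
  rcases y with - | y
  · simp [Ex.val, e4, runLength]
  · have h1 := e5 x y hx (by omega) (Or.inr ⟨rfl, by omega⟩)
    have h2 := hE x y
    simp only [Ex.val, Ex.val_bit, edge, e3, e4, Nat.add_sub_cancel, h1, e1 0 (by decide),
      e1 9 (by decide), runLength]
    by_cases hxy : E x y
    · simp [hxy, h2.mpr hxy]
    · simp [hxy, not_not.mp (mt h2.mp hxy)]

theorem wp_runsLeft (h3 : h.reg 3 = n + 1) (hM : n ≤ M)
    (hE : ∀ i j, h.arr 0 (h.arr 9 0 i) (h.arr 9 1 j) ≠ 0 ↔ E i j) :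
    wp M n inp runsLeft
      (fun h' => ∀ i ≤ n, ∀ j ≤ n, h'.arr 11 i j = runLength (fun b a => E a b) j i) h := by
  refine wp_fillTable (fun i j => runLength (fun b a => E a b) j i) h3 fun x hx y hy h' e1 e2 e3 e4 e5 =>
    ⟨?_, (runLength_le _ y x).trans (hx.trans hM)⟩
  rcases x with - | x
  · simp [Ex.val, e3, runLength]
  · have h1 := e5 x y (by omega) hy (Or.inl (by omega))
    have h2 := hE x y
    simp only [Ex.val, Ex.val_bit, edge, e3, e4, Nat.add_sub_cancel, h1, e1 0 (by decide),
      e1 9 (by decide), runLength]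
    by_cases hxy : E x y
    · simp [hxy, h2.mpr hxy]
    · simp [hxy, not_not.mp (mt h2.mp hxy)]

theorem wp_lastLeft (h3 : h.reg 3 = n + 1) (hM : n ≤ M) (h1 : h.reg 1 = s)
    (hE : ∀ i ≤ n, ∀ j ≤ n, h.arr 10 i j = runLength E i j) :
    wp M n inp lastLeft (fun h' => ∀ i ≤ n, ∀ j ≤ n,
      h'.arr 12 i j = lastBelow (fun a => s + 1 ≤ runLength E a j) i) h := by
  refine wp_fillTable (fun i j => lastBelow (fun a => s + 1 ≤ runLength E a j) i) h3
    fun x hx y hy h' e1 e2 e3 e4 e5 => ⟨?_, (lastBelow_le _ x).trans (hx.trans hM)⟩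
  rcases x with - | x
  · simp [Ex.val, e3, lastBelow]
  · have h2 := e5 x y (by omega) hy (Or.inl (by omega))
    have h4 := Ex.le_ne_zero h' (.add (.r 1) (.c 1)) (.arr 10 (.sub (.r 4) (.c 1)) (.r 5))
    simp only [Ex.val, e3, e4, Nat.add_sub_cancel, e1 10 (by decide), e2 1 (by decide) (by decide), h1,
      hE x (by omega) y hy] at h4
    simp only [Ex.val, Ex.val_bit, Ex.val_not, e3, e4, Nat.add_sub_cancel, h2, lastBelow]
    by_cases hxy : s + 1 ≤ runLength E x y
    · rw [if_pos hxy, if_neg (h4.mpr hxy), if_neg (h4.mpr hxy)]; simp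
    · have := not_not.mp (mt h4.mp hxy)
      rw [if_neg hxy, if_pos this, if_pos this]; simp

theorem wp_lastRight (h3 : h.reg 3 = n + 1) (hM : n ≤ M) (h1 : h.reg 1 = s)
    (hE : ∀ i ≤ n, ∀ j ≤ n, h.arr 11 i j = runLength (fun b a => E a b) j i) :
    wp M n inp lastRight (fun h' => ∀ i ≤ n, ∀ j ≤ n,
      h'.arr 13 i j = lastBelow (fun b => s + 1 ≤ runLength (fun b a => E a b) b i) j) h := by
  refine wp_fillTable (fun i j => lastBelow (fun b => s + 1 ≤ runLength (fun b a => E a b) b i) j) h3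
    fun x hx y hy h' e1 e2 e3 e4 e5 => ⟨?_, (lastBelow_le _ y).trans (hy.trans hM)⟩
  rcases y with - | y
  · simp [Ex.val, e4, lastBelow]
  · have h2 := e5 x y hx (by omega) (Or.inr ⟨rfl, by omega⟩)
    have h4 := Ex.le_ne_zero h' (.add (.r 1) (.c 1)) (.arr 11 (.r 4) (.sub (.r 5) (.c 1)))
    simp only [Ex.val, e3, e4, Nat.add_sub_cancel, e1 11 (by decide), e2 1 (by decide) (by decide), h1,
      hE x hx y (by omega)] at h4
    simp only [Ex.val, Ex.val_bit, Ex.val_not, e3, e4, Nat.add_sub_cancel, h2, lastBelow]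
    by_cases hxy : s + 1 ≤ runLength (fun b a => E a b) y x
    · rw [if_pos hxy, if_neg (h4.mpr hxy), if_neg (h4.mpr hxy)]; simp
    · have := not_not.mp (mt h4.mp hxy)
      rw [if_neg hxy, if_pos this, if_pos this]; simp

theorem wp_reachTable (h3 : h.reg 3 = n + 1) (hM : 1 ≤ M) (h1 : h.reg 1 = s)
    (h10 : ∀ i ≤ n, ∀ j ≤ n, h.arr 10 i j = runLength E i j)
    (h11 : ∀ i ≤ n, ∀ j ≤ n, h.arr 11 i j = runLength (fun b a => E a b) j i)
    (h12 : ∀ i ≤ n, ∀ j ≤ n, h.arr 12 i j = lastBelow (fun a => s + 1 ≤ runLength E a j) i)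
    (h13 : ∀ i ≤ n, ∀ j ≤ n,
      h.arr 13 i j = lastBelow (fun b => s + 1 ≤ runLength (fun b a => E a b) b i) j) :
    wp M n inp reachTable
      (fun h' => ∀ i ≤ n, ∀ j ≤ n, h'.arr 14 i j = if Reach E s i j then 1 else 0) h := by
  refine wp_fillTable (fun i j => if Reach E s i j then 1 else 0) h3
    fun x hx y hy h' e1 e2 e3 e4 e5 => ⟨?_, by split_ifs <;> omega⟩
  have hne : ∀ x' y', x' ≤ n → y' ≤ n → (x' < x ∨ (x' = x ∧ y' < y)) →
      (h'.arr 14 x' y' ≠ 0 ↔ Reach E s x' y') := by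
    intro x' y' hx' hy' hlt
    rw [e5 x' y' hx' hy' hlt]
    split_ifs with hr <;> simp [hr]
  rw [Ex.val_bit]
  have key : ∀ {a : ℕ} {p : Prop}, (a ≠ 0 ↔ p) → (if a = 0 then 0 else 1) = if p then 1 else 0 := by
    intro a p hp
    by_cases h0 : a = 0
    · rw [if_pos h0, if_neg (fun hh => hp.mpr hh h0)]
    · rw [if_neg h0, if_pos (hp.mp h0)]
  apply key
  rw [reach_iff_tables]
  simp only [Ex.add_ne_zero', Ex.mul_ne_zero', Ex.eq_ne_zero, Ex.lt_ne_zero, Ex.le_ne_zero]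
  simp only [Ex.val, e3, e4, e2 1 (by decide) (by decide), h1, e1 10 (by decide), e1 11 (by decide),
    e1 12 (by decide), e1 13 (by decide), h10 (x - 1) (by omega) y hy, h11 x hx (y - 1) (by omega),
    h12 x hx y hy, h13 x hx y hy]
  refine or_congr Iff.rfl (or_congr ?_ (or_congr ?_ ?_))
  · refine and_congr_right fun i1 => and_congr_right fun i2 => and_congr_left fun _ => ?_
    exact hne _ _ (by omega) (by omega) (by omega)
  · refine and_congr_right fun i1 => and_congr_right fun i2 => and_congr_left fun _ => ?_
    exact hne _ _ (by omega) (by omega) (by omega)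
  · refine and_congr_right fun i1 => and_congr_right fun i2 => and_congr_left fun _ => ?_
    exact hne _ _ (by omega) (by omega) (by omega)

theorem wp_decideReach (h3 : h.reg 3 = n + 1) (hM : n + 1 ≤ M) (h1 : h.reg 1 = s)
    (h9 : h.reg 9 ≤ n) (h10 : h.reg 10 ≤ n)
    (hE : ∀ i j, h.arr 0 (h.arr 9 0 i) (h.arr 9 1 j) ≠ 0 ↔ E i j) :
    wp M n inp decideReach
      (fun h' => h'.reg 11 = if Reach E s (h.reg 9) (h.reg 10) then 1 else 0) h := by
  refine wp_seq (wp_runsRight h3 (by omega) hE) fun h₁ H₁ F₁ => ?_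
  refine wp_seq (wp_runsLeft (E := E) (by rw [F₁.1 3 rfl, h3]) (by omega) ?_) fun h₂ H₂ F₂ => ?_
  · intro i j
    rw [F₁.2 0 rfl, F₁.2 9 rfl, hE]
  have A₂ : ∀ i ≤ n, ∀ j ≤ n, h₂.arr 10 i j = runLength E i j := by rw [F₂.2 10 rfl]; exact H₁
  refine wp_seq (wp_lastLeft (E := E) (s := s) (by rw [F₂.1 3 rfl, F₁.1 3 rfl, h3]) (by omega)
    (by rw [F₂.1 1 rfl, F₁.1 1 rfl, h1]) A₂) fun h₃ H₃ F₃ => ?_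
  refine wp_seq (wp_lastRight (E := E) (s := s) (by rw [F₃.1 3 rfl, F₂.1 3 rfl, F₁.1 3 rfl, h3])
    (by omega) (by rw [F₃.1 1 rfl, F₂.1 1 rfl, F₁.1 1 rfl, h1]) (by rw [F₃.2 11 rfl]; exact H₂))
    fun h₄ H₄ F₄ => ?_
  refine wp_seq (wp_reachTable (E := E) (s := s)
    (by rw [F₄.1 3 rfl, F₃.1 3 rfl, F₂.1 3 rfl, F₁.1 3 rfl, h3])
    (by omega) (by rw [F₄.1 1 rfl, F₃.1 1 rfl, F₂.1 1 rfl, F₁.1 1 rfl, h1])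
    (by rw [F₄.2 10 rfl, F₃.2 10 rfl]; exact A₂)
    (by rw [F₄.2 11 rfl, F₃.2 11 rfl]; exact H₂)
    (by rw [F₄.2 12 rfl]; exact H₃) H₄) fun h₅ H₅ F₅ => ?_
  have r9 : h₅.reg 9 = h.reg 9 := by
    rw [F₅.1 9 rfl, F₄.1 9 rfl, F₃.1 9 rfl, F₂.1 9 rfl, F₁.1 9 rfl]
  have r10 : h₅.reg 10 = h.reg 10 := by
    rw [F₅.1 10 rfl, F₄.1 10 rfl, F₃.1 10 rfl, F₂.1 10 rfl, F₁.1 10 rfl]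
  have hval : (Ex.arr 14 (.r 9) (.r 10)).val h₅ = if Reach E s (h.reg 9) (h.reg 10) then 1 else 0 := by
    simp only [Ex.val, r9, r10]
    exact H₅ _ h9 _ h10
  refine ⟨?_, ?_⟩
  · rw [hval]; split_ifs <;> omega
  · rw [hval]; simp

end Cmd

/-! ### The program -/

theorem Reach.mono {E E' : ℕ → ℕ → Prop} {s i j : ℕ} (h : Reach E s i j)
    (hE : ∀ a < i, ∀ b < j, E a b → E' a b) : Reach E' s i j := by
  induction h with
  | zero => exact .zero
  | left _ h' ih =>
    exact (ih fun a ha b hb => hE a (by omega) b (by omega)).left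
      fun b hb => hE _ (by omega) _ (by omega) (h' b hb)
  | right _ h' ih =>
    exact (ih fun a ha b hb => hE a (by omega) b (by omega)).right
      fun a ha => hE _ (by omega) _ (by omega) (h' a ha)
  | pair _ h₁ h₂ ih =>
    obtain ⟨a, ha, h₁⟩ := h₁
    obtain ⟨b, hb, h₂⟩ := h₂
    exact (ih fun a ha b hb => hE a (by omega) b (by omega)).pair
      ⟨a, ha, fun b hb => hE _ (by omega) _ (by omega) (h₁ b hb)⟩
      ⟨b, hb, fun a ha => hE _ (by omega) _ (by omega) (h₂ a ha)⟩

namespace Cmd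

/-- On sorted sides the dynamic program decides Star Partition. -/
theorem Sorted.reach_iff {n s : ℕ} {G : SimpleGraph (Fin n)} {O : StrongOrdering G} {h : Store}
    (hS : Sorted O h) (hL : Loaded G h) :
    Reach (fun i j => h.arr 0 (h.arr 9 0 i) (h.arr 9 1 j) ≠ 0) s O.cardU O.flip.cardU ↔
      HasStarPartition G s := by
  rcases Nat.eq_zero_or_pos n with rfl | hn
  · have h1 : O.cardU = 0 := by simp [StrongOrdering.cardU]
    have h2 : O.flip.cardU = 0 := by simp [StrongOrdering.cardU]
    rw [h1, h2, hasStarPartition_iff]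
    exact iff_of_true .zero ⟨∅, by simp, by simp, fun v => v.elim0⟩
  · let f : ℕ → ℕ → Fin n := fun k i =>
      if hi : h.arr 9 k i < n then ⟨h.arr 9 k i, hi⟩ else ⟨0, hn⟩
    have hu : O.Lists (f 0) := fun v hv => by simp [f, hS.left v hv]
    have hw : O.flip.Lists (f 1) := fun v hv => by
      rw [StrongOrdering.pos_flip]
      simp [f, hS.right v hv]
    rw [← StrongOrdering.reach_iff_hasStarPartition hu hw]
    have key : ∀ a < O.cardU, ∀ b < O.flip.cardU,
        (h.arr 0 (h.arr 9 0 a) (h.arr 9 1 b) ≠ 0 ↔ G.Adj (f 0 a) (f 1 b)) := by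
      intro a ha b hb
      have h1 := hu.mem ha
      have h2 := hw.mem hb
      have e1 := hS.left _ h1.1
      have e2 := hS.right _ h2.1
      rw [h1.2] at e1
      rw [StrongOrdering.pos_flip] at h2
      rw [h2.2] at e2
      rw [e1, e2, hL.adj]
      simp
    exact ⟨fun hr => hr.mono fun a ha b hb => (key a ha b hb).mp,
      fun hr => hr.mono fun a ha b hb => (key a ha b hb).mpr⟩

/-- The algorithm for Star Partition; the answer goes to register `11`. -/
def main : Cmd := .seq load (.seq layers (.seq sortSides decideReach))

theorem wp_main {M n s : ℕ} {G : SimpleGraph (Fin n)} (O : StrongOrdering G) {h : Store}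
    (h0 : h.reg 0 = n) (h1 : h.reg 1 = s) (h3 : h.reg 3 = n + 1) (hM : 4 * (n + 2) * (n + 2) ≤ M) :
    wp M n (inputMatrix G) main (fun h' => h'.reg 11 = if HasStarPartition G s then 1 else 0) h := by
  refine wp_seq (wp_load h0 h3 hM) fun h₁ L₁ F₁ => ?_
  refine wp_seq (wp_layers O L₁ hM) ?_
  rintro h₂ ⟨lam, hadj, hN, hle, hl⟩ F₂
  have L₂ : Loaded G h₂ := L₁.frame F₂ rfl rfl rfl rfl
  refine wp_seq (wp_sortSides L₂ hM hadj hN hle hl) fun h₃ S₃ F₃ => ?_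
  have L₃ : Loaded G h₃ := L₂.frame F₃ rfl rfl rfl rfl
  have hc : ∀ O' : StrongOrdering G, O'.cardU ≤ n := fun O' =>
    (Finset.card_le_univ _).trans (by simp)
  refine wp_mono (fun h' hh => ?_) (wp_decideReach (s := s) L₃.reg_three (by nlinarith)
    (by rw [F₃.1 1 rfl, F₂.1 1 rfl, F₁.1 1 rfl, h1]) (by rw [S₃.reg_nine]; exact hc _)
    (by rw [S₃.reg_ten]; exact hc _) fun i j => Iff.rfl)
  rw [hh, S₃.reg_nine, S₃.reg_ten, S₃.reach_iff L₃]

end Cmd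

theorem solvableInTime : SolvableInTime (fun _ G => IsBipartitePermutationGraph G)
    (fun n => n ^ 2) := by
  obtain ⟨K, hK⟩ := Cmd.main.exists_time_le
  have hdepth : Cmd.main.depth = 2 := rfl
  rw [hdepth] at hK
  set e₂ : Expr := .mul (.reg 0) (.reg 0) with he₂
  set e₃ : Expr := .add (.reg 0) (.const 1) with he₃
  set e₀ : Expr := .reg 11 with he₀
  refine ⟨.seq (.set 2 e₂) (.seq (.set 3 e₃) (.seq Cmd.main.comp (.set 0 e₀))), 2 * K + 10,
    Cmd.main.comp.deg 4 + (e₂.deg 4 + e₃.deg 4 + e₀.deg 4), fun n s G hG => ?_⟩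
  obtain ⟨O⟩ := hG.nonempty_strongOrdering
  set D := Cmd.main.comp.deg 4 + (e₂.deg 4 + e₃.deg 4 + e₀.deg 4) with hD
  set X := n + s + 2 with hX
  have hX2 : 2 ≤ X := by omega
  have hM : 4 * (n + 2) * (n + 2) ≤ X ^ 4 := by
    have h1 : 2 ^ 2 ≤ X ^ 2 := Nat.pow_le_pow_left hX2 2
    have h2 : (n + 2) ^ 2 ≤ X ^ 2 := Nat.pow_le_pow_left (by omega) 2
    calc 4 * (n + 2) * (n + 2) = 2 ^ 2 * (n + 2) ^ 2 := by ring
      _ ≤ X ^ 2 * X ^ 2 := Nat.mul_le_mul h1 h2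
      _ = X ^ 4 := by ring
  have hXM : X ≤ X ^ 4 := Nat.le_self_pow (by decide) X
  have hn1 : n + 1 ≤ X ^ 4 := by omega
  have hnn : n * n ≤ X ^ 4 := by nlinarith
  set σ := inputState G s with hσ
  have hmem : ∀ a, σ.mem a ≤ 1 := fun a => by simp only [hσ, inputState]; split_ifs <;> omega
  have b₀ : Bdd (X ^ 4) σ := by
    refine ⟨fun i => ?_, fun a => (hmem a).trans (by omega)⟩
    simp only [hσ, inputState]
    split_ifs <;> omega
  have b₁ : Bdd (X ^ 4) ⟨Function.update σ.reg 2 (e₂.eval σ), σ.mem⟩ := b₀.setReg hnn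
  set σ₁ : State := ⟨Function.update σ.reg 2 (e₂.eval σ), σ.mem⟩ with hσ₁
  have b₂ : Bdd (X ^ 4) ⟨Function.update σ₁.reg 3 (e₃.eval σ₁), σ₁.mem⟩ := b₁.setReg hn1
  set σ₂ : State := ⟨Function.update σ₁.reg 3 (e₃.eval σ₁), σ₁.mem⟩ with hσ₂
  set h : Store := ⟨σ₂.reg, fun _ _ _ => 0⟩ with hh
  have hr : Represents n (inputMatrix G) h σ₂ := by
    refine ⟨rfl, fun k i j => ?_, fun i j hi hj => ?_, rfl, rfl, rfl⟩
    · change σ.mem _ = 0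
      simp only [hσ, inputState]
      rw [if_neg]
      rintro ⟨a, b, hab, -⟩
      have h1 := Nat.mul_le_mul_right n (show (a : ℕ) + 1 ≤ n from a.2)
      have h2 := b.2
      rw [add_mul] at h1
      omega
    · change σ.mem _ = _
      simp only [hσ, inputState, inputMatrix]
      congr 1
      apply propext
      constructor
      · rintro ⟨a, b, hab, hadj⟩
        have h1 : i = a := by
          have e1 : (i * n + j) / n = i := by
            rw [mul_comm, Nat.mul_add_div (by omega), Nat.div_eq_of_lt hj, add_zero]
          have e2 : ((a : ℕ) * n + b) / n = a := by
            rw [mul_comm, Nat.mul_add_div (by omega), Nat.div_eq_of_lt b.2, add_zero]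
          rw [← e1, hab, e2]
        subst h1
        exact ⟨a, b, rfl, by omega, hadj⟩
      · rintro ⟨a, b, rfl, rfl, hadj⟩
        exact ⟨a, b, rfl, hadj⟩
  obtain ⟨t, τ, h', hex, ht, hr', hb', hans⟩ := Cmd.exec_comp (D := D) hX2 hn1 Cmd.main
    (Cmd.wp_main (s := s) O (h := h) rfl rfl rfl hM) rfl hr b₂ (by omega)
  refine ⟨_, _, .seq (.set σ 2 e₂ ((e₂.fits_of_bdd hX2 b₀).2 D (by omega)))
    (.seq (.set σ₁ 3 e₃ ((e₃.fits_of_bdd hX2 b₁).2 D (by omega)))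
      (.seq hex (.set τ 0 e₀ ((e₀.fits_of_bdd hX2 hb').2 D (by omega))))), ?_, ?_⟩
  · have h1 := hK (n + 1) (by omega)
    have h2 : K * (n + 1) ^ 2 ≤ K * (2 * n ^ 2 + 2) := by
      apply Nat.mul_le_mul_left
      rcases Nat.lt_or_ge n 1 with h | h <;> nlinarith [Nat.le_self_pow (two_ne_zero) n, sq_nonneg (n - 1)]
    simp only [he₂, he₃, he₀, Expr.cost]
    nlinarith
  · have e : e₀.eval τ = if HasStarPartition G s then 1 else 0 := by
      rw [← hans, ← hr'.reg]; rfl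
    simp only [Function.update_self, e]
    by_cases hP : HasStarPartition G s <;> simp [hP]

end StarPart

theorem theorem3 :
    StarPart.SolvableInTime (fun _ G => StarPart.IsBipartitePermutationGraph G) (fun n => n ^ 2) ∧
    ∀ {V : Type*} [Fintype V] (G : SimpleGraph V) (s : ℕ) (O : StarPart.StrongOrdering G)
      (P : Finset (StarPart.CenteredStar V)), O.IsMinScore s P →
      O.IsGood P ∧
      ∀ X ∈ P, ∀ Y ∈ P, ∀ Z ∈ P, Y ≠ X → Z ≠ X →
        O.Interleaving X Y → O.Interleaving X Z → Y = Z := by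
  exact ⟨StarPart.solvableInTime, fun G s O P h => ⟨h.isGood,
    fun X _ Y hY Z hZ _ _ hXY hXZ => h.interleaving_unique hY hZ hXY hXZ⟩⟩
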